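/- Let $\omega>0$, $T=2\pi/\omega$, $\gamma\in\mathbb R$, $g:\mathbb R\to\mathbb R$, let $\mathbb T_T$ be the one-dimensional torus of period $T$, and put $L_k=-\frac{d^2}{dx^2}-k^2\omega^2g$ with domain $H^2(\mathbb R)\subset L^2(\mathbb R)$. Assume * (C0) $g\in L^\infty(\mathbb R)$ is even, $g\not\equiv0$, and $\gamma\neq0$; * (C1) for every odd $k\in\mathbb N$, $0\notin\sigma_{\mathrm{ess}}(L_k)\cup\sigma_{\mathrm D}(L_k)$, where $\sigma_{\mathrm D}(L_k)$ is the spectrum of $L_k$ with an additional Dirichlet condition at $0$, i.e. of $L_k$ restricted to the functions that are odd around $x=0$. Then for every odd $k\in\mathbb N$ there is a real function $\Phi_k\in H^2(0,\infty)$ with $L_k\Phi_k=0$ on $(0,\infty)$ and $\Phi_k(0)=1$. Let such $\Phi_k$ be given, put $\Phi_{-k}=\Phi_k$, and assume further * (C2) there are $\rho,M>0$ with $|\Phi_k(x)|\le Me^{-\rho x}$ for all $x\ge0$ and all odd $k\in\mathbb N$. Let $\mathbb Z_{odd}=2\mathbb Z+1$ and let sequences indexed by $\mathbb Z_{odd}$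 be extended by $0$ to $\mathbb Z$. Let $(u*v)_k=\sum_{l\in\mathbb Z}u_lv_{k-l}$ and $$\mathrm{Dom}(J)=\{z\in\mathbb R^{\mathbb Z_{odd}}:\ z_{-k}=-z_k,\ |||z|||<\infty\},\qquad |||z|||=\|z*z\|_{\ell^2}^{1/2},$$ which is a real normed space with norm $|||\cdot|||$. Consider on it the functional $$J(z)=\tfrac14\,(z*z*z*z)_0+\frac{T}{\gamma\omega^4}\sum_{k\in\mathbb Z_{odd}}\frac{\Phi_k'(0)}{k^2}\,z_k^2,\qquad (z*z*z*z)_0=\big((z*z)*(z*z)\big)_0 .$$ Theorem. 1. $J$ is well defined on $\mathrm{Dom}(J)$ (all sums in its definition converge), Fréchet differentiable, bounded from below and coercive ($J(z)\to\infty$ as $|||z|||\to\infty$). 2. $J$ attains its minimum over $\mathrm{Dom}(J)$, and this minimum is negative, provided (i) $\gamma<0$ and $\Phi_k'(0)>0$ for at least one odd $k\in\mathbb N$, or (ii) $\gamma>0$ and $\Phi_k'(0)<0$ for at least one odd $k\in\mathbb N$. 3. For every critical point $\alpha\in\mathrm{Dom}(J)$ of $J$ the series $$w(x,t)=\sum_{k\in\mathbb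 Z_{odd}}\frac{\alpha_k}{k}\,\Phi_k(|x|)\,e_k(t),\qquad e_k(t)=\frac1{\sqrt T}e^{i\omega kt},$$ converges for all $(x,t)\in\mathbb R^2$, its sum is real-valued, and $w$ is a $T$-periodic weak solution of $$g(x)w_{tt}-w_{xx}+\gamma\,\delta_0(x)\,(w_t^3)_t=0 ,$$ that is, $w\in H^1(\mathbb R\times\mathbb T_T)$, $\partial_tw(0,\cdot)\in L^3(\mathbb T_T)$ (the weak derivative of the trace of $w$ at $x=0$), and for all $\psi\in C_c^\infty(\mathbb R\times\mathbb T_T)$ $$\int_{\mathbb R\times\mathbb T_T}\big(-g(x)\,\partial_tw\,\partial_t\psi+\partial_xw\,\partial_x\psi\big)\,d(x,t)-\gamma\int_0^T(\partial_tw(0,t))^3\,\partial_t\psi(0,t)\,dt=0 .$$ If $\alpha\neq0$, then $w$ is nontrivial (not almost everywhere zero). -/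

import Mathlib

open MeasureTheory Set Filter Topology
open scoped ENNReal

/-! ### One-dimensional Sobolev functions and the operators `L_k` -/

/-- `u ∈ H²(I)` for an interval `I ⊆ ℝ`, with first derivative `u₁` and second derivative `u₂`:
`u`, `u₁`, `u₂` are square integrable on `I`, and `u`, `u₁` are the (absolutely continuous)
primitives of `u₁`, `u₂`. Thus `u` and `u₁` are the continuous representatives. -/
structure IsH2 {E : Type*} [NormedAddCommGroup E] [NormedSpace ℝ E] (I : Set ℝ)
    (u u₁ u₂ : ℝ → E) : Prop where
  memLp : MemLp u 2 (volume.restrict I)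
  memLp₁ : MemLp u₁ 2 (volume.restrict I)
  memLp₂ : MemLp u₂ 2 (volume.restrict I)
  primitive₁ : ∀ a ∈ I, ∀ b ∈ I, u b - u a = ∫ x in a..b, u₁ x
  primitive₂ : ∀ a ∈ I, ∀ b ∈ I, u₁ b - u₁ a = ∫ x in a..b, u₂ x

/-- The complex Hilbert space `L²(ℝ)`. -/
abbrev L2R : Type := Lp ℂ 2 (volume : Measure ℝ)

theorem IsH2.intervalIntegrable {u u₁ u₂ : ℝ → ℂ} (h : IsH2 univ u u₁ u₂) (a b : ℝ) :
    IntervalIntegrable u₁ volume a b ∧ IntervalIntegrable u₂ volume a b := by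
  have key : ∀ v : ℝ → ℂ, MemLp v 2 (volume.restrict univ) → IntervalIntegrable v volume a b := by
    intro v hv
    rw [Measure.restrict_univ] at hv
    exact ((hv.locallyIntegrable (by norm_num)).integrableOn_isCompact
      isCompact_uIcc).intervalIntegrable
  exact ⟨key _ h.memLp₁, key _ h.memLp₂⟩

theorem IsH2.add {u u₁ u₂ v v₁ v₂ : ℝ → ℂ} (hu : IsH2 univ u u₁ u₂) (hv : IsH2 univ v v₁ v₂) :
    IsH2 univ (u + v) (u₁ + v₁) (u₂ + v₂) where
  memLp := hu.memLp.add hv.memLp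
  memLp₁ := hu.memLp₁.add hv.memLp₁
  memLp₂ := hu.memLp₂.add hv.memLp₂
  primitive₁ a ha b hb := by
    simp only [Pi.add_apply]
    rw [intervalIntegral.integral_add (hu.intervalIntegrable a b).1 (hv.intervalIntegrable a b).1,
      ← hu.primitive₁ a ha b hb, ← hv.primitive₁ a ha b hb]
    ring
  primitive₂ a ha b hb := by
    simp only [Pi.add_apply]
    rw [intervalIntegral.integral_add (hu.intervalIntegrable a b).2 (hv.intervalIntegrable a b).2,
      ← hu.primitive₂ a ha b hb, ← hv.primitive₂ a ha b hb]
    ring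

theorem IsH2.smul {u u₁ u₂ : ℝ → ℂ} (c : ℂ) (hu : IsH2 univ u u₁ u₂) :
    IsH2 univ (c • u) (c • u₁) (c • u₂) where
  memLp := hu.memLp.const_smul c
  memLp₁ := hu.memLp₁.const_smul c
  memLp₂ := hu.memLp₂.const_smul c
  primitive₁ a ha b hb := by
    simp only [Pi.smul_apply]
    rw [intervalIntegral.integral_smul, ← hu.primitive₁ a ha b hb, smul_sub]
  primitive₂ a ha b hb := by
    simp only [Pi.smul_apply]
    rw [intervalIntegral.integral_smul, ← hu.primitive₂ a ha b hb, smul_sub]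

/-- The graph of the operator `L_k = -d²/dx² - k² ω² g` with domain `H²(ℝ)` in `L²(ℝ)`: all pairs
`(u, f)` with `u ∈ H²(ℝ)` and `f = -u'' - k² ω² g u`. -/
noncomputable def opL (g : ℝ → ℝ) (ω : ℝ) (k : ℕ) : Submodule ℂ (L2R × L2R) where
  carrier := {p | ∃ u u₁ u₂ : ℝ → ℂ, IsH2 univ u u₁ u₂ ∧ p.1 =ᵐ[volume] u ∧
    p.2 =ᵐ[volume] fun x => -u₂ x - ((k : ℝ) ^ 2 * ω ^ 2 * g x : ℝ) * u x}
  zero_mem' := by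
    refine ⟨0, 0, 0, ⟨MemLp.zero, MemLp.zero, MemLp.zero, ?_, ?_⟩, Lp.coeFn_zero _ _ _, ?_⟩
    · intro a _ b _; simp
    · intro a _ b _; simp
    · refine (Lp.coeFn_zero ℂ 2 (volume : Measure ℝ)).trans (Eventually.of_forall fun x => ?_)
      simp
  add_mem' := by
    rintro p q ⟨u, u₁, u₂, hu, hp, hp'⟩ ⟨v, v₁, v₂, hv, hq, hq'⟩
    refine ⟨u + v, u₁ + v₁, u₂ + v₂, hu.add hv, ?_, ?_⟩
    · filter_upwards [Lp.coeFn_add p.1 q.1, hp, hq] with x h1 h2 h3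
      rw [Prod.fst_add, h1, Pi.add_apply, h2, h3, Pi.add_apply]
    · filter_upwards [Lp.coeFn_add p.2 q.2, hp', hq'] with x h1 h2 h3
      rw [Prod.snd_add, h1, Pi.add_apply, h2, h3, Pi.add_apply, Pi.add_apply]
      ring
  smul_mem' := by
    rintro c p ⟨u, u₁, u₂, hu, hp, hp'⟩
    refine ⟨c • u, c • u₁, c • u₂, hu.smul c, ?_, ?_⟩
    · filter_upwards [Lp.coeFn_smul c p.1, hp] with x h1 h2
      rw [Prod.smul_fst, h1, Pi.smul_apply, h2, Pi.smul_apply]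
    · filter_upwards [Lp.coeFn_smul c p.2, hp'] with x h1 h2
      rw [Prod.smul_snd, h1, Pi.smul_apply, h2, Pi.smul_apply, Pi.smul_apply]
      simp only [smul_eq_mul]
      ring

/-- The closed subspace of `L²(ℝ)` of functions that are odd around `0`. -/
noncomputable def oddL2 : Submodule ℂ L2R where
  carrier := {f | ∃ v : ℝ → ℂ, (∀ x, v (-x) = -v x) ∧ f =ᵐ[volume] v}
  zero_mem' := ⟨0, by simp, Lp.coeFn_zero _ _ _⟩
  add_mem' := by
    rintro a b ⟨u, hu, ha⟩ ⟨v, hv, hb⟩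
    refine ⟨u + v, fun x => ?_, (Lp.coeFn_add a b).trans (ha.add hb)⟩
    simp only [Pi.add_apply, hu, hv]
    ring
  smul_mem' := by
    rintro c a ⟨u, hu, ha⟩
    refine ⟨c • u, fun x => ?_, (Lp.coeFn_smul c a).trans (ha.const_smul c)⟩
    simp only [Pi.smul_apply, hu, smul_neg]

/-- The graph of `L_k` restricted to functions which are odd around `0`, an operator in the
Hilbert space of odd functions. This is `L_k` with an extra Dirichlet condition at `0`. -/
noncomputable def opLOdd (g : ℝ → ℝ) (ω : ℝ) (k : ℕ) : Submodule ℂ (oddL2 × oddL2) :=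
  (opL g ω k).comap (oddL2.subtype.prodMap oddL2.subtype)

section Spectrum

variable {H : Type*} [NormedAddCommGroup H] [NormedSpace ℂ H]

/-- The graph of `A - μ`, if `A` is the graph of an (unbounded) operator. -/
def graphSub (A : Submodule ℂ (H × H)) (μ : ℂ) : Submodule ℂ (H × H) :=
  A.map ((LinearMap.fst ℂ H H).prod (LinearMap.snd ℂ H H - μ • LinearMap.fst ℂ H H))

/-- The spectrum of an (unbounded) operator given by its graph: all `μ` for which `A - μ` has no
bounded everywhere defined inverse. -/
def graphSpectrum (A : Submodule ℂ (H × H)) : Set ℂ :=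
  {μ | ¬ ∃ R : H →L[ℂ] H, ∀ u f : H, (u, f) ∈ graphSub A μ ↔ u = R f}

/-- The essential spectrum of an (unbounded) self-adjoint operator given by its graph: all `μ` for
which `A - μ` is not a Fredholm operator. -/
def graphEssSpectrum (A : Submodule ℂ (H × H)) : Set ℂ :=
  {μ | ¬ (FiniteDimensional ℂ ((graphSub A μ).comap (LinearMap.inl ℂ H H)) ∧
    IsClosed (((graphSub A μ).map (LinearMap.snd ℂ H H) : Submodule ℂ H) : Set H) ∧
    FiniteDimensional ℂ (H ⧸ (graphSub A μ).map (LinearMap.snd ℂ H H)))}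

end Spectrum

/-! ### The assumptions -/

/-- Condition (C0): `g ∈ L^∞(ℝ)` is even and not identically zero, and `γ ≠ 0`. -/
def CondC0 (g : ℝ → ℝ) (γ : ℝ) : Prop :=
  MemLp g ∞ volume ∧ (∀ᵐ x, g (-x) = g x) ∧ ¬ g =ᵐ[volume] 0 ∧ γ ≠ 0

/-- Condition (C1): `0 ∉ σ_ess(L_k) ∪ σ_D(L_k)` for all odd `k ∈ ℕ`. -/
def CondC1 (g : ℝ → ℝ) (ω : ℝ) : Prop :=
  ∀ k : ℕ, Odd k → (0 : ℂ) ∉ graphEssSpectrum (opL g ω k) ∪ graphSpectrum (opLOdd g ω k)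

/-- `φ ∈ H²(0,∞)` with `L_k φ = 0` on `(0,∞)` and `φ(0) = 1`. Only the values of `φ` on `[0,∞)`
matter. -/
def IsDecayingSolution (g : ℝ → ℝ) (ω : ℝ) (k : ℕ) (φ : ℝ → ℝ) : Prop :=
  ∃ φ₁ φ₂ : ℝ → ℝ, IsH2 (Ici 0) φ φ₁ φ₂ ∧
    (∀ᵐ x ∂volume.restrict (Ioi 0), -φ₂ x - (k : ℝ) ^ 2 * ω ^ 2 * g x * φ x = 0) ∧ φ 0 = 1

/-- Condition (C2): a uniform exponential bound for the functions `Φ_k`, `k ∈ ℕ` odd. -/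
def CondC2 (Φ : ℕ → ℝ → ℝ) : Prop :=
  ∃ ρ > 0, ∃ M > 0, ∀ k : ℕ, Odd k → ∀ x : ℝ, 0 ≤ x → |Φ k x| ≤ M * Real.exp (-ρ * x)

/-- The one-sided derivative `φ'(0)` of a function on `[0,∞)`. -/
noncomputable def derivZero (φ : ℝ → ℝ) : ℝ := derivWithin φ (Ici 0) 0

/-! ### Weak solutions of `g(x) w_tt - w_xx + γ δ₀(x) (w_t³)_t = 0` on `ℝ × 𝕋_T`

Functions on the cylinder `ℝ × 𝕋_T` are functions of `(x, t) ∈ ℝ × ℝ` that are `T`-periodic in `t`;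
they are integrated over the period cell `ℝ × (0, T]`. -/

/-- The Lebesgue measure of the cylinder `ℝ × 𝕋_T`, realised on `ℝ × (0, T]`. -/
noncomputable def cylMeasure (T : ℝ) : Measure (ℝ × ℝ) :=
  volume.restrict (univ ×ˢ Ioc 0 T)

/-- The partial derivative with respect to the first variable `x`. -/
noncomputable def partialX (ψ : ℝ × ℝ → ℝ) (p : ℝ × ℝ) : ℝ := deriv (fun x => ψ (x, p.2)) p.1

/-- The partial derivative with respect to the second variable `t`. -/
noncomputable def partialT (ψ : ℝ × ℝ → ℝ) (p : ℝ × ℝ) : ℝ := deriv (fun t => ψ (p.1, t)) p.2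

/-- Test functions `ψ ∈ C_c^∞(ℝ × 𝕋_T)`. -/
structure IsTestFunction (T : ℝ) (ψ : ℝ × ℝ → ℝ) : Prop where
  smooth : ContDiff ℝ (⊤ : ℕ∞) ψ
  periodic : ∀ x t, ψ (x, t + T) = ψ (x, t)
  compactSupport : ∃ R : ℝ, ∀ x t, R < |x| → ψ (x, t) = 0

/-- `w ∈ H¹(ℝ × 𝕋_T)` with weak partial derivatives `wx`, `wt`. -/
structure IsH1Cyl (T : ℝ) (w wx wt : ℝ × ℝ → ℝ) : Prop where
  periodic : ∀ x t, w (x, t + T) = w (x, t)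
  memLp : MemLp w 2 (cylMeasure T)
  memLp_x : MemLp wx 2 (cylMeasure T)
  memLp_t : MemLp wt 2 (cylMeasure T)
  weak_x : ∀ ψ, IsTestFunction T ψ →
    ∫ p, w p * partialX ψ p ∂cylMeasure T = -∫ p, wx p * ψ p ∂cylMeasure T
  weak_t : ∀ ψ, IsTestFunction T ψ →
    ∫ p, w p * partialT ψ p ∂cylMeasure T = -∫ p, wt p * ψ p ∂cylMeasure T

/-- `τ ∈ L²(𝕋_T)` is the trace `w(0, ·)` of `w ∈ H¹(ℝ × 𝕋_T)` with weak `x`-derivative `wx`: the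
function on the boundary for which integration by parts holds on the half cylinder `x > 0`. -/
def IsTraceAtZero (T : ℝ) (w wx : ℝ × ℝ → ℝ) (τ : ℝ → ℝ) : Prop :=
  MemLp τ 2 (volume.restrict (Ioc 0 T)) ∧ ∀ ψ, IsTestFunction T ψ →
    ∫ p in Ioi 0 ×ˢ Ioc 0 T, (w p * partialX ψ p + wx p * ψ p) = -∫ t in Ioc 0 T, τ t * ψ (0, t)

/-- `v` is the weak derivative on the torus `𝕋_T` of `τ`. -/
def IsWeakDerivTorus (T : ℝ) (τ v : ℝ → ℝ) : Prop :=
  ∀ η : ℝ → ℝ, ContDiff ℝ (⊤ : ℕ∞) η → (∀ t, η (t + T) = η t) →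
    ∫ t in Ioc 0 T, τ t * deriv η t = -∫ t in Ioc 0 T, v t * η t

/-- Weak solutions: `w ∈ H¹(ℝ × 𝕋_T)` with `v = ∂_t w(0, ·) ∈ L³(𝕋_T)` and, for every test
function `ψ`, `∫ -g w_t ψ_t + w_x ψ_x d(x,t) - γ ∫₀ᵀ (∂_t w(0,t))³ ∂_t ψ(0,t) dt = 0`. -/
def IsWeakSolution (g : ℝ → ℝ) (γ T : ℝ) (w : ℝ × ℝ → ℝ) : Prop :=
  ∃ (wx wt : ℝ × ℝ → ℝ) (τ v : ℝ → ℝ), IsH1Cyl T w wx wt ∧ IsTraceAtZero T w wx τ ∧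
    IsWeakDerivTorus T τ v ∧ MemLp v 3 (volume.restrict (Ioc 0 T)) ∧
    ∀ ψ, IsTestFunction T ψ →
      ∫ p, (-g p.1 * wt p * partialT ψ p + wx p * partialX ψ p) ∂cylMeasure T
        - γ * ∫ t in Ioc 0 T, v t ^ 3 * partialT ψ (0, t) = 0

/-! ### Sequence space -/

/-- The convolution `(u * v)_k = ∑_l u_l v_{k-l}` of two real sequences. -/
noncomputable def conv (u v : ℤ → ℝ) (k : ℤ) : ℝ := ∑' l : ℤ, u l * v (k - l)

/-- `|||z||| = ‖z * z‖_{ℓ²}^{1/2}`. -/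
noncomputable def tripleNorm (z : ℤ → ℝ) : ℝ := √√(∑' k : ℤ, conv z z k ^ 2)

/-- Membership in `Dom(J)`: `z` is a real sequence on the odd integers (extended by zero to `ℤ`),
`z_{-k} = -z_k`, the convolution `z * z` converges, and `|||z||| < ∞`, i.e. `z * z ∈ ℓ²`. -/
structure IsDomJ (z : ℤ → ℝ) : Prop where
  even_zero : ∀ k, Even k → z k = 0
  odd_symm : ∀ k, z (-k) = -z k
  summable_conv : ∀ k, Summable fun l => z l * z (k - l)
  summable_sq : Summable fun k => conv z z k ^ 2

section SequenceSpace

open AddCircle ComplexConjugate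

/-- Uniqueness of Fourier coefficients of integrable functions on the circle. -/
theorem ae_zero_of_fourierCoeff_zero {f : UnitAddCircle → ℂ} (hf : Integrable f haarAddCircle)
    (h0 : ∀ n : ℤ, fourierCoeff f n = 0) : f =ᵐ[haarAddCircle] 0 := by
  have hcont : ∀ φ : C(UnitAddCircle, ℂ), ∫ t, φ t * f t ∂haarAddCircle = 0 := by
    have hint : ∀ φ : C(UnitAddCircle, ℂ), Integrable (fun t => φ t * f t) haarAddCircle := by
      intro φ
      exact hf.bdd_mul φ.continuous.aestronglyMeasurable
        (Eventually.of_forall fun t => φ.norm_coe_le_norm t)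
    let Λ : C(UnitAddCircle, ℂ) →ₗ[ℂ] ℂ :=
      { toFun := fun φ => ∫ t, φ t * f t ∂haarAddCircle
        map_add' := by
          intro φ ψ
          rw [← integral_add (hint φ) (hint ψ)]
          simp only [ContinuousMap.add_apply, add_mul]
        map_smul' := by
          intro c φ
          rw [RingHom.id_apply, smul_eq_mul, ← integral_const_mul]
          simp only [ContinuousMap.smul_apply, smul_eq_mul, mul_assoc] }
    have hΛb : ∀ φ, ‖Λ φ‖ ≤ (∫ t, ‖f t‖ ∂haarAddCircle) * ‖φ‖ := by
      intro φ
      calc ‖Λ φ‖ ≤ ∫ t, ‖φ t * f t‖ ∂haarAddCircle := norm_integral_le_integral_norm _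
        _ ≤ ∫ t, ‖φ‖ * ‖f t‖ ∂haarAddCircle := by
          refine integral_mono (hint φ).norm (hf.norm.const_mul _) fun t => ?_
          simp only [norm_mul]
          exact mul_le_mul_of_nonneg_right (φ.norm_coe_le_norm t) (norm_nonneg _)
        _ = _ := by rw [integral_const_mul, mul_comm]
    let Λc : C(UnitAddCircle, ℂ) →L[ℂ] ℂ := Λ.mkContinuous _ hΛb
    have hker : (⊤ : Submodule ℂ C(UnitAddCircle, ℂ)) ≤ Λc.ker := by
      rw [← span_fourier_closure_eq_top]
      refine Submodule.topologicalClosure_minimal _ ?_ Λc.isClosed_ker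
      rw [Submodule.span_le]
      rintro _ ⟨n, rfl⟩
      have := h0 (-n)
      simp only [fourierCoeff, neg_neg, smul_eq_mul] at this
      exact this
    intro φ
    exact hker (Submodule.mem_top (x := φ))
  refine ae_eq_zero_of_forall_setIntegral_isClosed_eq_zero hf fun s hs => ?_
  have hδ : ∀ n : ℕ, (0 : ℝ) < 1 / ((n : ℝ) + 1) := fun n => Nat.one_div_pos_of_nat
  have hlim : Tendsto (fun n : ℕ => (1 : ℝ) / ((n : ℝ) + 1)) atTop (𝓝 0) :=
    tendsto_one_div_add_atTop_nhds_zero_nat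
  have hpt := thickenedIndicator_tendsto_indicator_closure hδ hlim s
  rw [hs.closure_eq, tendsto_pi_nhds] at hpt
  have hdom : Tendsto (fun n : ℕ => ∫ t, (((thickenedIndicator (hδ n) s t : NNReal) : ℝ) : ℂ) * f t
      ∂haarAddCircle) atTop (𝓝 (∫ t, s.indicator f t ∂haarAddCircle)) := by
    refine tendsto_integral_of_dominated_convergence (fun t => ‖f t‖) (fun n => ?_) hf.norm
      (fun n => Eventually.of_forall fun t => ?_) (Eventually.of_forall fun t => ?_)
    · refine AEStronglyMeasurable.mul (Continuous.aestronglyMeasurable ?_) hf.1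
      exact Complex.continuous_ofReal.comp
        (NNReal.continuous_coe.comp (thickenedIndicator (hδ n) s).continuous)
    · rw [norm_mul, Complex.norm_real, NNReal.norm_eq]
      refine mul_le_of_le_one_left (norm_nonneg _) ?_
      exact_mod_cast thickenedIndicator_le_one (hδ n) s t
    · have h1 := (Complex.continuous_ofReal.tendsto _).comp
        ((NNReal.continuous_coe.tendsto _).comp (hpt t))
      have h2 := h1.mul_const (f t)
      refine (h2.congr fun n => rfl).trans_eq ?_
      by_cases ht : t ∈ s <;> simp [ht]
  have hzero : ∀ n : ℕ, ∫ t, (((thickenedIndicator (hδ n) s t : NNReal) : ℝ) : ℂ) * f t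
      ∂haarAddCircle = 0 := fun n =>
    hcont ⟨fun t => (((thickenedIndicator (hδ n) s t : NNReal) : ℝ) : ℂ),
      Complex.continuous_ofReal.comp
        (NNReal.continuous_coe.comp (thickenedIndicator (hδ n) s).continuous)⟩
  simp only [hzero] at hdom
  rw [← integral_indicator hs.measurableSet]
  exact (tendsto_nhds_unique hdom tendsto_const_nhds)

/-- Fourier coefficients of a product of two `L²` functions. -/
theorem hasSum_fourierCoeff_mul (U V : Lp ℂ 2 (haarAddCircle (T := (1 : ℝ)))) (k : ℤ) :
    HasSum (fun l => fourierCoeff U l * fourierCoeff V (k - l))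
      (fourierCoeff (fun t => U t * V t) k) := by
  have hW : MemLp (fun t => conj (V t) * fourier k t) 2 (haarAddCircle (T := (1 : ℝ))) := by
    have h1 : MemLp (fun t => conj (V t)) 2 (haarAddCircle (T := (1 : ℝ))) := (Lp.memLp V).star
    refine h1.of_le (h1.1.mul (fourier k).continuous.aestronglyMeasurable) ?_
    refine Eventually.of_forall fun t => ?_
    rw [norm_mul]
    have : ‖fourier k t‖ = 1 := Circle.norm_coe _
    rw [this, mul_one]
  have hs := fourierBasis.hasSum_inner_mul_inner hW.toLp U
  have hr : inner ℂ hW.toLp U = fourierCoeff (fun t => U t * V t) k := by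
    rw [L2.inner_def, fourierCoeff]
    refine integral_congr_ae ?_
    filter_upwards [hW.coeFn_toLp] with t ht
    rw [ht, RCLike.inner_apply, fourier_neg]
    simp only [map_mul, RCLike.conj_conj, smul_eq_mul]
    ring
  rw [hr] at hs
  have hterm : (fun l => fourierCoeff U l * fourierCoeff V (k - l)) =
      fun l => inner ℂ hW.toLp (fourierBasis l) * inner ℂ (fourierBasis l) U := by
    funext l
    rw [← fourierBasis.repr_apply_apply U l, fourierBasis_repr, mul_comm]
    congr 1
    rw [L2.inner_def, fourierCoeff, coe_fourierBasis]
    refine integral_congr_ae ?_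
    filter_upwards [hW.coeFn_toLp, coeFn_fourierLp (T := 1) 2 l] with t ht ht'
    rw [ht, ht', RCLike.inner_apply]
    have : -(k - l) = l + -k := by ring
    rw [this, fourier_add, fourier_neg]
    simp only [map_mul, RCLike.conj_conj, smul_eq_mul]
    ring
  rw [hterm]
  exact hs

/-- The `L²` function on the circle with a given square summable sequence of coefficients. -/
theorem exists_synth (c : ℤ → ℝ) (hc : Summable fun k => c k ^ 2) :
    ∃ U : Lp ℂ 2 (haarAddCircle (T := (1 : ℝ))), ∀ k, fourierCoeff U k = c k := by
  have hm : Memℓp (fun k => (c k : ℂ)) 2 := by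
    rw [memℓp_gen_iff (by norm_num)]
    simpa using hc
  refine ⟨fourierBasis.repr.symm ⟨fun k => (c k : ℂ), hm⟩, fun k => ?_⟩
  rw [← fourierBasis_repr, LinearIsometryEquiv.apply_symm_apply]

/-- If `U` has Fourier coefficients `c`, then `U²` has Fourier coefficients `c * c`. -/
theorem fourier_mul_self_coeff {c : ℤ → ℝ} {U : Lp ℂ 2 (haarAddCircle (T := (1 : ℝ)))}
    (hU : ∀ k, fourierCoeff U k = c k) (k : ℤ) :
    HasSum (fun l => c l * c (k - l)) (conv c c k) ∧
      fourierCoeff (fun t => U t * U t) k = (conv c c k : ℝ) := by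
  have h := hasSum_fourierCoeff_mul U U k
  simp only [hU] at h
  have h1 : Summable fun l => c l * c (k - l) := by
    have := h.summable
    exact_mod_cast this
  refine ⟨h1.hasSum, h.unique ?_⟩
  have h2 := Complex.ofRealCLM.hasSum h1.hasSum
  simpa [Function.comp_def, conv] using h2

theorem memLp_four_iff {U : UnitAddCircle → ℂ} (hm : AEStronglyMeasurable U haarAddCircle) :
    MemLp U 4 haarAddCircle ↔ MemLp (fun t => U t * U t) 2 haarAddCircle := by
  rw [← integrable_norm_rpow_iff hm (by norm_num) (by norm_num),
    memLp_two_iff_integrable_sq_norm (f := fun t => U t * U t) (hm.mul hm)]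
  refine iff_of_eq (congrArg (fun f => Integrable f haarAddCircle) ?_)
  funext t
  simp only [norm_mul]
  norm_num
  ring

/-- If `c * c ∈ ℓ²`, then the Fourier series `U` of `c` is in `L⁴`. -/
theorem memLp_four_of_summable {c : ℤ → ℝ} {U : Lp ℂ 2 (haarAddCircle (T := (1 : ℝ)))}
    (hU : ∀ k, fourierCoeff U k = c k) (hs : Summable fun k => conv c c k ^ 2) :
    MemLp U 4 haarAddCircle := by
  obtain ⟨G, hG⟩ := exists_synth (conv c c) hs
  have hUU : Integrable (fun t => U t * U t) haarAddCircle := (Lp.memLp U).integrable_mul (Lp.memLp U)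
  have hGi : Integrable G haarAddCircle := (Lp.memLp G).integrable (by norm_num)
  have hz := ae_zero_of_fourierCoeff_zero (f := fun t => U t * U t + (-1 : ℂ) * G t)
    (hUU.add (hGi.const_mul _)) (fun n => by
      have h1 := congrFun (fourierCoeff.add hUU (hGi.const_mul (-1))) n
      rw [Pi.add_apply, fourierCoeff.const_mul, (fourier_mul_self_coeff hU n).2, hG] at h1
      refine (h1).trans ?_
      ring)
  rw [memLp_four_iff (Lp.aestronglyMeasurable U)]
  refine (memLp_congr_ae ?_).2 (Lp.memLp G)
  filter_upwards [hz] with t ht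
  have : U t * U t + (-1 : ℂ) * G t = 0 := ht
  linear_combination this

/-- If the Fourier series `U` of `c` is in `L⁴`, then `c * c ∈ ℓ²` and `|||c|||` is the `L⁴` norm
of `U`. -/
theorem summable_of_memLp_four {c : ℤ → ℝ} {U : Lp ℂ 2 (haarAddCircle (T := (1 : ℝ)))}
    (hU : ∀ k, fourierCoeff U k = c k) (h4 : MemLp U 4 haarAddCircle) :
    (Summable fun k => conv c c k ^ 2) ∧ tripleNorm c = ‖h4.toLp U‖ := by
  have h2 := (memLp_four_iff (Lp.aestronglyMeasurable U)).1 h4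
  have hp := hasSum_sq_fourierCoeff h2.toLp
  have hco : ∀ i, ‖fourierCoeff (h2.toLp) i‖ ^ 2 = conv c c i ^ 2 := by
    intro i
    rw [fourierCoeff_congr_ae h2.coeFn_toLp, (fourier_mul_self_coeff hU i).2]
    simp
  simp only [hco] at hp
  refine ⟨hp.summable, ?_⟩
  rw [tripleNorm, hp.tsum_eq, Lp.norm_toLp, h4.eLpNorm_eq_integral_rpow_norm (by norm_num)
    (by norm_num), ENNReal.toReal_ofReal (by positivity)]
  have he : ∫ t, ‖(h2.toLp : UnitAddCircle → ℂ) t‖ ^ 2 ∂haarAddCircle =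
      ∫ t, ‖U t‖ ^ (4 : ENNReal).toReal ∂haarAddCircle := by
    refine integral_congr_ae ?_
    filter_upwards [h2.coeFn_toLp] with t ht
    rw [ht, norm_mul]
    norm_num
    ring
  rw [he, Real.sqrt_eq_rpow, Real.sqrt_eq_rpow, ← Real.rpow_mul
    (integral_nonneg fun t => by positivity)]
  norm_num

theorem IsDomJ.sq_summable {z : ℤ → ℝ} (hz : IsDomJ z) : Summable fun k => z k ^ 2 := by
  have h := (hz.summable_conv 0).neg
  refine h.congr fun k => ?_
  rw [zero_sub, hz.odd_symm]
  ring

theorem IsDomJ.of_memLp_four {c : ℤ → ℝ} {U : Lp ℂ 2 (haarAddCircle (T := (1 : ℝ)))}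
    (hU : ∀ k, fourierCoeff U k = c k) (h4 : MemLp U 4 haarAddCircle)
    (h0 : ∀ k, Even k → c k = 0) (h1 : ∀ k, c (-k) = -c k) : IsDomJ c :=
  ⟨h0, h1, fun k => (fourier_mul_self_coeff hU k).1.summable, (summable_of_memLp_four hU h4).1⟩

theorem IsDomJ.exists_L4 {z : ℤ → ℝ} (hz : IsDomJ z) :
    ∃ U : Lp ℂ 2 (haarAddCircle (T := (1 : ℝ))), (∀ k, fourierCoeff U k = z k) ∧
      MemLp U 4 haarAddCircle := by
  obtain ⟨U, hU⟩ := exists_synth z hz.sq_summable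
  exact ⟨U, hU, memLp_four_of_summable hU hz.summable_sq⟩

theorem IsDomJ.add_aux {z y : ℤ → ℝ} (hz : IsDomJ z) (hy : IsDomJ y) :
    IsDomJ (z + y) ∧ tripleNorm (z + y) ≤ tripleNorm z + tripleNorm y := by
  obtain ⟨U, hU, hU4⟩ := hz.exists_L4
  obtain ⟨V, hV, hV4⟩ := hy.exists_L4
  have hUV : ∀ k, fourierCoeff (U + V : Lp ℂ 2 (haarAddCircle (T := (1 : ℝ)))) k
      = ((z + y) k : ℝ) := by
    intro k
    rw [fourierCoeff_congr_ae (Lp.coeFn_add U V)]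
    refine (congrFun (fourierCoeff.add ((Lp.memLp U).integrable (by norm_num))
      ((Lp.memLp V).integrable (by norm_num))) k).trans ?_
    rw [Pi.add_apply, hU, hV]
    simp
  have h4 : MemLp (U + V : Lp ℂ 2 (haarAddCircle (T := (1 : ℝ)))) 4 haarAddCircle :=
    (memLp_congr_ae (Lp.coeFn_add U V)).2 (hU4.add hV4)
  refine ⟨IsDomJ.of_memLp_four hUV h4 ?_ ?_, ?_⟩
  · intro k hk
    simp [hz.even_zero k hk, hy.even_zero k hk]
  · intro k
    simp only [Pi.add_apply, hz.odd_symm, hy.odd_symm]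
    ring
  · rw [(summable_of_memLp_four hUV h4).2, (summable_of_memLp_four hU hU4).2,
      (summable_of_memLp_four hV hV4).2]
    have hadd : h4.toLp _ = hU4.toLp U + hV4.toLp V := by
      rw [← MemLp.toLp_add]
      exact MemLp.toLp_congr _ _ (Lp.coeFn_add U V)
    have : Fact ((1 : ENNReal) ≤ 4) := ⟨by norm_num⟩
    rw [hadd]
    exact norm_add_le _ _

theorem conv_smul (c : ℝ) (z : ℤ → ℝ) (k : ℤ) : conv (c • z) (c • z) k = c ^ 2 * conv z z k := by
  simp only [conv, Pi.smul_apply, smul_eq_mul, ← tsum_mul_left]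
  exact tsum_congr fun l => by ring

theorem IsDomJ.smul {z : ℤ → ℝ} (hz : IsDomJ z) (c : ℝ) : IsDomJ (c • z) where
  even_zero k hk := by simp [hz.even_zero k hk]
  odd_symm k := by simp [hz.odd_symm k]
  summable_conv k := by
    refine ((hz.summable_conv k).mul_left (c ^ 2)).congr fun l => ?_
    simp only [Pi.smul_apply, smul_eq_mul]
    ring
  summable_sq := by
    refine (hz.summable_sq.mul_left (c ^ 4)).congr fun k => ?_
    rw [conv_smul]
    ring

/-- `Dom(J)` as a linear subspace of the space of all real sequences. -/
def domJSubmodule : Submodule ℝ (ℤ → ℝ) where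
  carrier := {z | IsDomJ z}
  add_mem' hz hy := (IsDomJ.add_aux hz hy).1
  zero_mem' := ⟨by simp, by simp, by simp, by simp [conv]⟩
  smul_mem' c _ hz := IsDomJ.smul hz c

/-- The space `Dom(J)`; it carries the norm `|||·|||`. -/
def DomJ : Type := {z : ℤ → ℝ // z ∈ domJSubmodule}

namespace DomJ

noncomputable instance : AddCommGroup DomJ := inferInstanceAs (AddCommGroup domJSubmodule)

noncomputable instance : Module ℝ DomJ := inferInstanceAs (Module ℝ domJSubmodule)

/-- The underlying sequence of an element of `Dom(J)`. -/
def seq (z : DomJ) : ℤ → ℝ := z.1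

noncomputable instance : Norm DomJ := ⟨fun z => tripleNorm z.seq⟩

theorem norm_def (z : DomJ) : ‖z‖ = tripleNorm z.seq := rfl

theorem seq_add (z y : DomJ) : (z + y).seq = z.seq + y.seq := rfl

theorem seq_smul (c : ℝ) (z : DomJ) : (c • z).seq = c • z.seq := rfl

theorem seq_zero : (0 : DomJ).seq = 0 := rfl

theorem isDomJ (z : DomJ) : IsDomJ z.seq := z.2

theorem ext_seq {z y : DomJ} (h : z.seq = y.seq) : z = y := Subtype.ext h

theorem core : NormedSpace.Core ℝ DomJ where
  norm_nonneg z := Real.sqrt_nonneg _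
  norm_smul c z := by
    rw [norm_def, norm_def, seq_smul, tripleNorm, tripleNorm]
    simp only [conv_smul, mul_pow]
    rw [tsum_mul_left, Real.sqrt_mul (by positivity), Real.sqrt_mul (Real.sqrt_nonneg _)]
    rw [show (c ^ 2) ^ 2 = (|c| ^ 2) ^ 2 by rw [sq_abs], Real.sqrt_sq (by positivity),
      Real.sqrt_sq (abs_nonneg c), Real.norm_eq_abs]
  norm_triangle z y := (IsDomJ.add_aux z.isDomJ y.isDomJ).2
  norm_eq_zero_iff z := by
    constructor
    · intro h
      have hz := z.isDomJ
      have h0 : ∑' k, conv z.seq z.seq k ^ 2 = 0 := by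
        have hn : 0 ≤ ∑' k, conv z.seq z.seq k ^ 2 := tsum_nonneg fun k => sq_nonneg _
        rw [norm_def, tripleNorm, Real.sqrt_eq_zero (Real.sqrt_nonneg _),
          Real.sqrt_eq_zero hn] at h
        exact h
      have h1 : conv z.seq z.seq 0 ^ 2 = 0 :=
        congrFun ((hasSum_zero_iff_of_nonneg fun k => sq_nonneg _).1
          (h0 ▸ hz.summable_sq.hasSum)) 0
      have h2 : ∑' k, z.seq k ^ 2 = 0 := by
        have h3 : conv z.seq z.seq 0 = 0 := by simpa using h1
        rw [conv] at h3
        rw [← neg_eq_zero, ← tsum_neg, ← h3]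
        refine tsum_congr fun l => ?_
        rw [zero_sub, hz.odd_symm]
        ring
      refine ext_seq (funext fun k => ?_)
      have h3 := congrFun ((hasSum_zero_iff_of_nonneg fun k => sq_nonneg (z.seq k)).1
          (h2 ▸ hz.sq_summable.hasSum)) k
      simpa [seq_zero] using h3
    · rintro rfl
      simp [norm_def, seq_zero, tripleNorm, conv]

noncomputable instance : NormedAddCommGroup DomJ := NormedAddCommGroup.ofCore core

noncomputable instance : NormedSpace ℝ DomJ := NormedSpace.ofCore core

end DomJ

end SequenceSpace

/-- The functional
`J(z) = 1/4 (z*z*z*z)_0 + T/(γ ω⁴) ∑_k Φ_k'(0)/k² z_k²`, with `T = 2π/ω` and `Φ_{-k} = Φ_k`. The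
fourfold convolution is `(z*z)*(z*z)`; terms with even `k` vanish. -/
noncomputable def functionalJ (Φ : ℕ → ℝ → ℝ) (γ ω : ℝ) (z : DomJ) : ℝ :=
  1 / 4 * conv (conv z.seq z.seq) (conv z.seq z.seq) 0 +
    (2 * Real.pi / ω) / (γ * ω ^ 4) *
      ∑' k : ℤ, derivZero (Φ k.natAbs) / (k : ℝ) ^ 2 * z.seq k ^ 2

/-- The orthonormal Fourier basis `e_k(t) = T^{-1/2} e^{iωkt}` of `L²(𝕋_T)`, `T = 2π/ω`. -/
noncomputable def fourierMode (ω : ℝ) (k : ℤ) (t : ℝ) : ℂ :=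
  1 / (√(2 * Real.pi / ω) : ℝ) * Complex.exp (Complex.I * ω * k * t)

/-!
The solutions `Φ_k`. The Dirichlet condition `0 ∉ σ_D(L_k)` makes the restriction of `L_k` to odd
functions invertible. If `u` is the odd solution of `L_k u = f`, where `f` is the odd extension of
`L_k e^{-x}`, then `e^{-x} - u` restricted to the half line is the required `Φ_k`
(`exists_isDecayingSolution`). The decay (C2) and the equation bound `Φ_k''` by a multiple of
`k² e^{-ρx}`, so Landau's inequality on intervals of length `1/k` gives
`|Φ_k'(x)| ≤ C k e^{-ρx}` (`exists_deriv_bound`); in particular the weights `Φ_k'(0) / k²` of the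
quadratic part of `J` tend to zero.

The functional. An odd sequence `z` is encoded by the real sine series `u(s) = 2 ∑ z_k sin(2πks)`
on the circle of length one, and `|||z|||` is the `L⁴` norm of `u`. So `Dom(J)` is a closed
subspace of a real `L⁴` space (`DomJ.profileL`), and `J(z) = ¼ ‖u‖⁴ + ∑ q_k z_k²`, where `q_k → 0`
(`DomJ.functionalJ_eq`). Boundedness of `q` gives differentiability and coercivity. As `q_k → 0`,
the quadratic part is weakly continuous (`DomJ.tendsto_weightedForm`), and Clarkson's inequality
(`CircleL4.clarkson`) then turns a componentwise convergent minimising sequence into a Cauchy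
sequence (`DomJ.exists_isMin_quarticFunctional`). If some `q_n` is negative, then `J` is negative
at small multiples of `δ_n - δ_{-n}`.

Critical points. The derivative of `J` in the directions `δ_k - δ_{-k}` shows that the sine
coefficients of `u³` are `-2 q_k α_k` (`DomJ.hasSineCoeffs_cube_of_critical`); being square
summable, they put `u³` in `L²`. The series `w` and its weak derivatives converge in `L²` of the
cylinder, because the time factors are orthogonal and the space factors are dominated by
`c_k e^{-ρ|x|}` with `c ∈ ℓ²` (`exists_cyl_series`). Integrating by parts mode by mode, the linear
part `g w_tt - w_xx` of the equation leaves only the jumps `2 Φ_k'(0)` of the derivatives of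
`Φ_k(|x|)` at `x = 0` (`IsMode.integral_weakForm`). By Parseval's identity the sum of these jumps
cancels the nonlinear boundary term precisely by the Euler-Lagrange equation, since
`∂_t w(0,t) = -ω T^{-1/2} u(t/T)` (`IsModeFamily.isWeakSolution`). This formula also shows that
`w = 0` forces `α = 0`.
-/

/-! ### Functions on the half line -/

/-- On `[0,∞)`, `u` is a primitive of the locally integrable function `u₁`. -/
structure IsHalfLinePrimitive (u u₁ : ℝ → ℝ) : Prop where
  intervalIntegrable : ∀ a ∈ Ici (0 : ℝ), ∀ b ∈ Ici (0 : ℝ), IntervalIntegrable u₁ volume a b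
  sub_eq : ∀ a ∈ Ici (0 : ℝ), ∀ b ∈ Ici (0 : ℝ), u b - u a = ∫ x in a..b, u₁ x

theorem MemLp.intervalIntegrable_of_Ici {v : ℝ → ℝ} (hv : MemLp v 2 (volume.restrict (Ici 0)))
    {a b : ℝ} (ha : a ∈ Ici (0 : ℝ)) (hb : b ∈ Ici (0 : ℝ)) : IntervalIntegrable v volume a b := by
  have hsub : uIcc a b ⊆ Ici 0 := fun x hx => (le_min ha hb).trans hx.1
  have h1 : MemLp v 2 (volume.restrict (uIcc a b)) :=
    hv.mono_measure (Measure.restrict_mono hsub le_rfl)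
  have : IsFiniteMeasure (volume.restrict (uIcc a b)) :=
    ⟨by simp⟩
  have h2 : IntegrableOn v (uIcc a b) := h1.integrable (by norm_num)
  exact h2.intervalIntegrable

namespace IsHalfLinePrimitive

theorem of_isH2 {u u₁ u₂ : ℝ → ℝ} (h : IsH2 (Ici 0) u u₁ u₂) : IsHalfLinePrimitive u u₁ :=
  ⟨fun _ ha _ hb => MemLp.intervalIntegrable_of_Ici h.memLp₁ ha hb, h.primitive₁⟩

theorem deriv_of_isH2 {u u₁ u₂ : ℝ → ℝ} (h : IsH2 (Ici 0) u u₁ u₂) : IsHalfLinePrimitive u₁ u₂ :=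
  ⟨fun _ ha _ hb => MemLp.intervalIntegrable_of_Ici h.memLp₂ ha hb, h.primitive₂⟩

variable {u u₁ : ℝ → ℝ}

theorem continuousOn (h : IsHalfLinePrimitive u u₁) : ContinuousOn u (Ici 0) := by
  intro x hx
  have hx0 : (0 : ℝ) ≤ x := hx
  have h1 : ContinuousOn (fun y => ∫ t in (0 : ℝ)..y, u₁ t) (uIcc 0 (x + 1)) :=
    intervalIntegral.continuousOn_primitive_interval'
      (h.intervalIntegrable 0 self_mem_Ici (x + 1) (mem_Ici.2 (by linarith))) left_mem_uIcc
  rw [uIcc_of_le (by linarith)] at h1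
  have h2 : ContinuousWithinAt (fun y => u 0 + ∫ t in (0 : ℝ)..y, u₁ t) (Icc 0 (x + 1)) x :=
    continuousWithinAt_const.add (h1 x ⟨hx, by linarith⟩)
  have h3 : ContinuousWithinAt u (Icc 0 (x + 1)) x := by
    refine h2.congr (fun y hy => ?_) ?_
    · rw [← h.sub_eq 0 self_mem_Ici y hy.1]; ring
    · rw [← h.sub_eq 0 self_mem_Ici x hx]; ring
  refine h3.mono_of_mem_nhdsWithin ?_
  rw [← Ici_inter_Iic]
  exact inter_mem self_mem_nhdsWithin (mem_nhdsWithin_of_mem_nhds (Iic_mem_nhds (by linarith)))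

theorem continuous_comp_abs (h : IsHalfLinePrimitive u u₁) : Continuous fun x => u |x| :=
  h.continuousOn.comp_continuous continuous_abs fun x => abs_nonneg x

theorem derivZero_eq {u₂ : ℝ → ℝ} (h : IsHalfLinePrimitive u u₁) (h' : IsHalfLinePrimitive u₁ u₂) :
    derivZero u = u₁ 0 := by
  have hc := h'.continuousOn
  have h1 : HasDerivWithinAt (fun y => ∫ t in (0 : ℝ)..y, u₁ t) (u₁ 0) (Ici 0) 0 := by
    refine intervalIntegral.integral_hasDerivWithinAt_right (t := Ioi 0) (s := Ici 0)
      IntervalIntegrable.refl ?_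
      ((hc 0 self_mem_Ici).mono Ioi_subset_Ici_self)
    exact ⟨Ioi 0, self_mem_nhdsWithin,
      (hc.mono Ioi_subset_Ici_self).aestronglyMeasurable measurableSet_Ioi⟩
  have h2 : HasDerivWithinAt u (u₁ 0) (Ici 0) 0 := by
    refine (h1.const_add (u 0)).congr (fun y hy => ?_) ?_
    · rw [← h.sub_eq 0 self_mem_Ici y hy]; ring
    · simp
  exact h2.derivWithin (uniqueDiffOn_Ici 0 0 self_mem_Ici)

/-- A Landau inequality on `[x, x + h]`: the first derivative is controlled by the function and by
a bound for the second derivative. -/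
theorem abs_deriv_le {u₂ : ℝ → ℝ} (h : IsHalfLinePrimitive u u₁) (h' : IsHalfLinePrimitive u₁ u₂)
    {x l A B : ℝ} (hx : 0 ≤ x) (hl : 0 < l) (hA : ∀ y, x ≤ y → |u y| ≤ A)
    (hB : ∀ᵐ y, x < y → |u₂ y| ≤ B) : |u₁ x| ≤ 2 * A / l + l * B := by
  have hxl : (0 : ℝ) ≤ x + l := by linarith
  have hlip : ∀ y ∈ uIoc x (x + l), ‖u₁ y - u₁ x‖ ≤ l * B := by
    intro y hy
    rw [uIoc_of_le (by linarith)] at hy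
    rw [h'.sub_eq x hx y (hx.trans hy.1.le)]
    have hB0 : 0 ≤ B := by
      have : ∃ᵐ z, x < z := by
        rw [frequently_ae_iff]
        change volume (Ioi x) ≠ 0
        simp
      obtain ⟨z, hz, hz'⟩ := (this.and_eventually hB).exists
      exact (abs_nonneg _).trans (hz' hz)
    refine (intervalIntegral.norm_integral_le_of_norm_le_const_ae (C := B) ?_).trans ?_
    · filter_upwards [hB] with z hz hz'
      rw [uIoc_of_le hy.1.le] at hz'
      exact hz hz'.1
    · rw [abs_of_nonneg (by linarith [hy.1]), mul_comm]
      exact mul_le_mul_of_nonneg_right (by linarith [hy.2]) hB0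
  have h1 := intervalIntegral.norm_integral_le_of_norm_le_const hlip
  rw [intervalIntegral.integral_sub (h.intervalIntegrable x hx _ hxl) intervalIntegrable_const,
    ← h.sub_eq x hx _ hxl, intervalIntegral.integral_const, add_sub_cancel_left, abs_of_pos hl,
    smul_eq_mul, Real.norm_eq_abs] at h1
  have h2 := hA x le_rfl
  have h3 := hA (x + l) (by linarith)
  have h4 : |l * u₁ x| ≤ l * B * l + 2 * A := by
    rw [abs_le] at *
    constructor <;> linarith
  rw [abs_mul, abs_of_pos hl] at h4
  have h5 : |u₁ x| = l * |u₁ x| / l := by field_simp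
  rw [h5, div_le_iff₀ hl, add_mul, div_mul_cancel₀ _ hl.ne']
  linarith

/-- Integration by parts on the half line against a compactly supported function. -/
theorem integral_mul_deriv_add (h : IsHalfLinePrimitive u u₁) {η : ℝ → ℝ} (hη : ContDiff ℝ 1 η)
    {R : ℝ} (hR : ∀ x, R < |x| → η x = 0) :
    ∫ x in Ioi 0, (u x * deriv η x + u₁ x * η x) = -(u 0 * η 0) := by
  set b := max R 0 + 1 with hb
  have hb0 : 0 < b := by positivity
  have hRb : R < b := (le_max_left R 0).trans_lt (lt_add_one _)
  have hzero : ∀ x, R < x → η x = 0 := fun x hx => hR x (hx.trans_le (le_abs_self x))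
  have hdzero : ∀ x, R < x → deriv η x = 0 := by
    intro x hx
    have : η =ᶠ[𝓝 x] fun _ => 0 := by
      filter_upwards [Ioi_mem_nhds hx] with y hy using hzero y hy
    rw [this.deriv_eq, deriv_const]
  have h1 : ∫ x in Ioi 0, (u x * deriv η x + u₁ x * η x) =
      ∫ x in Ioc 0 b, (u x * deriv η x + u₁ x * η x) := by
    refine setIntegral_eq_of_subset_of_forall_sdiff_eq_zero measurableSet_Ioi Ioc_subset_Ioi_self ?_
    rintro x ⟨hx, hx'⟩
    have : R < x := hRb.trans (by simpa [mem_Ioi.1 hx] using hx')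
    rw [hzero x this, hdzero x this]; ring
  have hi := h.intervalIntegrable 0 self_mem_Ici b hb0.le
  set F : ℝ → ℝ := fun y => ∫ t in (0 : ℝ)..y, u₁ t with hF
  have hFu : ∀ x, 0 ≤ x → u x = u 0 + F x := fun x hx => by
    rw [hF]; simp only; rw [← h.sub_eq 0 self_mem_Ici x hx]; ring
  have hac : AbsolutelyContinuousOnInterval F 0 b :=
    hi.absolutelyContinuousOnInterval_intervalIntegral (by simp)
  have hac2 : AbsolutelyContinuousOnInterval η 0 b := hη.contDiffOn.absolutelyContinuousOnInterval
  have hac3 : AbsolutelyContinuousOnInterval (fun x => u 0 + F x) 0 b := by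
    refine AbsolutelyContinuousOnInterval.add ?_ hac
    exact (contDiff_const (c := u 0) (n := 1)).contDiffOn.absolutelyContinuousOnInterval
  have h2 := hac3.integral_deriv_mul_eq_sub hac2
  rw [h1, ← intervalIntegral.integral_of_le hb0.le]
  have h3 : ∫ x in (0 : ℝ)..b, (u x * deriv η x + u₁ x * η x) =
      ∫ x in (0 : ℝ)..b, deriv (fun x => u 0 + F x) x * η x + (u 0 + F x) * deriv η x := by
    refine intervalIntegral.integral_congr_ae ?_
    filter_upwards [hi.ae_hasDerivAt_integral] with x hx hx'
    have hx0 : 0 ≤ x := by rw [uIoc_of_le hb0.le] at hx'; exact hx'.1.le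
    have hd := hx (uIoc_subset_uIcc hx') 0 (by simp)
    rw [(hd.const_add (u 0)).deriv, ← hFu x hx0]; ring
  rw [h3, h2, hzero b hRb, ← hFu 0 le_rfl]
  ring

end IsHalfLinePrimitive

theorem integral_eq_integral_Ioi_add_neg {F : ℝ → ℝ} (hF : Integrable F) :
    ∫ x, F x = ∫ x in Ioi 0, (F x + F (-x)) := by
  have h2 : ∫ x in Ioi 0, F (-x) = ∫ x in Iic 0, F x := by
    simp
  rw [integral_add hF.integrableOn hF.comp_neg.integrableOn, h2, add_comm,
    ← setIntegral_union (by simp) measurableSet_Ioi hF.integrableOn hF.integrableOn, Iic_union_Ioi,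
    setIntegral_univ]

/-! ### Decaying solutions on the half line -/

theorem integrable_exp_neg_mul_abs {r : ℝ} (hr : 0 < r) :
    Integrable fun x : ℝ => Real.exp (-r * |x|) := by
  have h1 : IntegrableOn (fun x : ℝ => Real.exp (-r * |x|)) (Ioi 0) := by
    refine (exp_neg_integrableOn_Ioi 0 hr).congr_fun (fun x hx => ?_) measurableSet_Ioi
    simp only [abs_of_pos (mem_Ioi.1 hx)]
  have h2 : IntegrableOn (fun x : ℝ => Real.exp (-r * |x|)) (Iic 0) := by
    have h3 := Iff.mpr integrableOn_Ici_iff_integrableOn_Ioi h1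
    rw [← neg_zero] at h3
    simpa using h3.comp_neg_Iic
  rw [← integrableOn_univ, ← Iic_union_Ioi (a := (0 : ℝ))]
  exact h2.union h1

theorem memLp_exp_neg_mul_abs {r : ℝ} (hr : 0 < r) :
    MemLp (fun x : ℝ => Real.exp (-r * |x|)) 2 volume := by
  rw [memLp_two_iff_integrable_sq (by fun_prop)]
  refine (integrable_exp_neg_mul_abs (r := 2 * r) (by positivity)).congr
    (Eventually.of_forall fun x => ?_)
  simp only [← Real.exp_nat_mul]
  congr 1; push_cast; ring

theorem ae_abs_le_of_memLp_top {g : ℝ → ℝ} (hg : MemLp g ∞ volume) :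
    ∃ G : ℝ, 0 < G ∧ ∀ᵐ x, |g x| ≤ G := by
  refine ⟨(eLpNormEssSup g volume).toReal + 1, by positivity, ?_⟩
  have h2 : eLpNormEssSup g volume ≠ ∞ := by
    simpa [eLpNorm_exponent_top] using hg.2.ne
  filter_upwards [enorm_ae_le_eLpNormEssSup g volume] with x hx
  have := ENNReal.toReal_mono h2 hx
  rw [toReal_enorm, Real.norm_eq_abs] at this
  linarith

theorem ae_comp_neg {p : ℝ → Prop} (h : ∀ᵐ x, p x) : ∀ᵐ x, p (-x) :=
  (Measure.measurePreserving_neg (volume : Measure ℝ)).quasiMeasurePreserving.ae h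

theorem measurable_realSign : Measurable Real.sign :=
  Measurable.ite measurableSet_Iio measurable_const
    (Measurable.ite measurableSet_Ioi measurable_const measurable_const)

theorem abs_realSign_le (x : ℝ) : |Real.sign x| ≤ 1 := by
  rcases Real.sign_apply_eq x with h | h | h <;> simp [h]

/-- The odd function `sign(x) e^{-|x|} (-1 - c g(|x|))` is square integrable. For `c = k²ω²` it is
`L_k e^{-x}` on the half line `x > 0`. -/
theorem exists_odd_rhs (g : ℝ → ℝ) (hg : MemLp g ∞ volume) (hev : ∀ᵐ x, g (-x) = g x) (c : ℝ) :
    ∃ f : oddL2, ∀ᵐ x, 0 < x →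
      (f : L2R) x = ((-Real.exp (-x) - c * g x * Real.exp (-x) : ℝ) : ℂ) := by
  obtain ⟨G, hG0, hG⟩ := ae_abs_le_of_memLp_top hg
  let v : ℝ → ℂ := fun x =>
    ((Real.sign x * (Real.exp (-1 * |x|) * (-1 - c * g |x|)) : ℝ) : ℂ)
  have hgabs : (fun x => g |x|) =ᵐ[volume] g := by
    filter_upwards [hev] with x hx
    rcases le_total 0 x with h | h
    · rw [abs_of_nonneg h]
    · rw [abs_of_nonpos h, hx]
  have hm : AEStronglyMeasurable v volume := by
    have h1 : AEStronglyMeasurable (fun x => g |x|) volume := hg.1.congr hgabs.symm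
    refine Complex.continuous_ofReal.comp_aestronglyMeasurable ?_
    refine measurable_realSign.aestronglyMeasurable.mul (AEStronglyMeasurable.mul (by fun_prop) ?_)
    exact aestronglyMeasurable_const.sub (h1.const_mul c)
  have hv : MemLp v 2 volume := by
    refine ((memLp_exp_neg_mul_abs one_pos).const_mul (1 + |c| * G)).of_le hm ?_
    filter_upwards [hG, hgabs] with x hx hx'
    simp only [v, Complex.norm_real, Real.norm_eq_abs, abs_mul, Real.abs_exp, hx']
    have h1 := abs_realSign_le x
    have h2 : |-1 - c * g x| ≤ |1 + |c| * G| := by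
      rw [abs_of_pos (by positivity : 0 < 1 + |c| * G)]
      refine (abs_sub _ _).trans ?_
      rw [abs_neg, abs_one, abs_mul]
      gcongr
    calc _ ≤ 1 * (Real.exp (-1 * |x|) * |1 + |c| * G|) := by gcongr
      _ = _ := by ring
  refine ⟨⟨hv.toLp, v, fun x => ?_, hv.coeFn_toLp⟩, ?_⟩
  · simp only [v, abs_neg, Real.sign_neg]
    push_cast
    simp
  · filter_upwards [hv.coeFn_toLp] with x hx h0
    change (hv.toLp) x = _
    rw [hx]
    simp only [v, abs_of_pos h0, Real.sign_of_pos h0]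
    push_cast
    ring_nf

/-- The continuous representative of an odd `H²` function vanishes at `0`. -/
theorem IsH2.apply_zero_of_odd {u u₁ u₂ : ℝ → ℂ} (h : IsH2 univ u u₁ u₂) {f : L2R}
    (hf : f ∈ oddL2) (hfu : f =ᵐ[volume] u) : u 0 = 0 := by
  obtain ⟨v, hv, hfv⟩ := hf
  have hc : Continuous u := by
    have h1 : Continuous fun y => u 0 + ∫ t in (0 : ℝ)..y, u₁ t :=
      continuous_const.add (intervalIntegral.continuous_primitive
        (fun a b => (h.intervalIntegrable a b).1) 0)
    refine h1.congr fun y => ?_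
    rw [← h.primitive₁ 0 trivial y trivial]; ring
  have huv : ∀ᵐ x, u x = v x := hfu.symm.trans hfv
  have hz : (fun x => u x + u (-x)) =ᵐ[volume] fun _ => 0 := by
    filter_upwards [huv, ae_comp_neg huv] with x h1 h2
    rw [h1, h2, hv]; ring
  have := congrFun ((Continuous.ae_eq_iff_eq volume (by fun_prop) continuous_const).1 hz) 0
  simp only [neg_zero] at this
  exact add_self_eq_zero.1 this

theorem IntervalIntegrable.integral_re {f : ℝ → ℂ} {a b : ℝ}
    (hf : IntervalIntegrable f volume a b) :
    ∫ x in a..b, (f x).re = (∫ x in a..b, f x).re := by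
  simpa using Complex.reCLM.intervalIntegral_comp_comm hf

/-- If `u` is the odd solution of `L_k u = f` where `f` is the odd extension of `L_k e^{-x}`, then
the restriction of `e^{-x} - u` to the half line is the required solution of `L_k φ = 0`. -/
theorem exists_isDecayingSolution {g : ℝ → ℝ} (hg : MemLp g ∞ volume)
    (hev : ∀ᵐ x, g (-x) = g x) {ω : ℝ} {k : ℕ} (hk : (0 : ℂ) ∉ graphSpectrum (opLOdd g ω k)) :
    ∃ φ : ℝ → ℝ, IsDecayingSolution g ω k φ := by
  obtain ⟨R, hR⟩ : ∃ R : oddL2 →L[ℂ] oddL2, ∀ u f : oddL2,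
      (u, f) ∈ graphSub (opLOdd g ω k) 0 ↔ u = R f := by
    simpa [graphSpectrum] using hk
  obtain ⟨f, hf⟩ := exists_odd_rhs g hg hev ((k : ℝ) ^ 2 * ω ^ 2)
  obtain ⟨⟨p, q⟩, hp, hpq⟩ := (hR (R f) f).2 rfl
  obtain ⟨hp', hq'⟩ : R f = p ∧ f = q := by simpa [eq_comm] using hpq
  subst hp' hq'
  obtain ⟨u, u₁, u₂, hu, hup, huq⟩ := hp
  change ((R f : oddL2) : L2R) =ᵐ[volume] u at hup
  change ((f : oddL2) : L2R) =ᵐ[volume] _ at huq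
  have hu0 : u 0 = 0 := hu.apply_zero_of_odd (R f).2 hup
  have hle : volume.restrict (Ici (0 : ℝ)) ≤ volume.restrict univ :=
    Measure.restrict_mono (subset_univ _) le_rfl
  have hexp : MemLp (fun x : ℝ => Real.exp (-x)) 2 (volume.restrict (Ici 0)) := by
    refine ((memLp_exp_neg_mul_abs one_pos).mono_measure Measure.restrict_le_self).ae_eq ?_
    filter_upwards [ae_restrict_mem measurableSet_Ici] with x hx
    rw [abs_of_nonneg hx]; ring_nf
  have hexpc : ∀ a b : ℝ, IntervalIntegrable (fun x : ℝ => Real.exp (-x)) volume a b :=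
    fun a b => Continuous.intervalIntegrable (by fun_prop) a b
  have hre : ∀ {v : ℝ → ℂ} {a b : ℝ}, IntervalIntegrable v volume a b →
      IntervalIntegrable (fun x => (v x).re) volume a b := by
    intro v a b hv
    exact ⟨hv.1.re, hv.2.re⟩
  have hint : ∀ a b : ℝ, ∫ x in a..b, Real.exp (-x) = Real.exp (-a) - Real.exp (-b) := by
    intro a b
    rw [intervalIntegral.integral_comp_neg fun x => Real.exp x, integral_exp]
  refine ⟨fun x => Real.exp (-x) - (u x).re, fun x => -Real.exp (-x) - (u₁ x).re,
    fun x => Real.exp (-x) - (u₂ x).re, ⟨?_, ?_, ?_, ?_, ?_⟩, ?_, ?_⟩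
  · exact hexp.sub (hu.memLp.mono_measure hle).re
  · exact hexp.neg.sub (hu.memLp₁.mono_measure hle).re
  · exact hexp.sub (hu.memLp₂.mono_measure hle).re
  · intro a _ b _
    have h1 := (hu.intervalIntegrable a b).1
    have h2 : IntervalIntegrable (fun x : ℝ => -Real.exp (-x)) volume a b := (hexpc a b).neg
    rw [intervalIntegral.integral_sub h2 (hre h1), intervalIntegral.integral_neg, hint,
      h1.integral_re, ← hu.primitive₁ a trivial b trivial, Complex.sub_re]
    ring
  · intro a _ b _
    have h1 := (hu.intervalIntegrable a b).2
    rw [intervalIntegral.integral_sub (hexpc a b) (hre h1), hint,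
      h1.integral_re, ← hu.primitive₂ a trivial b trivial, Complex.sub_re]
    ring
  · rw [ae_restrict_iff' measurableSet_Ioi]
    filter_upwards [hf, huq] with x h1 h2 hx
    have h3 := congrArg Complex.re ((h1 hx).symm.trans h2)
    rw [Complex.ofReal_re, Complex.sub_re, Complex.neg_re, Complex.re_ofReal_mul] at h3
    linarith
  · simp [hu0]

/-- By the Landau inequality on intervals of length `1/k`, the derivative of `Φ_k` grows at most
linearly in `k`, uniformly with the same exponential decay. -/
theorem exists_deriv_bound {g : ℝ → ℝ} (hg : MemLp g ∞ volume) (ω : ℝ) {M ρ : ℝ}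
    (hM : 0 < M) (hρ : 0 < ρ) :
    ∃ C > 0, ∀ (k : ℕ) (φ : ℝ → ℝ), 0 < k → IsDecayingSolution g ω k φ →
      (∀ x, 0 ≤ x → |φ x| ≤ M * Real.exp (-ρ * x)) →
      ∃ φ₁ φ₂ : ℝ → ℝ, IsHalfLinePrimitive φ φ₁ ∧ IsHalfLinePrimitive φ₁ φ₂ ∧
        (∀ᵐ x, 0 < x → φ₂ x = -((k : ℝ) ^ 2 * ω ^ 2 * g x * φ x)) ∧ φ 0 = 1 ∧
        ∀ x, 0 ≤ x → |φ₁ x| ≤ C * k * Real.exp (-ρ * x) := by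
  obtain ⟨G, hG0, hG⟩ := ae_abs_le_of_memLp_top hg
  refine ⟨2 * M + ω ^ 2 * G * M, by positivity, ?_⟩
  rintro k φ hk ⟨φ₁, φ₂, hH, heq, h0⟩ hφ
  rw [ae_restrict_iff' measurableSet_Ioi] at heq
  have heq' : ∀ᵐ x, 0 < x → φ₂ x = -((k : ℝ) ^ 2 * ω ^ 2 * g x * φ x) := by
    filter_upwards [heq] with x hx h
    linarith [hx h]
  refine ⟨φ₁, φ₂, .of_isH2 hH, .deriv_of_isH2 hH, heq', h0, fun x hx => ?_⟩
  have hk' : (0 : ℝ) < k := by exact_mod_cast hk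
  have hdec : ∀ y, x ≤ y → |φ y| ≤ M * Real.exp (-ρ * x) := by
    intro y hy
    refine (hφ y (hx.trans hy)).trans ?_
    gcongr ?_ * Real.exp ?_
    nlinarith
  have := IsHalfLinePrimitive.abs_deriv_le (.of_isH2 hH) (.deriv_of_isH2 hH) hx (l := 1 / k)
    (by positivity) hdec (B := k ^ 2 * ω ^ 2 * G * (M * Real.exp (-ρ * x))) ?_
  · refine this.trans_eq ?_
    field_simp
  · filter_upwards [heq', hG] with y h1 h2 hxy
    rw [h1 (hx.trans_lt hxy), abs_neg, abs_mul, abs_mul,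
      abs_of_nonneg (by positivity : 0 ≤ (k : ℝ) ^ 2 * ω ^ 2)]
    have := hdec y hxy.le
    gcongr

section SineSeries

open AddCircle ComplexConjugate

/-! ### The real profile of a sequence in `Dom(J)` -/

instance fact_one_le_four_ennreal : Fact ((1 : ℝ≥0∞) ≤ 4) := ⟨by norm_num⟩

instance holderTriple_four_four_two : ENNReal.HolderTriple 4 4 2 where
  inv_add_inv_eq_inv := by
    rw [← two_mul, show (4 : ℝ≥0∞) = 2 * 2 by norm_num,
      ENNReal.mul_inv (Or.inl two_ne_zero) (Or.inl (by norm_num)), ← mul_assoc,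
      ENNReal.mul_inv_cancel two_ne_zero (by norm_num), one_mul]

/-- The real space `L⁴` of the circle `ℝ/ℤ` with its probability measure. -/
abbrev CircleL4 : Type := Lp ℝ 4 (haarAddCircle (T := (1 : ℝ)))

/-- The real space `L²` of the circle `ℝ/ℤ` with its probability measure. -/
abbrev CircleL2 : Type := Lp ℝ 2 (haarAddCircle (T := (1 : ℝ)))

/-- The real function `f` has the (formal) Fourier series `i f(s) = ∑_k b_k e^{2πiks}`. If `b` is
odd, this says that `f(s) = 2 ∑_{k>0} b_k sin(2πks)`. -/
def HasSineCoeffs (f : UnitAddCircle → ℝ) (b : ℤ → ℝ) : Prop :=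
  ∀ k, fourierCoeff (fun s => Complex.I * (f s : ℂ)) k = b k

theorem integrable_I_mul {f : UnitAddCircle → ℝ} (hf : Integrable f haarAddCircle) :
    Integrable (fun s => Complex.I * (f s : ℂ)) haarAddCircle :=
  hf.ofReal.const_mul _

theorem fourierCoeff_fun_sub {f g : UnitAddCircle → ℂ} (hf : Integrable f haarAddCircle)
    (hg : Integrable g haarAddCircle) (k : ℤ) :
    fourierCoeff (fun s => f s - g s) k = fourierCoeff f k - fourierCoeff g k := by
  have h1 := congrFun (fourierCoeff.add hf (hg.const_mul (-1))) k
  rw [Pi.add_apply, fourierCoeff.const_mul] at h1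
  calc fourierCoeff (fun s => f s - g s) k = fourierCoeff (f + fun s => -1 * g s) k := by
        congr 1; funext s; simp [sub_eq_add_neg]
    _ = _ := by rw [h1]; ring

theorem ae_eq_of_fourierCoeff_eq {f g : UnitAddCircle → ℂ} (hf : Integrable f haarAddCircle)
    (hg : Integrable g haarAddCircle) (h : ∀ k, fourierCoeff f k = fourierCoeff g k) :
    f =ᵐ[haarAddCircle] g := by
  have h1 := ae_zero_of_fourierCoeff_zero (hf.sub hg) fun n => by
    have := fourierCoeff_fun_sub hf hg n
    rw [h n, sub_self] at this
    exact this
  filter_upwards [h1] with s hs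
  exact sub_eq_zero.1 hs

theorem fourierCoeff_conj (f : UnitAddCircle → ℂ) (k : ℤ) :
    fourierCoeff (fun s => conj (f s)) k = conj (fourierCoeff f (-k)) := by
  rw [fourierCoeff, fourierCoeff, ← integral_conj]
  refine integral_congr_ae (Eventually.of_forall fun s => ?_)
  simp only [smul_eq_mul, map_mul, neg_neg, fourier_neg]

namespace HasSineCoeffs

theorem ae_eq {f g : UnitAddCircle → ℝ} {b : ℤ → ℝ} (hf : HasSineCoeffs f b)
    (hg : HasSineCoeffs g b) (hfi : Integrable f haarAddCircle)
    (hgi : Integrable g haarAddCircle) : f =ᵐ[haarAddCircle] g := by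
  have h := ae_eq_of_fourierCoeff_eq (integrable_I_mul hfi) (integrable_I_mul hgi)
    fun k => (hf k).trans (hg k).symm
  filter_upwards [h] with s hs
  exact_mod_cast mul_left_cancel₀ Complex.I_ne_zero hs

theorem congr_ae {f g : UnitAddCircle → ℝ} {b : ℤ → ℝ} (hf : HasSineCoeffs f b)
    (h : f =ᵐ[haarAddCircle] g) : HasSineCoeffs g b := by
  intro k
  rw [← hf k]
  refine congrFun (fourierCoeff_congr_ae ?_) k
  filter_upwards [h] with s hs
  rw [hs]

theorem add {f g : UnitAddCircle → ℝ} {b c : ℤ → ℝ} (hf : HasSineCoeffs f b)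
    (hg : HasSineCoeffs g c) (hfi : Integrable f haarAddCircle)
    (hgi : Integrable g haarAddCircle) : HasSineCoeffs (f + g) (b + c) := by
  intro k
  have h := congrFun (fourierCoeff.add (integrable_I_mul hfi) (integrable_I_mul hgi)) k
  rw [Pi.add_apply, hf k, hg k] at h
  rw [Pi.add_apply, Complex.ofReal_add, ← h]
  congr 1
  funext s
  simp [mul_add]

theorem smul {f : UnitAddCircle → ℝ} {b : ℤ → ℝ} (hf : HasSineCoeffs f b) (c : ℝ) :
    HasSineCoeffs (c • f) (c • b) := by
  intro k
  have h := fourierCoeff.const_mul (fun s => Complex.I * (f s : ℂ)) c k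
  rw [hf k] at h
  rw [Pi.smul_apply, smul_eq_mul, Complex.ofReal_mul, ← h]
  congr 1
  funext s
  simp only [Pi.smul_apply, smul_eq_mul, Complex.ofReal_mul]
  ring

end HasSineCoeffs

/-- An integrable function on the circle whose Fourier coefficients form a real odd sequence is
purely imaginary. -/
theorem ae_eq_I_mul_im {U : UnitAddCircle → ℂ} (hU : Integrable U haarAddCircle) {b : ℤ → ℝ}
    (hb : ∀ k, fourierCoeff U k = b k) (hodd : ∀ k, b (-k) = -b k) :
    U =ᵐ[haarAddCircle] fun s => Complex.I * ((U s).im : ℂ) := by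
  have hc : Integrable (fun s => conj (U s)) haarAddCircle :=
    hU.norm.mono' (Complex.continuous_conj.comp_aestronglyMeasurable hU.1)
      (Eventually.of_forall fun s => by simp)
  have h := ae_eq_of_fourierCoeff_eq (hU.const_mul (-1)) hc fun k => by
    rw [fourierCoeff.const_mul, fourierCoeff_conj]; simp [hb, hodd]
  filter_upwards [h] with s hs
  have h1 := congrArg Complex.re hs
  simp only [neg_mul, one_mul, Complex.neg_re, Complex.conj_re] at h1
  have h2 : (U s).re = 0 := by linarith
  apply Complex.ext <;> simp [h2]

theorem DomJ.exists_profile (z : DomJ) :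
    ∃ u : CircleL4, HasSineCoeffs u z.seq ∧ ‖u‖ = ‖z‖ := by
  obtain ⟨U, hU, hU4⟩ := z.isDomJ.exists_L4
  have hI := ae_eq_I_mul_im (hU4.integrable (by norm_num)) hU z.isDomJ.odd_symm
  have hm : MemLp (fun s => (U s).im) 4 haarAddCircle := hU4.im
  refine ⟨hm.toLp, fun k => ?_, ?_⟩
  · rw [← hU k]
    refine congrFun (fourierCoeff_congr_ae ?_) k
    filter_upwards [hI, hm.coeFn_toLp] with s h1 h2
    rw [h2, ← h1]
  · rw [DomJ.norm_def, (summable_of_memLp_four hU hU4).2, Lp.norm_toLp, Lp.norm_toLp]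
    congr 1
    refine eLpNorm_congr_norm_ae ?_
    filter_upwards [hI] with s h1
    rw [h1]; simp

namespace DomJ

/-- The real `L⁴` function `u(s) = 2 ∑_{k>0} z_k sin(2πks)` on the circle of length one. -/
noncomputable def profile (z : DomJ) : CircleL4 := z.exists_profile.choose

theorem hasSineCoeffs_profile (z : DomJ) : HasSineCoeffs z.profile z.seq :=
  z.exists_profile.choose_spec.1

theorem norm_profile (z : DomJ) : ‖z.profile‖ = ‖z‖ := z.exists_profile.choose_spec.2

theorem integrable_circleL4 (u : CircleL4) : Integrable u haarAddCircle :=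
  (Lp.memLp u).integrable (by norm_num)

theorem eq_profile {z : DomJ} {u : CircleL4} (hu : HasSineCoeffs u z.seq) : u = z.profile :=
  Lp.ext (hu.ae_eq z.hasSineCoeffs_profile (integrable_circleL4 _) (integrable_circleL4 _))

/-- The isometric embedding of `Dom(J)` into the real space `L⁴` of the circle. -/
noncomputable def profileL : DomJ →ₗᵢ[ℝ] CircleL4 where
  toFun := profile
  map_add' z y := by
    refine (eq_profile ?_).symm
    rw [seq_add]
    exact (z.hasSineCoeffs_profile.add y.hasSineCoeffs_profile (integrable_circleL4 _)
      (integrable_circleL4 _)).congr_ae (Lp.coeFn_add _ _).symm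
  map_smul' c z := by
    refine (eq_profile ?_).symm
    rw [seq_smul]
    exact (z.hasSineCoeffs_profile.smul c).congr_ae (Lp.coeFn_smul _ _).symm
  norm_map' := norm_profile

theorem profileL_apply (z : DomJ) : profileL z = z.profile := rfl

theorem exists_of_hasSineCoeffs {u : CircleL4} {c : ℤ → ℝ} (hu : HasSineCoeffs u c)
    (h0 : ∀ k, Even k → c k = 0) (h1 : ∀ k, c (-k) = -c k) :
    ∃ z : DomJ, z.seq = c ∧ z.profile = u := by
  have h4 : MemLp (fun s => Complex.I * (u s : ℂ)) 4 haarAddCircle := by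
    have : MemLp (fun s => (u s : ℂ)) 4 haarAddCircle := (Lp.memLp u).ofReal
    exact this.const_mul _
  have h2 : MemLp (fun s => Complex.I * (u s : ℂ)) 2 haarAddCircle :=
    h4.mono_exponent (by norm_num)
  have hc : ∀ k, fourierCoeff h2.toLp k = c k := fun k => by
    rw [← hu k]; exact congrFun (fourierCoeff_congr_ae h2.coeFn_toLp) k
  refine ⟨⟨c, IsDomJ.of_memLp_four hc ((memLp_congr_ae h2.coeFn_toLp).2 h4) h0 h1⟩, rfl, ?_⟩
  exact (eq_profile hu).symm

theorem norm_fourierCoeff_le (u : CircleL4) (k : ℤ) :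
    ‖fourierCoeff (fun s => Complex.I * (u s : ℂ)) k‖ ≤ ‖u‖ := by
  have h1 : ‖fourierCoeff (fun s => Complex.I * (u s : ℂ)) k‖ ≤ ∫ s, ‖u s‖ ∂haarAddCircle := by
    refine (norm_integral_le_integral_norm _).trans_eq ?_
    refine integral_congr_ae (Eventually.of_forall fun s => ?_)
    have : ‖fourier (-k) s‖ = 1 := Circle.norm_coe _
    simp only [smul_eq_mul, norm_mul, this, Complex.norm_I, Complex.norm_real, one_mul]
  refine h1.trans ?_
  rw [integral_norm_eq_lintegral_enorm (Lp.aestronglyMeasurable u),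
    ← eLpNorm_one_eq_lintegral_enorm, Lp.norm_def]
  exact ENNReal.toReal_mono (Lp.eLpNorm_ne_top u)
    (eLpNorm_le_eLpNorm_of_exponent_le (by norm_num) (Lp.aestronglyMeasurable u))

instance : CompleteSpace DomJ := by
  refine Metric.complete_of_cauchySeq_tendsto fun z hz => ?_
  obtain ⟨u, hu⟩ := cauchySeq_tendsto_of_complete
    (profileL.isometry.uniformContinuous.comp_cauchySeq hz)
  have hcoef : ∀ k, Tendsto (fun n => (((z n).seq k : ℝ) : ℂ)) atTop
      (𝓝 (fourierCoeff (fun s => Complex.I * (u s : ℂ)) k)) := by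
    intro k
    rw [tendsto_iff_norm_sub_tendsto_zero]
    refine squeeze_zero (fun n => norm_nonneg _) (fun n => ?_)
      (tendsto_iff_norm_sub_tendsto_zero.1 hu)
    refine le_trans (le_of_eq ?_) (norm_fourierCoeff_le _ k)
    rw [← (z n).hasSineCoeffs_profile k, ← fourierCoeff_fun_sub
      (integrable_I_mul (integrable_circleL4 _)) (integrable_I_mul (integrable_circleL4 _))]
    congr 1
    refine congrFun (fourierCoeff_congr_ae ?_) k
    filter_upwards [Lp.coeFn_sub (profileL (z n)) u] with s hs
    change _ = Complex.I * (((profileL (z n) - u : CircleL4) s : ℝ) : ℂ)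
    rw [hs]
    simp [profileL_apply, mul_sub]
  set c : ℤ → ℝ := fun k => (fourierCoeff (fun s => Complex.I * (u s : ℂ)) k).re with hc
  have hre : ∀ k, Tendsto (fun n => (z n).seq k) atTop (𝓝 (c k)) := fun k => by
    exact (Complex.continuous_re.tendsto _).comp (hcoef k)
  have huc : HasSineCoeffs u c := fun k =>
    tendsto_nhds_unique (hcoef k) ((Complex.continuous_ofReal.tendsto _).comp (hre k))
  obtain ⟨y, -, hy⟩ := exists_of_hasSineCoeffs huc
    (fun k hk => tendsto_nhds_unique (hre k) (by simp [(z _).isDomJ.even_zero k hk]))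
    (fun k => tendsto_nhds_unique (hre (-k)) (by simpa [(z _).isDomJ.odd_symm] using (hre k).neg))
  refine ⟨y, ?_⟩
  exact profileL.isometry.isEmbedding.tendsto_nhds_iff.2 (by rw [profileL_apply, hy]; exact hu)

end DomJ

/-! ### The quartic part -/

/-- The pointwise product `L⁴ × L⁴ → L²`. -/
noncomputable def mulL4 : CircleL4 →L[ℝ] CircleL4 →L[ℝ] CircleL2 :=
  (ContinuousLinearMap.mul ℝ ℝ).holderL haarAddCircle 4 4 2

theorem coeFn_mulL4 (u v : CircleL4) : mulL4 u v =ᵐ[haarAddCircle] fun s => u s * v s :=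
  (ContinuousLinearMap.mul ℝ ℝ).coeFn_holder u v

theorem mulL4_comm (u v : CircleL4) : mulL4 u v = mulL4 v u := by
  refine Lp.ext ?_
  filter_upwards [coeFn_mulL4 u v, coeFn_mulL4 v u] with s h1 h2
  rw [h1, h2, mul_comm]

theorem norm_mulL4_self (u : CircleL4) : ‖mulL4 u u‖ = ‖u‖ ^ 2 := by
  rw [Lp.norm_def, Lp.norm_def, ← ENNReal.toReal_pow]
  congr 1
  have h := eLpNorm_norm_rpow (p := 2) (μ := haarAddCircle) (u : UnitAddCircle → ℝ) (q := 2)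
    two_pos
  rw [show (2 : ℝ≥0∞) * ENNReal.ofReal 2 = 4 by rw [ENNReal.ofReal_ofNat]; norm_num,
    ENNReal.rpow_ofNat] at h
  rw [← h]
  refine eLpNorm_congr_norm_ae ?_
  filter_upwards [coeFn_mulL4 u u] with s h1
  rw [h1]
  simp [sq]

theorem inner_mulL4_self_nonneg (u v : CircleL4) : 0 ≤ inner ℝ (mulL4 u u) (mulL4 v v) := by
  rw [L2.inner_def]
  refine integral_nonneg_of_ae ?_
  filter_upwards [coeFn_mulL4 u u, coeFn_mulL4 v v] with s h1 h2
  rw [h1, h2]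
  simp only [RCLike.inner_apply, conj_trivial, Pi.zero_apply]
  exact mul_nonneg (mul_self_nonneg _) (mul_self_nonneg _)

/-- Clarkson's inequality in `L⁴`. -/
theorem CircleL4.clarkson (a b : CircleL4) :
    ‖(2⁻¹ : ℝ) • (a + b)‖ ^ 4 + ‖(2⁻¹ : ℝ) • (a - b)‖ ^ 4 ≤ (‖a‖ ^ 4 + ‖b‖ ^ 4) / 2 := by
  set F := mulL4 ((2⁻¹ : ℝ) • (a + b)) ((2⁻¹ : ℝ) • (a + b)) with hF
  set G := mulL4 ((2⁻¹ : ℝ) • (a - b)) ((2⁻¹ : ℝ) • (a - b)) with hG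
  have hFG : F + G = (2⁻¹ : ℝ) • (mulL4 a a + mulL4 b b) := by
    simp only [hF, hG, map_smul, map_add, map_sub, add_apply,
      sub_apply, smul_apply]
    module
  have h4 : ∀ u : CircleL4, ‖u‖ ^ 4 = ‖mulL4 u u‖ ^ 2 := fun u => by rw [norm_mulL4_self]; ring
  have hin : 0 ≤ inner ℝ F G := inner_mulL4_self_nonneg _ _
  have h1 := norm_add_sq_real F G
  rw [hFG, norm_smul, mul_pow] at h1
  have h2 := norm_add_sq_real (mulL4 a a) (mulL4 b b)
  have h3 := norm_sub_sq_real (mulL4 a a) (mulL4 b b)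
  have h5 := sq_nonneg ‖mulL4 a a - mulL4 b b‖
  rw [h4, h4, h4, h4, ← hF, ← hG]
  norm_num at h1
  linarith

theorem conv_neg_self {z : ℤ → ℝ} (hz : ∀ k, z (-k) = -z k) (k : ℤ) :
    conv z z (-k) = conv z z k := by
  rw [conv, conv, ← (Equiv.neg ℤ).tsum_eq]
  refine tsum_congr fun l => ?_
  simp only [Equiv.neg_apply]
  rw [hz, show -k - -l = -(k - l) by ring, hz]
  ring

namespace DomJ

theorem tsum_sq_conv (z : DomJ) : ∑' k, conv z.seq z.seq k ^ 2 = ‖z‖ ^ 4 := by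
  have h : 0 ≤ ∑' k, conv z.seq z.seq k ^ 2 := tsum_nonneg fun k => sq_nonneg _
  rw [norm_def, tripleNorm, show 4 = 2 * 2 by norm_num, pow_mul, Real.sq_sqrt (Real.sqrt_nonneg _),
    Real.sq_sqrt h]

theorem conv_mul_conv (z : DomJ) (l : ℤ) :
    conv z.seq z.seq l * conv z.seq z.seq (0 - l) = conv z.seq z.seq l ^ 2 := by
  rw [zero_sub, conv_neg_self z.isDomJ.odd_symm, sq]

/-- The quartic term of `J` is a power of the norm, since `z * z` is an even sequence. -/
theorem conv_conv_zero (z : DomJ) :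
    conv (conv z.seq z.seq) (conv z.seq z.seq) 0 = ‖z‖ ^ 4 := by
  rw [← tsum_sq_conv, conv]
  exact tsum_congr z.conv_mul_conv

theorem tsum_sq_le (z : DomJ) : ∑' k, z.seq k ^ 2 ≤ ‖z‖ ^ 2 := by
  have h1 : ∑' k, z.seq k ^ 2 = -conv z.seq z.seq 0 := by
    rw [conv, ← tsum_neg]
    refine tsum_congr fun l => ?_
    rw [zero_sub, z.isDomJ.odd_symm]; ring
  have h2 : conv z.seq z.seq 0 ^ 2 ≤ (‖z‖ ^ 2) ^ 2 := by
    rw [← pow_mul, ← tsum_sq_conv]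
    exact z.isDomJ.summable_sq.le_tsum 0 fun _ _ => sq_nonneg _
  rw [h1]
  exact (neg_le_abs _).trans (abs_le_of_sq_le_sq h2 (sq_nonneg _))

theorem abs_seq_le (z : DomJ) (k : ℤ) : |z.seq k| ≤ ‖z‖ := by
  refine abs_le_of_sq_le_sq ?_ (norm_nonneg _)
  exact (z.isDomJ.sq_summable.le_tsum k fun _ _ => sq_nonneg _).trans z.tsum_sq_le

/-! ### The quadratic part -/

variable {q : ℤ → ℝ} {K : ℝ}

theorem summable_weighted_mul (hq : ∀ k, |q k| ≤ K) (z y : DomJ) :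
    Summable fun k => q k * (z.seq k * y.seq k) := by
  refine Summable.of_norm_bounded (g := fun k => K * (z.seq k ^ 2 + y.seq k ^ 2))
    ((z.isDomJ.sq_summable.add y.isDomJ.sq_summable).mul_left K) fun k => ?_
  rw [Real.norm_eq_abs, abs_mul, abs_mul]
  have h0 : 0 ≤ K := (abs_nonneg _).trans (hq k)
  refine mul_le_mul (hq k) ?_ (by positivity) h0
  rw [← sq_abs (z.seq k), ← sq_abs (y.seq k)]
  nlinarith [sq_nonneg (|z.seq k| - |y.seq k|), sq_nonneg (|z.seq k|), sq_nonneg (|y.seq k|)]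

theorem abs_tsum_weighted_mul_le (hq : ∀ k, |q k| ≤ K) (z y : DomJ) :
    |∑' k, q k * (z.seq k * y.seq k)| ≤ K * ‖z‖ * ‖y‖ := by
  have h0 : 0 ≤ K := (abs_nonneg _).trans (hq 0)
  have hz : Summable fun k => |z.seq k| ^ (2 : ℝ) := by simpa using z.isDomJ.sq_summable
  have hy : Summable fun k => |y.seq k| ^ (2 : ℝ) := by simpa using y.isDomJ.sq_summable
  obtain ⟨hs, hle⟩ := Real.summable_and_inner_le_Lp_mul_Lq_tsum_of_nonneg
    Real.HolderConjugate.two_two (fun k => abs_nonneg (z.seq k)) (fun k => abs_nonneg (y.seq k))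
    hz hy
  have hroot : ∀ x : DomJ, (∑' k, |x.seq k| ^ (2 : ℝ)) ^ (1 / (2 : ℝ)) ≤ ‖x‖ := by
    intro x
    rw [← Real.sqrt_eq_rpow]
    refine Real.sqrt_le_iff.2 ⟨norm_nonneg _, ?_⟩
    simpa using x.tsum_sq_le
  have h1 : ‖∑' k, q k * (z.seq k * y.seq k)‖ ≤ ∑' k, K * (|z.seq k| * |y.seq k|) := by
    refine tsum_of_norm_bounded (hs.mul_left K).hasSum fun k => ?_
    rw [Real.norm_eq_abs, abs_mul, abs_mul]
    exact mul_le_mul_of_nonneg_right (hq k) (by positivity)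
  rw [tsum_mul_left] at h1
  refine h1.trans ?_
  rw [mul_assoc]
  refine mul_le_mul_of_nonneg_left (hle.trans ?_) h0
  exact mul_le_mul (hroot z) (hroot y) (by positivity) (norm_nonneg _)

/-- The bounded bilinear form `(z, y) ↦ ∑_k q_k z_k y_k` with bounded weights `q`. -/
noncomputable def weightedForm (hq : ∀ k, |q k| ≤ K) : DomJ →L[ℝ] DomJ →L[ℝ] ℝ :=
  LinearMap.mkContinuous₂
    (LinearMap.mk₂ ℝ (fun z y : DomJ => ∑' k, q k * (z.seq k * y.seq k))
      (fun z z' y => by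
        rw [← (summable_weighted_mul hq z y).tsum_add (summable_weighted_mul hq z' y)]
        exact tsum_congr fun k => by rw [seq_add, Pi.add_apply]; ring)
      (fun c z y => by
        rw [smul_eq_mul, ← tsum_mul_left]
        exact tsum_congr fun k => by rw [seq_smul, Pi.smul_apply, smul_eq_mul]; ring)
      (fun z y y' => by
        rw [← (summable_weighted_mul hq z y).tsum_add (summable_weighted_mul hq z y')]
        exact tsum_congr fun k => by rw [seq_add, Pi.add_apply]; ring)
      (fun c z y => by
        rw [smul_eq_mul, ← tsum_mul_left]
        exact tsum_congr fun k => by rw [seq_smul, Pi.smul_apply, smul_eq_mul]; ring))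
    K (abs_tsum_weighted_mul_le hq)

theorem weightedForm_apply (hq : ∀ k, |q k| ≤ K) (z y : DomJ) :
    weightedForm hq z y = ∑' k, q k * (z.seq k * y.seq k) := rfl

theorem weightedForm_comm (hq : ∀ k, |q k| ≤ K) (z y : DomJ) :
    weightedForm hq z y = weightedForm hq y z := by
  rw [weightedForm_apply, weightedForm_apply]
  exact tsum_congr fun k => by ring

theorem abs_weightedForm_le (hq : ∀ k, |q k| ≤ K) (z y : DomJ) :
    |weightedForm hq z y| ≤ K * ‖z‖ * ‖y‖ := abs_tsum_weighted_mul_le hq z y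

/-- If the weights tend to zero, the quadratic form is weakly continuous: it tends to zero along
bounded families which tend to zero componentwise. -/
theorem tendsto_weightedForm (hq : ∀ k, |q k| ≤ K) (hq0 : Tendsto q cofinite (𝓝 0))
    {ι : Type*} {l : Filter ι} {y : ι → DomJ} {R : ℝ} (hR : ∀ i, ‖y i‖ ≤ R)
    (hy : ∀ k, Tendsto (fun i => (y i).seq k) l (𝓝 0)) :
    Tendsto (fun i => weightedForm hq (y i) (y i)) l (𝓝 0) := by
  rw [Metric.tendsto_nhds]
  intro ε hε
  set δ := ε / (2 * (R ^ 2 + 1)) with hδ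
  have hδ0 : 0 < δ := by positivity
  have hfin : {k | ¬ |q k| < δ}.Finite := by
    have h := eventually_cofinite.1 (Metric.tendsto_nhds.1 hq0 δ hδ0)
    simpa only [Real.dist_eq, sub_zero] using h
  set S := hfin.toFinset with hS
  have hsum : Tendsto (fun i => ∑ k ∈ S, |q k| * (y i).seq k ^ 2) l (𝓝 0) := by
    have : Tendsto (fun i => ∑ k ∈ S, |q k| * (y i).seq k ^ 2) l
        (𝓝 (∑ k ∈ S, |q k| * (0 : ℝ) ^ 2)) :=
      tendsto_finsetSum _ fun k _ => ((hy k).pow 2).const_mul _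
    simpa using this
  filter_upwards [Metric.tendsto_nhds.1 hsum (ε / 2) (by positivity)] with i hi
  rw [Real.dist_eq, sub_zero] at hi ⊢
  have h0 : 0 ≤ R := (norm_nonneg _).trans (hR i)
  have hsq := (y i).isDomJ.sq_summable
  have hbound : ∀ k, ‖q k * ((y i).seq k * (y i).seq k)‖ ≤
      (S : Set ℤ).indicator (fun k => |q k| * (y i).seq k ^ 2) k + δ * (y i).seq k ^ 2 := by
    intro k
    rw [Real.norm_eq_abs, abs_mul, ← sq, abs_of_nonneg (sq_nonneg ((y i).seq k))]
    by_cases hk : k ∈ S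
    · rw [indicator_of_mem (Finset.mem_coe.2 hk)]
      have : 0 ≤ δ * (y i).seq k ^ 2 := by positivity
      linarith
    · rw [indicator_of_notMem (by simpa using hk), zero_add]
      have : |q k| < δ := by simpa [hS] using hk
      gcongr
  have hind : HasSum ((S : Set ℤ).indicator (fun k => |q k| * (y i).seq k ^ 2))
      (∑ k ∈ S, |q k| * (y i).seq k ^ 2) := by
    rw [← hasSum_subtype_iff_indicator]
    exact S.hasSum _
  have h1 := tsum_of_norm_bounded (hind.add (hsq.mul_left δ).hasSum) hbound
  rw [← weightedForm_apply hq, Real.norm_eq_abs, tsum_mul_left] at h1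
  have h2 : ∑' k, (y i).seq k ^ 2 ≤ R ^ 2 :=
    (y i).tsum_sq_le.trans (pow_le_pow_left₀ (norm_nonneg _) (hR i) 2)
  have h3 : δ * ∑' k, (y i).seq k ^ 2 ≤ ε / 2 := by
    calc δ * ∑' k, (y i).seq k ^ 2 ≤ δ * (R ^ 2 + 1) := by gcongr; linarith
      _ = ε / 2 := by rw [hδ]; field_simp
  have h4 := (le_abs_self _).trans_lt hi
  linarith

/-! ### Quartic functionals with a weakly continuous quadratic part -/

/-- The functional `¼ |||z|||⁴ + ∑_k q_k z_k²`. -/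
noncomputable def quarticFunctional (hq : ∀ k, |q k| ≤ K) (z : DomJ) : ℝ :=
  1 / 4 * ‖z‖ ^ 4 + weightedForm hq z z

theorem hasFDerivAt_quarticFunctional (hq : ∀ k, |q k| ≤ K) (z : DomJ) :
    ∃ D : DomJ →L[ℝ] ℝ, HasFDerivAt (quarticFunctional hq) D z ∧
      ∀ y, D y = inner ℝ (mulL4 z.profile z.profile) (mulL4 z.profile y.profile) +
        2 * weightedForm hq z y := by
  have hP : HasFDerivAt (profileL : DomJ → CircleL4) profileL.toContinuousLinearMap z :=
    profileL.toContinuousLinearMap.hasFDerivAt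
  have h1 := (mulL4.hasFDerivAt_of_bilinear hP hP).norm_sq.const_mul (1 / 4)
  have h2 := (weightedForm hq).hasFDerivAt_of_bilinear (hasFDerivAt_id z) (hasFDerivAt_id z)
  refine ⟨_, (h1.add h2).congr_of_eventuallyEq (Eventually.of_forall fun x => ?_), fun y => ?_⟩
  · simp only [quarticFunctional, Pi.add_apply, norm_mulL4_self, LinearIsometry.norm_map, id]
    ring
  · simp [profileL_apply, mulL4_comm y.profile z.profile, weightedForm_comm hq y z,
      ContinuousLinearMap.precompR, ContinuousLinearMap.precompL]
    ring

theorem differentiable_quarticFunctional (hq : ∀ k, |q k| ≤ K) :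
    Differentiable ℝ (quarticFunctional hq) := fun z =>
  let ⟨_, hD, _⟩ := hasFDerivAt_quarticFunctional hq z
  hD.differentiableAt

theorem quarticFunctional_ge (hq : ∀ k, |q k| ≤ K) (z : DomJ) :
    ‖z‖ ^ 2 - (K + 1) ^ 2 ≤ quarticFunctional hq z := by
  have h := (abs_le.1 (abs_weightedForm_le hq z z)).1
  rw [quarticFunctional]
  -- completing the square: `¼ s² - K s - s + (K + 1)² = (s / 2 - (K + 1))²` with `s = ‖z‖²`
  nlinarith [sq_nonneg (‖z‖ ^ 2 / 2 - (K + 1))]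

theorem bddBelow_quarticFunctional (hq : ∀ k, |q k| ≤ K) :
    BddBelow (range (quarticFunctional hq)) := by
  refine ⟨-(K + 1) ^ 2, ?_⟩
  rintro _ ⟨z, rfl⟩
  have := quarticFunctional_ge hq z
  nlinarith [sq_nonneg ‖z‖]

theorem tendsto_quarticFunctional (hq : ∀ k, |q k| ≤ K) :
    Tendsto (quarticFunctional hq) (Bornology.cobounded DomJ) atTop := by
  refine tendsto_atTop_mono (quarticFunctional_ge hq) ?_
  refine tendsto_atTop_add_const_right _ _ ?_
  exact (tendsto_pow_atTop two_ne_zero).comp tendsto_norm_cobounded_atTop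

/-- Uniform convexity of the `L⁴` norm, in the form needed for minimising sequences. -/
theorem quarticFunctional_midpoint (hq : ∀ k, |q k| ≤ K) (a b : DomJ) :
    quarticFunctional hq ((2⁻¹ : ℝ) • (a + b)) + 1 / 4 * ‖(2⁻¹ : ℝ) • (a - b)‖ ^ 4 ≤
      (quarticFunctional hq a + quarticFunctional hq b) / 2 -
        1 / 4 * weightedForm hq (a - b) (a - b) := by
  have h := CircleL4.clarkson (profileL a) (profileL b)
  rw [← map_add, ← map_sub, ← map_smul, ← map_smul, LinearIsometry.norm_map,
    LinearIsometry.norm_map, LinearIsometry.norm_map, LinearIsometry.norm_map] at h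
  have h2 : weightedForm hq ((2⁻¹ : ℝ) • (a + b)) ((2⁻¹ : ℝ) • (a + b)) =
      (weightedForm hq a a + weightedForm hq b b) / 2 -
        1 / 4 * weightedForm hq (a - b) (a - b) := by
    simp only [map_smul, map_add, map_sub, add_apply,
      sub_apply, smul_apply, smul_eq_mul]
    ring
  simp only [quarticFunctional, h2]
  linarith

/-- By the midpoint inequality every minimising sequence has a strongly convergent
subsequence. -/
theorem exists_isMin_quarticFunctional (hq : ∀ k, |q k| ≤ K) (hq0 : Tendsto q cofinite (𝓝 0)) :
    ∃ α : DomJ, ∀ z, quarticFunctional hq α ≤ quarticFunctional hq z := by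
  set J := quarticFunctional hq with hJ
  have hbdd : BddBelow (range J) := bddBelow_quarticFunctional hq
  obtain ⟨v, -, hv, hvr⟩ := exists_seq_tendsto_sInf (range_nonempty J) hbdd
  choose z hz using hvr
  have hlim : Tendsto (fun n => J (z n)) atTop (𝓝 (sInf (range J))) := by simpa [hz] using hv
  have hmin : ∀ y, sInf (range J) ≤ J y := fun y => csInf_le hbdd (mem_range_self y)
  obtain ⟨B, hB⟩ := hlim.bddAbove_range
  set R := √(B + (K + 1) ^ 2) with hRdef
  have hR : ∀ n, ‖z n‖ ≤ R := fun n => by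
    refine Real.le_sqrt_of_sq_le ?_
    have h1 := quarticFunctional_ge hq (z n)
    have h2 : J (z n) ≤ B := hB (mem_range_self n)
    linarith
  -- a subsequence converges componentwise, by compactness of `[-R, R]^ℤ`
  obtain ⟨ζ, -, φ, hφ, hζ⟩ :=
    (isCompact_univ_pi fun _ : ℤ => isCompact_Icc (a := -R) (b := R)).tendsto_subseq
    (x := fun n => (z n).seq) fun n k _ => abs_le.1 (((z n).abs_seq_le k).trans (hR n))
  rw [tendsto_pi_nhds] at hζ
  have hcomp : ∀ k, Tendsto (fun p : ℕ × ℕ => (z (φ p.1) - z (φ p.2)).seq k) atTop (𝓝 0) := by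
    intro k
    have h1 := ((hζ k).comp tendsto_fst).sub ((hζ k).comp (tendsto_snd (f := atTop) (g := atTop)))
    rw [prod_atTop_atTop_eq, sub_self] at h1
    exact h1
  have hQ := tendsto_weightedForm hq hq0 (R := R + R)
    (fun p : ℕ × ℕ => (norm_sub_le _ _).trans (add_le_add (hR _) (hR _))) hcomp
  have hJφ := hlim.comp hφ.tendsto_atTop
  have hJsum : Tendsto (fun p : ℕ × ℕ => (J (z (φ p.1)) + J (z (φ p.2))) / 2 -
      1 / 4 * weightedForm hq (z (φ p.1) - z (φ p.2)) (z (φ p.1) - z (φ p.2)) - sInf (range J))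
      atTop (𝓝 0) := by
    have h1 := (hJφ.comp tendsto_fst).add (hJφ.comp (tendsto_snd (f := atTop) (g := atTop)))
    rw [prod_atTop_atTop_eq] at h1
    have h2 := ((h1.div_const 2).sub (hQ.const_mul (1 / 4))).sub_const (sInf (range J))
    simpa using h2
  have hpow : Tendsto (fun p : ℕ × ℕ => ‖z (φ p.1) - z (φ p.2)‖ ^ 4) atTop (𝓝 0) := by
    -- the last term of the midpoint inequality is `¼ ‖2⁻¹ (a - b)‖⁴ = ‖a - b‖⁴ / 64`
    have h64 := hJsum.const_mul 64
    rw [mul_zero] at h64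
    refine squeeze_zero (fun p => by positivity) (fun p => ?_) h64
    have h1 := quarticFunctional_midpoint hq (z (φ p.1)) (z (φ p.2))
    have h2 := hmin ((2⁻¹ : ℝ) • (z (φ p.1) + z (φ p.2)))
    rw [norm_smul, mul_pow, show ‖(2⁻¹ : ℝ)‖ = 2⁻¹ by norm_num, ← hJ] at h1
    linarith
  have hcauchy : CauchySeq (z ∘ φ) := by
    rw [cauchySeq_iff_tendsto_dist_atTop_0]
    have h1 := ((Real.continuous_sqrt.comp Real.continuous_sqrt).tendsto 0).comp hpow
    simp only [Function.comp_apply, Real.sqrt_zero] at h1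
    refine h1.congr fun p => ?_
    rw [Function.comp_apply, Function.comp_apply,
      show ‖z (φ p.1) - z (φ p.2)‖ ^ 4 = (‖z (φ p.1) - z (φ p.2)‖ ^ 2) ^ 2 by ring,
      Real.sqrt_sq (by positivity), Real.sqrt_sq (by positivity), dist_eq_norm]
    rfl
  obtain ⟨α, hα⟩ := cauchySeq_tendsto_of_complete hcauchy
  refine ⟨α, fun y => ?_⟩
  have h1 : Tendsto (J ∘ z ∘ φ) atTop (𝓝 (J α)) :=
    ((differentiable_quarticFunctional hq).continuous.tendsto α).comp hα
  rw [tendsto_nhds_unique h1 hJφ]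
  exact hmin y

end DomJ

/-! ### The functional `J` as a quartic functional -/

namespace DomJ

/-- The weights `Φ_k'(0) / k²` for odd `k`, extended by zero to the even integers. -/
noncomputable def weight (Φ : ℕ → ℝ → ℝ) (k : ℤ) : ℝ :=
  if Odd k then derivZero (Φ k.natAbs) / (k : ℝ) ^ 2 else 0

theorem weight_neg (Φ : ℕ → ℝ → ℝ) (k : ℤ) : weight Φ (-k) = weight Φ k := by
  simp [weight]

theorem weight_mul (Φ : ℕ → ℝ → ℝ) (z : DomJ) (k : ℤ) :
    derivZero (Φ k.natAbs) / (k : ℝ) ^ 2 * z.seq k ^ 2 = weight Φ k * (z.seq k * z.seq k) := by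
  rw [weight]
  split_ifs with h
  · rw [sq (z.seq k)]
  · rw [z.isDomJ.even_zero k (Int.not_odd_iff_even.1 h)]; simp

/-- Linear growth of `Φ_k'(0)` makes the weights decay like `1/k`. -/
theorem abs_weight_le {Φ : ℕ → ℝ → ℝ} {C : ℝ} (hC : ∀ k : ℕ, Odd k → |derivZero (Φ k)| ≤ C * k)
    (hC0 : 0 ≤ C) (k : ℤ) : |weight Φ k| ≤ C * |(k : ℝ)⁻¹| := by
  rw [weight]
  split_ifs with h
  · have hk : (k : ℝ) ≠ 0 := by
      rintro h0
      rw [Int.cast_eq_zero.1 h0] at h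
      simp at h
    have h1 := hC k.natAbs (Int.natAbs_odd.2 h)
    rw [show ((k.natAbs : ℕ) : ℝ) = |(k : ℝ)| by
      rw [Nat.cast_natAbs, Int.cast_abs]] at h1
    have hk' : 0 < |(k : ℝ)| := abs_pos.2 hk
    rw [abs_div, abs_pow, abs_inv, div_le_iff₀ (by positivity)]
    refine h1.trans_eq ?_
    field_simp
  · rw [abs_zero]; positivity

theorem abs_weight_le_const {Φ : ℕ → ℝ → ℝ} {C : ℝ}
    (hC : ∀ k : ℕ, Odd k → |derivZero (Φ k)| ≤ C * k)
    (hC0 : 0 ≤ C) (k : ℤ) : |weight Φ k| ≤ C := by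
  refine (abs_weight_le hC hC0 k).trans (mul_le_of_le_one_right hC0 ?_)
  rcases eq_or_ne k 0 with rfl | hk
  · simp
  · rw [abs_inv]
    refine inv_le_one_of_one_le₀ ?_
    rw [← Int.cast_abs]
    exact_mod_cast Int.one_le_abs hk

theorem tendsto_weight {Φ : ℕ → ℝ → ℝ} {C : ℝ} (hC : ∀ k : ℕ, Odd k → |derivZero (Φ k)| ≤ C * k)
    (hC0 : 0 ≤ C) : Tendsto (weight Φ) cofinite (𝓝 0) := by
  refine squeeze_zero_norm (a := fun k : ℤ => C * |(k : ℝ)⁻¹|) (abs_weight_le hC hC0) ?_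
  have h1 : Tendsto (fun k : ℤ => (k : ℝ)⁻¹) cofinite (𝓝 0) := by
    have := Int.tendsto_coe_cofinite
    rw [← Metric.cobounded_eq_cocompact] at this
    exact tendsto_inv₀_cobounded.comp this
  simpa using h1.abs.const_mul C

theorem functionalJ_eq {Φ : ℕ → ℝ → ℝ} {γ ω K : ℝ}
    (hq : ∀ k, |(2 * Real.pi / ω) / (γ * ω ^ 4) * weight Φ k| ≤ K) :
    functionalJ Φ γ ω = quarticFunctional hq := by
  funext z
  rw [functionalJ, quarticFunctional, conv_conv_zero, weightedForm_apply, ← tsum_mul_left]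
  congr 1
  exact tsum_congr fun k => by rw [weight_mul]; ring

/-! ### Sine modes on the circle -/

/-- The function `sin(2πks)` on the circle. -/
noncomputable def circleSin (k : ℤ) (s : UnitAddCircle) : ℝ := (fourier k s).im

theorem continuous_circleSin (k : ℤ) : Continuous (circleSin k) :=
  Complex.continuous_im.comp (fourier k).continuous

theorem circleSin_neg (k : ℤ) (s : UnitAddCircle) : circleSin (-k) s = -circleSin k s := by
  rw [circleSin, fourier_neg, Complex.conj_im, circleSin]

theorem memLp_of_continuous {f : UnitAddCircle → ℝ} (hf : Continuous f) (p : ℝ≥0∞) :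
    MemLp f p haarAddCircle := by
  obtain ⟨B, hB⟩ := isCompact_univ.exists_bound_of_continuousOn hf.continuousOn
  exact MemLp.of_bound hf.aestronglyMeasurable B (Eventually.of_forall fun s => hB s trivial)

theorem _root_.HasSineCoeffs.integral_mul_circleSin {f : UnitAddCircle → ℝ} {b : ℤ → ℝ}
    (hf : HasSineCoeffs f b) (hfi : Integrable f haarAddCircle) (k : ℤ) :
    ∫ s, f s * circleSin k s ∂haarAddCircle = b k := by
  have h := congrArg Complex.re (hf k)
  rw [Complex.ofReal_re] at h
  have hi : Integrable (fun s => fourier (-k) s • (Complex.I * (f s : ℂ))) haarAddCircle :=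
    (integrable_I_mul hfi).fourier_smul _
  rw [← h, fourierCoeff]
  refine (integral_congr_ae (Eventually.of_forall fun s => ?_)).trans (integral_re hi)
  simp only [circleSin, smul_eq_mul, fourier_neg, RCLike.re_to_complex, Complex.mul_re,
    Complex.conj_re, Complex.conj_im, Complex.I_re, Complex.I_im, Complex.ofReal_re,
    Complex.ofReal_im, Complex.mul_im]
  ring

/-- The sequence `δ_n - δ_{-n}`, for odd `n`, with profile `2 sin(2πns)`. -/
theorem exists_mode {n : ℤ} (hn : Odd n) :
    ∃ e : DomJ, e.seq = Pi.single n 1 - Pi.single (-n) 1 ∧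
      e.profile =ᵐ[haarAddCircle] fun s => 2 * circleSin n s := by
  have hm : MemLp (fun s => 2 * circleSin n s) 4 (haarAddCircle (T := (1 : ℝ))) :=
    memLp_of_continuous ((continuous_circleSin n).const_mul 2) 4
  have hn0 : n ≠ -n := fun h => by
    have : n = 0 := by omega
    rw [this] at hn
    simp at hn
  have hcoef : HasSineCoeffs (fun s => 2 * circleSin n s)
      (Pi.single n 1 - Pi.single (-n) 1 : ℤ → ℝ) := by
    intro k
    have h1 : (fun s => Complex.I * ((2 * circleSin n s : ℝ) : ℂ)) =
        fun s => fourier n s - fourier (-n) s := by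
      funext s
      rw [fourier_neg, Complex.sub_conj, circleSin]
      push_cast; ring
    rw [h1, fourierCoeff_fun_sub ((fourier n).continuous.integrable_of_hasCompactSupport
        (HasCompactSupport.of_compactSpace _))
        ((fourier (-n)).continuous.integrable_of_hasCompactSupport
        (HasCompactSupport.of_compactSpace _)),
      fourierCoeff_fourier, fourierCoeff_fourier]
    simp only [Pi.sub_apply, Pi.single_apply, Complex.ofReal_sub]
    split_ifs <;> simp
  obtain ⟨e, he, hep⟩ := exists_of_hasSineCoeffs (hcoef.congr_ae hm.coeFn_toLp.symm)
    (fun k hk => by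
      have h1 : k ≠ n := fun h => by rw [h] at hk; exact (Int.not_even_iff_odd.2 hn) hk
      have h2 : k ≠ -n := fun h => by rw [h, even_neg] at hk; exact (Int.not_even_iff_odd.2 hn) hk
      simp [h1, h2])
    (fun k => by
      simp only [Pi.sub_apply, Pi.single_apply, neg_eq_iff_eq_neg, neg_neg]
      ring)
  exact ⟨e, he, by rw [hep]; exact hm.coeFn_toLp⟩

/-- Along the mode `δ_n - δ_{-n}` a functional with a negative weight at the odd frequency `n` is
negative near zero. -/
theorem exists_quarticFunctional_neg {q : ℤ → ℝ} {K : ℝ} (hq : ∀ k, |q k| ≤ K) {n : ℤ}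
    (hn : Odd n) (hqn : q n < 0) (hqn' : q (-n) < 0) : ∃ z, quarticFunctional hq z < 0 := by
  obtain ⟨e, he, -⟩ := exists_mode hn
  have hn0 : -n ≠ n := fun h => by
    have : n = 0 := by omega
    rw [this] at hn
    simp at hn
  have hsum : weightedForm hq e e = q n + q (-n) := by
    rw [weightedForm_apply, tsum_eq_sum (s := {n, -n})]
    · rw [Finset.sum_pair hn0.symm]
      simp [he, hn0, hn0.symm]
    · intro k hk
      simp only [Finset.mem_insert, Finset.mem_singleton, not_or] at hk
      simp [he, hk.1, hk.2]
  have hform : ∀ ε : ℝ, quarticFunctional hq (ε • e) =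
      ε ^ 2 * (1 / 4 * ‖e‖ ^ 4 * ε ^ 2 + (q n + q (-n))) := by
    intro ε
    simp only [quarticFunctional, map_smul, smul_apply, hsum]
    rw [norm_smul,
      mul_pow, show ‖ε‖ ^ 4 = (‖ε‖ ^ 2) ^ 2 by ring, Real.norm_eq_abs, sq_abs, smul_eq_mul,
      smul_eq_mul]
    ring
  have hlim : Tendsto (fun ε : ℝ => 1 / 4 * ‖e‖ ^ 4 * ε ^ 2 + (q n + q (-n))) (𝓝[≠] 0)
      (𝓝 (q n + q (-n))) := by
    have : Continuous fun ε : ℝ => 1 / 4 * ‖e‖ ^ 4 * ε ^ 2 + (q n + q (-n)) := by fun_prop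
    have h := this.tendsto 0
    simp only [ne_eq, OfNat.ofNat_ne_zero, not_false_eq_true, zero_pow, mul_zero, zero_add] at h
    exact h.mono_left nhdsWithin_le_nhds
  obtain ⟨ε, hε, hε0⟩ := ((hlim.eventually (gt_mem_nhds (by linarith : q n + q (-n) < 0))).and
    self_mem_nhdsWithin).exists
  refine ⟨ε • e, ?_⟩
  rw [hform]
  have : 0 < ε ^ 2 := sq_pos_of_ne_zero hε0
  exact mul_neg_of_pos_of_neg this hε

/-- The cube of a profile has the sine coefficients `-(z * z * z)_k`. They form an odd sequence and
vanish for even `k`, since a sum of three odd numbers is odd. -/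
theorem exists_cube_hasSineCoeffs (z : DomJ) :
    ∃ b : ℤ → ℝ, HasSineCoeffs (fun s => z.profile s ^ 3) b ∧ (∀ k, b (-k) = -b k) ∧
      ∀ k, Even k → b k = 0 := by
  obtain ⟨U, hU, hU4⟩ := z.isDomJ.exists_L4
  have hUp : U =ᵐ[haarAddCircle] fun s => Complex.I * (z.profile s : ℂ) := by
    refine ae_eq_of_fourierCoeff_eq (hU4.integrable (by norm_num))
      (integrable_I_mul (integrable_circleL4 _)) fun k => ?_
    rw [hU, z.hasSineCoeffs_profile k]
  have h2 := (memLp_four_iff (Lp.aestronglyMeasurable U)).1 hU4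
  set c := conv z.seq z.seq with hc
  have hcoef : ∀ k, fourierCoeff h2.toLp k = c k := fun k => by
    rw [← (fourier_mul_self_coeff hU k).2]
    exact congrFun (fourierCoeff_congr_ae h2.coeFn_toLp) k
  have hcU : ∀ k, fourierCoeff (fun t => (h2.toLp : UnitAddCircle → ℂ) t * U t) k =
      (conv c z.seq k : ℝ) := by
    intro k
    have h := (hasSum_fourierCoeff_mul h2.toLp U k).tsum_eq
    simp only [hcoef, hU] at h
    rw [← h, conv]
    push_cast
    rfl
  have hceven : ∀ k, c (-k) = c k := conv_neg_self z.isDomJ.odd_symm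
  have hcodd : ∀ l, ¬ Even l → c l = 0 := by
    intro l hl
    rw [hc, conv, ← tsum_zero (β := ℤ)]
    refine tsum_congr fun m => ?_
    by_cases hm : Even m
    · rw [z.isDomJ.even_zero m hm, zero_mul]
    · rw [z.isDomJ.even_zero (l - m), mul_zero]
      exact Int.even_sub.2 ⟨fun h => absurd h hl, fun h => absurd h hm⟩
  refine ⟨fun k => -conv c z.seq k, fun k => ?_, fun k => ?_, fun k hk => ?_⟩
  · rw [Complex.ofReal_neg, ← hcU k, ← neg_one_mul, ← fourierCoeff.const_mul]
    refine congrFun (fourierCoeff_congr_ae ?_) k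
    filter_upwards [hUp, h2.coeFn_toLp] with s h1 h3
    rw [h3, h1]
    push_cast
    linear_combination (Complex.I * (z.profile s : ℂ) ^ 3) * Complex.I_sq
  · change -conv c z.seq (-k) = -(-conv c z.seq k)
    rw [neg_inj, conv, conv, ← (Equiv.neg ℤ).tsum_eq, ← tsum_neg]
    refine tsum_congr fun l => ?_
    simp only [Equiv.neg_apply]
    rw [hceven, show -k - -l = -(k - l) by ring, z.isDomJ.odd_symm, mul_neg]
  · rw [neg_eq_zero, conv, ← tsum_zero (β := ℤ)]
    refine tsum_congr fun l => ?_
    by_cases hl : Even l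
    · rw [z.isDomJ.even_zero (k - l) (hk.sub hl), mul_zero]
    · rw [hcodd l hl, zero_mul]

end DomJ

/-! ### The Euler-Lagrange equation -/

namespace DomJ

theorem integrable_profile_cube (α : DomJ) :
    Integrable (fun s => α.profile s ^ 3) haarAddCircle := by
  have h1 : MemLp (fun s => (mulL4 α.profile α.profile) s * α.profile s) 1 haarAddCircle :=
    ((Lp.memLp α.profile).mono_exponent (by norm_num : (2 : ℝ≥0∞) ≤ 4)).mul'
      (Lp.memLp (mulL4 α.profile α.profile))
  refine (h1.integrable le_rfl).congr ?_
  filter_upwards [coeFn_mulL4 α.profile α.profile] with s hs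
  rw [hs]; ring

/-- The Euler-Lagrange equation: the sine coefficients of `u³` are `-2 q_k α_k`. It is tested with
the modes `δ_k - δ_{-k}` for odd `k`; for even `k` both sides vanish. -/
theorem hasSineCoeffs_cube_of_critical {q : ℤ → ℝ} {K : ℝ} (hq : ∀ k, |q k| ≤ K)
    (hqs : ∀ k, q (-k) = q k) {α : DomJ} (hα : fderiv ℝ (quarticFunctional hq) α = 0) :
    HasSineCoeffs (fun s => α.profile s ^ 3) fun k => -2 * q k * α.seq k := by
  obtain ⟨b, hb, hodd, heven⟩ := exists_cube_hasSineCoeffs α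
  obtain ⟨D, hD, hDy⟩ := hasFDerivAt_quarticFunctional hq α
  rw [hD.fderiv] at hα
  suffices h : b = fun k => -2 * q k * α.seq k from h ▸ hb
  funext k
  rcases Int.even_or_odd k with hk | hk
  · rw [heven k hk, α.isDomJ.even_zero k hk, mul_zero]
  · obtain ⟨e, he, hep⟩ := exists_mode hk
    have hk0 : -k ≠ k := fun h => by
      have : k = 0 := by omega
      rw [this] at hk
      simp at hk
    have h1 := hDy e
    have hform : weightedForm hq α e = 2 * (q k * α.seq k) := by
      rw [weightedForm_apply, tsum_eq_sum (s := {k, -k})]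
      · rw [Finset.sum_pair hk0.symm]
        simp only [he, Pi.sub_apply, Pi.single_eq_same, Pi.single_eq_of_ne hk0, hqs,
          α.isDomJ.odd_symm, Pi.single_eq_of_ne hk0.symm]
        ring
      · intro m hm
        simp only [Finset.mem_insert, Finset.mem_singleton, not_or] at hm
        simp [he, hm.1, hm.2]
    have hinner : inner ℝ (mulL4 α.profile α.profile) (mulL4 α.profile e.profile) = 2 * b k := by
      rw [← hb.integral_mul_circleSin (integrable_profile_cube α) k, L2.inner_def,
        ← integral_const_mul]
      refine integral_congr_ae ?_
      filter_upwards [coeFn_mulL4 α.profile α.profile, coeFn_mulL4 α.profile e.profile, hep]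
        with s h1 h2 h3
      rw [h1, h2, h3]
      simp only [RCLike.inner_apply, conj_trivial]
      ring
    rw [hα, zero_apply, hform, hinner] at h1
    linarith

theorem memLp_two_of_hasSineCoeffs {f : UnitAddCircle → ℝ} {b : ℤ → ℝ} (hf : HasSineCoeffs f b)
    (hfi : Integrable f haarAddCircle) (hb : Summable fun k => b k ^ 2) :
    MemLp f 2 haarAddCircle := by
  obtain ⟨V, hV⟩ := exists_synth b hb
  have h := ae_eq_of_fourierCoeff_eq (integrable_I_mul hfi)
    ((Lp.memLp V).integrable (by norm_num)) fun k => (hf k).trans (hV k).symm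
  have h1 : MemLp (fun s => Complex.I * (f s : ℂ)) 2 haarAddCircle :=
    (memLp_congr_ae h).2 (Lp.memLp V)
  refine h1.im.congr_norm hfi.1 (Eventually.of_forall fun s => ?_)
  simp

/-- Parseval's identity for sine series. -/
theorem hasSum_integral_mul {f r : UnitAddCircle → ℝ} {b : ℤ → ℝ} (hf : HasSineCoeffs f b)
    (hf2 : MemLp f 2 haarAddCircle) (hr : MemLp r 2 haarAddCircle) (hodd : ∀ k, b (-k) = -b k) :
    HasSum (fun n : ℕ => 2 * b n * ∫ s, r s * circleSin n s ∂haarAddCircle)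
      (∫ s, f s * r s ∂haarAddCircle) := by
  have hF : MemLp (fun s => Complex.I * (f s : ℂ)) 2 haarAddCircle :=
    hf2.ofReal.const_mul Complex.I
  have hR : MemLp (fun s => (r s : ℂ)) 2 haarAddCircle := hr.ofReal
  have hri : Integrable r haarAddCircle := hr.integrable (by norm_num)
  have h := hasSum_fourierCoeff_mul hF.toLp hR.toLp 0
  have h0 : fourierCoeff (fun t => (hF.toLp : UnitAddCircle → ℂ) t *
      (hR.toLp : UnitAddCircle → ℂ) t) 0 = Complex.I * (∫ s, f s * r s ∂haarAddCircle : ℝ) := by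
    rw [fourierCoeff, ← integral_complex_ofReal, ← integral_const_mul]
    refine integral_congr_ae ?_
    filter_upwards [hF.coeFn_toLp, hR.coeFn_toLp] with s h1 h2
    rw [h1, h2]
    simp only [neg_zero, fourier_zero, one_smul, Complex.ofReal_mul]
    ring
  have hl : ∀ l, (fourierCoeff (hF.toLp : UnitAddCircle → ℂ) l *
      fourierCoeff (hR.toLp : UnitAddCircle → ℂ) (0 - l)).im =
      b l * ∫ s, r s * circleSin l s ∂haarAddCircle := by
    intro l
    rw [congrFun (fourierCoeff_congr_ae hF.coeFn_toLp) l, hf l,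
      congrFun (fourierCoeff_congr_ae hR.coeFn_toLp) (0 - l), Complex.im_ofReal_mul]
    congr 1
    have hi : Integrable (fun s => fourier (-(0 - l)) s • (r s : ℂ)) haarAddCircle :=
      hri.ofReal.fourier_smul _
    rw [fourierCoeff]
    refine (integral_im hi).symm.trans (integral_congr_ae (Eventually.of_forall fun s => ?_))
    simp only [circleSin, smul_eq_mul, zero_sub, neg_neg, RCLike.im_to_complex, Complex.mul_im,
      Complex.ofReal_re, Complex.ofReal_im]
    ring
  have him := Complex.hasSum_im h
  rw [h0] at him
  simp only [hl, Complex.mul_im, Complex.I_re, Complex.I_im, Complex.ofReal_re, zero_mul, one_mul,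
    zero_add] at him
  have hb0 : b 0 = 0 := by
    have := hodd 0
    rw [neg_zero] at this
    linarith
  have hn := him.nat_add_neg
  rw [hb0, zero_mul, add_zero] at hn
  refine hn.congr_fun fun n => ?_
  simp only [hodd, circleSin_neg, mul_neg, integral_neg]
  ring

/-! ### Transfer to functions of time -/

/-- The covering map `t ↦ ωt/(2π)` of the circle of length one by the time axis. -/
noncomputable def timeMk (ω : ℝ) (t : ℝ) : UnitAddCircle :=
  ((ω / (2 * Real.pi) * t : ℝ) : UnitAddCircle)

theorem continuous_timeMk (ω : ℝ) : Continuous (timeMk ω) :=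
  (AddCircle.continuous_mk' 1).comp (continuous_const.mul continuous_id)

theorem map_timeMk {ω : ℝ} (hω : 0 < ω) :
    Measure.map (timeMk ω) (volume.restrict (Ioc 0 (2 * Real.pi / ω))) =
      ENNReal.ofReal (2 * Real.pi / ω) • haarAddCircle := by
  set a := ω / (2 * Real.pi) with ha
  have ha0 : 0 < a := by positivity
  have hT : 2 * Real.pi / ω = a⁻¹ := by rw [ha, inv_div]
  have h1 : Measure.map (fun t : ℝ => a * t) (volume.restrict (Ioc 0 (2 * Real.pi / ω))) =
      ENNReal.ofReal (2 * Real.pi / ω) • volume.restrict (Ioc 0 (0 + 1)) := by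
    have hpre : Ioc 0 (2 * Real.pi / ω) = (fun t : ℝ => a * t) ⁻¹' (Ioc 0 (0 + 1)) := by
      ext t
      rw [hT]
      simp only [mem_preimage, mem_Ioc, zero_add, mul_pos_iff_of_pos_left ha0]
      rw [← one_div, le_div_iff₀' ha0]
    rw [hpre, ← Measure.restrict_map (by fun_prop) measurableSet_Ioc,
      Real.map_volume_mul_left ha0.ne', Measure.restrict_smul, hT, abs_of_pos (inv_pos.2 ha0)]
  have h2 : timeMk ω = (fun x : ℝ => (x : UnitAddCircle)) ∘ fun t : ℝ => a * t := rfl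
  rw [h2, ← Measure.map_map (AddCircle.measurable_mk') (by fun_prop), h1, Measure.map_smul,
    (UnitAddCircle.measurePreserving_mk 0).map_eq, AddCircle.volume_eq_smul_haarAddCircle]
  simp

theorem circleSin_timeMk (ω : ℝ) (k : ℤ) (t : ℝ) :
    circleSin k (timeMk ω t) = Real.sin (ω * k * t) := by
  rw [circleSin, timeMk, fourier_coe_apply]
  have : 2 * (Real.pi : ℂ) * Complex.I * k * ((ω / (2 * Real.pi) * t : ℝ) : ℂ) / ((1 : ℝ) : ℂ) =
      ((ω * k * t : ℝ) : ℂ) * Complex.I := by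
    have : (Real.pi : ℂ) ≠ 0 := by exact_mod_cast Real.pi_ne_zero
    push_cast
    field_simp
  rw [this, Complex.exp_ofReal_mul_I_im]

theorem integral_timeMk {ω : ℝ} (hω : 0 < ω) {f : UnitAddCircle → ℝ}
    (hf : AEStronglyMeasurable f haarAddCircle) :
    ∫ t in Ioc 0 (2 * Real.pi / ω), f (timeMk ω t) = 2 * Real.pi / ω * ∫ s, f s ∂haarAddCircle := by
  have h := integral_map (μ := volume.restrict (Ioc 0 (2 * Real.pi / ω)))
    (continuous_timeMk ω).aemeasurable (f := f)
    (by rw [map_timeMk hω]; exact hf.smul_measure _)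
  rw [← h, map_timeMk hω, integral_smul_measure, ENNReal.toReal_ofReal (by positivity), smul_eq_mul]

theorem memLp_timeMk {ω : ℝ} (hω : 0 < ω) {f : UnitAddCircle → ℝ} {p : ℝ≥0∞}
    (hf : MemLp f p haarAddCircle) :
    MemLp (fun t => f (timeMk ω t)) p (volume.restrict (Ioc 0 (2 * Real.pi / ω))) := by
  have h : MemLp f p (Measure.map (timeMk ω) (volume.restrict (Ioc 0 (2 * Real.pi / ω)))) := by
    rw [map_timeMk hω]
    exact hf.smul_measure ENNReal.ofReal_ne_top
  exact h.comp_of_map (continuous_timeMk ω).aemeasurable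

/-- Parseval's identity for sine series over a period. -/
theorem hasSum_integral_timeMk_mul {ω : ℝ} (hω : 0 < ω) {f : UnitAddCircle → ℝ} {b : ℤ → ℝ}
    (hf : HasSineCoeffs f b) (hf2 : MemLp f 2 haarAddCircle) (hodd : ∀ k, b (-k) = -b k)
    {r : ℝ → ℝ} (hr : Continuous r) (hper : ∀ t, r (t + 2 * Real.pi / ω) = r t) :
    HasSum (fun n : ℕ => 2 * b n * ∫ t in Ioc 0 (2 * Real.pi / ω), r t * Real.sin (ω * n * t))
      (∫ t in Ioc 0 (2 * Real.pi / ω), f (timeMk ω t) * r t) := by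
  have hp : Function.Periodic (fun s : ℝ => r (2 * Real.pi / ω * s)) 1 := fun s => by
    simp only [mul_add, mul_one, hper]
  set ρ : UnitAddCircle → ℝ := hp.lift with hρ
  have hρc : Continuous ρ := by
    rw [continuous_coinduced_dom]
    exact hr.comp (continuous_const.mul continuous_id)
  have hρt : ∀ t, ρ (timeMk ω t) = r t := fun t => by
    rw [hρ, timeMk, Function.Periodic.lift_coe]
    congr 1
    field_simp
  have hρ2 := memLp_of_continuous hρc 2
  have h := (hasSum_integral_mul hf hf2 hρ2 hodd).mul_left (2 * Real.pi / ω)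
  rw [← integral_timeMk hω (f := fun s => f s * ρ s) (hf2.1.mul hρ2.1)] at h
  simp only [hρt] at h
  refine h.congr_fun fun n => ?_
  have h1 := integral_timeMk hω (f := fun s => ρ s * circleSin n s)
    (hρc.mul (continuous_circleSin n)).aestronglyMeasurable
  simp only [hρt, circleSin_timeMk, Int.cast_natCast] at h1
  rw [h1]
  ring

end DomJ

end SineSeries

/-! ### Modes in space -/

/-- A decaying solution of `φ'' + κ² g φ = 0` on the half line, with derivatives `φ₁`, `φ₂` and
quantitative exponential decay of `φ` and `φ₁`. -/
structure IsMode (g : ℝ → ℝ) (κ ρ N N₁ : ℝ) (φ φ₁ φ₂ : ℝ → ℝ) : Prop where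
  prim : IsHalfLinePrimitive φ φ₁
  prim₁ : IsHalfLinePrimitive φ₁ φ₂
  eq : ∀ᵐ x, 0 < x → φ₂ x = -(κ ^ 2 * g x * φ x)
  bound : ∀ x, 0 ≤ x → |φ x| ≤ N * Real.exp (-ρ * x)
  bound₁ : ∀ x, 0 ≤ x → |φ₁ x| ≤ N₁ * Real.exp (-ρ * x)

theorem exists_bound_of_compactSupport {η : ℝ → ℝ} (hη : Continuous η) {R : ℝ}
    (hR : ∀ x, R < |x| → η x = 0) : ∃ B, ∀ x, ‖η x‖ ≤ B := by
  obtain ⟨B, hB⟩ := (isCompact_Icc (a := -R) (b := R)).exists_bound_of_continuousOn hη.continuousOn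
  refine ⟨max B 0, fun x => ?_⟩
  rcases le_or_gt |x| R with h | h
  · exact (hB x (abs_le.1 h)).trans (le_max_left _ _)
  · rw [hR x h, norm_zero]; exact le_max_right _ _

theorem deriv_eq_zero_of_lt_abs {η : ℝ → ℝ} {R : ℝ} (hR : ∀ x, R < |x| → η x = 0) {x : ℝ}
    (hx : R < |x|) : deriv η x = 0 := by
  have : η =ᶠ[𝓝 x] fun _ => 0 := by
    filter_upwards [(isOpen_lt continuous_const continuous_abs).mem_nhds hx] with y hy using hR y hy
  rw [this.deriv_eq, deriv_const]

theorem integrable_of_exp_bound {A : ℝ → ℝ} {N ρ : ℝ} (hρ : 0 < ρ)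
    (hA : AEStronglyMeasurable A volume) (hb : ∀ᵐ x, |A x| ≤ N * Real.exp (-ρ * |x|)) :
    Integrable A :=
  ((integrable_exp_neg_mul_abs hρ).const_mul N).mono' hA hb

/-- The function `-κ² g(x) φ(|x|)`. For even `g` and a solution of `φ'' + κ² g φ = 0` on the half
line it is the even extension of `φ''`. -/
noncomputable def evenPotential (g : ℝ → ℝ) (κ : ℝ) (φ : ℝ → ℝ) (x : ℝ) : ℝ :=
  -(κ ^ 2 * g x * φ |x|)

namespace IsMode

variable {g φ φ₁ φ₂ : ℝ → ℝ} {κ ρ N N₁ : ℝ}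

theorem measurable_sign_mul (h : IsMode g κ ρ N N₁ φ φ₁ φ₂) :
    Measurable fun x => Real.sign x * φ₁ |x| :=
  measurable_realSign.mul h.prim₁.continuous_comp_abs.measurable

theorem abs_sign_mul_le (h : IsMode g κ ρ N N₁ φ φ₁ φ₂) (x : ℝ) :
    |Real.sign x * φ₁ (|x|)| ≤ N₁ * Real.exp (-ρ * |x|) := by
  rw [abs_mul]
  exact (mul_le_of_le_one_left (abs_nonneg _) (abs_realSign_le x)).trans (h.bound₁ _ (abs_nonneg x))

theorem abs_evenPotential_le (h : IsMode g κ ρ N N₁ φ φ₁ φ₂) {G : ℝ} (hG : ∀ᵐ x, |g x| ≤ G) :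
    ∀ᵐ x, |evenPotential g κ φ x| ≤ κ ^ 2 * G * N * Real.exp (-ρ * |x|) := by
  filter_upwards [hG] with x hx
  rw [evenPotential, abs_neg, abs_mul, abs_mul, abs_of_nonneg (sq_nonneg κ), mul_assoc, mul_assoc,
    mul_assoc]
  have := h.bound _ (abs_nonneg x)
  have hG0 : 0 ≤ G := (abs_nonneg _).trans hx
  gcongr

theorem aestronglyMeasurable_evenPotential (h : IsMode g κ ρ N N₁ φ φ₁ φ₂)
    (hg : AEStronglyMeasurable g volume) : AEStronglyMeasurable (evenPotential g κ φ) volume :=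
  ((hg.const_mul (κ ^ 2)).mul h.prim.continuous_comp_abs.aestronglyMeasurable).neg

/-- The weak derivative of `φ(|x|)` is `sign(x) φ₁(|x|)`, without a singular part at `0`. -/
theorem integral_mul_deriv_add_sign (h : IsMode g κ ρ N N₁ φ φ₁ φ₂) (hρ : 0 < ρ) {η : ℝ → ℝ}
    (hη : ContDiff ℝ 1 η) {R : ℝ} (hR : ∀ x, R < |x| → η x = 0) :
    ∫ x, (φ |x| * deriv η x + Real.sign x * φ₁ |x| * η x) = 0 := by
  have hηd : Differentiable ℝ η := hη.differentiable one_ne_zero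
  obtain ⟨B, hB⟩ := exists_bound_of_compactSupport hη.continuous hR
  obtain ⟨B', hB'⟩ := exists_bound_of_compactSupport (hη.continuous_deriv le_rfl)
    fun x => deriv_eq_zero_of_lt_abs hR
  have hi1 : Integrable fun x => φ |x| * deriv η x :=
    (integrable_of_exp_bound hρ h.prim.continuous_comp_abs.aestronglyMeasurable
      (Eventually.of_forall fun x => h.bound _ (abs_nonneg x))).mul_bdd
      (hη.continuous_deriv le_rfl).aestronglyMeasurable (Eventually.of_forall hB')
  have hi2 : Integrable fun x => Real.sign x * φ₁ |x| * η x :=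
    (integrable_of_exp_bound hρ h.measurable_sign_mul.aestronglyMeasurable
      (Eventually.of_forall h.abs_sign_mul_le)).mul_bdd
      hη.continuous.aestronglyMeasurable (Eventually.of_forall hB)
  refine (integral_eq_integral_Ioi_add_neg (hi1.add hi2)).trans ?_
  simp only [Pi.add_apply]
  have hζ : ContDiff ℝ 1 fun x => η x - η (-x) := hη.sub (hη.comp contDiff_neg)
  have h1 := h.prim.integral_mul_deriv_add hζ (R := R) fun x hx => by
    rw [hR x hx, hR (-x) (by rwa [abs_neg]), sub_zero]
  rw [neg_zero, sub_self, mul_zero, neg_zero] at h1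
  refine Eq.trans ?_ h1
  refine setIntegral_congr_fun measurableSet_Ioi fun x hx => ?_
  have hd : deriv (fun x => η x - η (-x)) x = deriv η x + deriv η (-x) := by
    rw [deriv_fun_sub (hηd x) (by fun_prop), deriv_comp_neg]; ring
  simp only [hd, abs_neg, abs_of_pos (mem_Ioi.1 hx), Real.sign_neg, Real.sign_of_pos hx]
  ring

/-- The jump of `sign(x) φ₁(|x|)` at `0` contributes `2 φ₁(0) δ₀` to its weak derivative. -/
theorem integral_sign_mul_deriv_add (h : IsMode g κ ρ N N₁ φ φ₁ φ₂) (hρ : 0 < ρ)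
    (hg : MemLp g ∞ volume) (hev : ∀ᵐ x, g (-x) = g x) {η : ℝ → ℝ}
    (hη : ContDiff ℝ 1 η) {R : ℝ} (hR : ∀ x, R < |x| → η x = 0) :
    ∫ x, (Real.sign x * φ₁ |x| * deriv η x + evenPotential g κ φ x * η x) = -(2 * φ₁ 0 * η 0) := by
  have hηd : Differentiable ℝ η := hη.differentiable one_ne_zero
  obtain ⟨G, -, hG⟩ := ae_abs_le_of_memLp_top hg
  obtain ⟨B, hB⟩ := exists_bound_of_compactSupport hη.continuous hR
  obtain ⟨B', hB'⟩ := exists_bound_of_compactSupport (hη.continuous_deriv le_rfl)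
    fun x => deriv_eq_zero_of_lt_abs hR
  have hi1 : Integrable fun x => Real.sign x * φ₁ |x| * deriv η x :=
    (integrable_of_exp_bound hρ h.measurable_sign_mul.aestronglyMeasurable
      (Eventually.of_forall h.abs_sign_mul_le)).mul_bdd
      (hη.continuous_deriv le_rfl).aestronglyMeasurable (Eventually.of_forall hB')
  have hi2 : Integrable fun x => evenPotential g κ φ x * η x :=
    (integrable_of_exp_bound hρ (h.aestronglyMeasurable_evenPotential hg.1)
      (h.abs_evenPotential_le hG)).mul_bdd
      hη.continuous.aestronglyMeasurable (Eventually.of_forall hB)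
  refine (integral_eq_integral_Ioi_add_neg (hi1.add hi2)).trans ?_
  simp only [Pi.add_apply]
  have hζ : ContDiff ℝ 1 fun x => η x + η (-x) := hη.add (hη.comp contDiff_neg)
  have h1 := h.prim₁.integral_mul_deriv_add hζ (R := R) fun x hx => by
    rw [hR x hx, hR (-x) (by rwa [abs_neg]), add_zero]
  rw [neg_zero] at h1
  rw [show 2 * φ₁ 0 * η 0 = φ₁ 0 * (η 0 + η 0) by ring, ← h1]
  refine setIntegral_congr_ae measurableSet_Ioi ?_
  filter_upwards [h.eq, hev] with x heq hevx hx
  have hd : deriv (fun x => η x + η (-x)) x = deriv η x - deriv η (-x) := by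
    rw [deriv_fun_add (hηd x) (by fun_prop), deriv_comp_neg]; ring
  simp only [hd, abs_neg, abs_of_pos (mem_Ioi.1 hx), Real.sign_neg, Real.sign_of_pos hx, heq hx,
    evenPotential, hevx]
  ring

end IsMode

/-! ### Modes in time -/

/-- Integration by parts over a period. -/
theorem integral_periodic_mul_deriv {T : ℝ} (hT : 0 < T) {f f' η η' : ℝ → ℝ}
    (hf : ∀ t, HasDerivAt f (f' t) t) (hη : ∀ t, HasDerivAt η (η' t) t) (hf' : Continuous f')
    (hη' : Continuous η') (hfp : f T = f 0) (hηp : η T = η 0) :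
    ∫ t in Ioc 0 T, f t * η' t = -∫ t in Ioc 0 T, f' t * η t := by
  rw [← intervalIntegral.integral_of_le hT.le, ← intervalIntegral.integral_of_le hT.le,
    intervalIntegral.integral_mul_deriv_eq_deriv_mul (fun t _ => hf t) (fun t _ => hη t)
    (hf'.intervalIntegrable _ _) (hη'.intervalIntegrable _ _), hfp, hηp]
  ring

section Trig

variable {ω : ℝ}

theorem hasDerivAt_cos_mul (ω : ℝ) (n : ℕ) (t : ℝ) :
    HasDerivAt (fun t => Real.cos (ω * n * t)) (-(ω * n) * Real.sin (ω * n * t)) t := by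
  have h := (hasDerivAt_mul_const (x := t) (ω * n))
  simp only [mul_comm _ (ω * n)] at h
  exact h.cos.congr_deriv (by ring)

theorem hasDerivAt_sin_mul (ω : ℝ) (n : ℕ) (t : ℝ) :
    HasDerivAt (fun t => Real.sin (ω * n * t)) (ω * n * Real.cos (ω * n * t)) t := by
  have h := (hasDerivAt_mul_const (x := t) (ω * n))
  simp only [mul_comm _ (ω * n)] at h
  exact h.sin.congr_deriv (by ring)

theorem sin_period (hω : 0 < ω) (n : ℤ) : Real.sin (ω * n * (2 * Real.pi / ω)) = 0 := by
  rw [show ω * n * (2 * Real.pi / ω) = ((2 * n : ℤ) : ℝ) * Real.pi by push_cast; field_simp]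
  exact Real.sin_int_mul_pi _

theorem cos_period (hω : 0 < ω) (n : ℕ) : Real.cos (ω * n * (2 * Real.pi / ω)) = 1 := by
  rw [show ω * n * (2 * Real.pi / ω) = n * (2 * Real.pi) by field_simp]
  exact Real.cos_nat_mul_two_pi n

theorem integral_cos_period (hω : 0 < ω) {n : ℤ} (hn : n ≠ 0) :
    ∫ t in (0 : ℝ)..(2 * Real.pi / ω), Real.cos (ω * n * t) = 0 := by
  have h0 : ω * n ≠ 0 := mul_ne_zero hω.ne' (by exact_mod_cast hn)
  rw [intervalIntegral.integral_comp_mul_left (fun t => Real.cos t) h0, integral_cos,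
    sin_period hω, mul_zero, Real.sin_zero, sub_zero, smul_zero]

theorem integral_cos_mul_cos (hω : 0 < ω) {n m : ℕ} (hnm : n ≠ m) :
    ∫ t in Ioc 0 (2 * Real.pi / ω), Real.cos (ω * n * t) * Real.cos (ω * m * t) = 0 := by
  have h1 := integral_cos_period hω (n := n - m) (by omega)
  have h2 := integral_cos_period hω (n := n + m) (by omega)
  rw [← intervalIntegral.integral_of_le (by positivity)]
  calc _ = ∫ t in (0 : ℝ)..(2 * Real.pi / ω), (1 / 2 * Real.cos (ω * ((n - m : ℤ) : ℝ) * t) +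
        1 / 2 * Real.cos (ω * ((n + m : ℤ) : ℝ) * t)) := by
        refine intervalIntegral.integral_congr fun t _ => ?_
        rw [show ω * ((n - m : ℤ) : ℝ) * t = ω * n * t - ω * m * t by push_cast; ring,
          show ω * ((n + m : ℤ) : ℝ) * t = ω * n * t + ω * m * t by push_cast; ring,
          Real.cos_sub, Real.cos_add]
        ring
    _ = 0 := by
        rw [intervalIntegral.integral_add (Continuous.intervalIntegrable (by fun_prop) _ _)
          (Continuous.intervalIntegrable (by fun_prop) _ _), intervalIntegral.integral_const_mul,
          intervalIntegral.integral_const_mul, h1, h2]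
        ring

theorem integral_sin_mul_sin (hω : 0 < ω) {n m : ℕ} (hnm : n ≠ m) :
    ∫ t in Ioc 0 (2 * Real.pi / ω), Real.sin (ω * n * t) * Real.sin (ω * m * t) = 0 := by
  have h1 := integral_cos_period hω (n := n - m) (by omega)
  have h2 := integral_cos_period hω (n := n + m) (by omega)
  rw [← intervalIntegral.integral_of_le (by positivity)]
  calc _ = ∫ t in (0 : ℝ)..(2 * Real.pi / ω), (1 / 2 * Real.cos (ω * ((n - m : ℤ) : ℝ) * t) -
        1 / 2 * Real.cos (ω * ((n + m : ℤ) : ℝ) * t)) := by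
        refine intervalIntegral.integral_congr fun t _ => ?_
        rw [show ω * ((n - m : ℤ) : ℝ) * t = ω * n * t - ω * m * t by push_cast; ring,
          show ω * ((n + m : ℤ) : ℝ) * t = ω * n * t + ω * m * t by push_cast; ring,
          Real.cos_sub, Real.cos_add]
        ring
    _ = 0 := by
        rw [intervalIntegral.integral_sub (Continuous.intervalIntegrable (by fun_prop) _ _)
          (Continuous.intervalIntegrable (by fun_prop) _ _), intervalIntegral.integral_const_mul,
          intervalIntegral.integral_const_mul, h1, h2]
        ring

/-- `∫ cos(ωnt) η' = ωn ∫ sin(ωnt) η` over a period. -/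
theorem integral_cos_mul_deriv (hω : 0 < ω) (n : ℕ) {η η' : ℝ → ℝ}
    (hη : ∀ t, HasDerivAt η (η' t) t) (hη' : Continuous η')
    (hηp : ∀ t, η (t + 2 * Real.pi / ω) = η t) :
    ∫ t in Ioc 0 (2 * Real.pi / ω), Real.cos (ω * n * t) * η' t =
      ω * n * ∫ t in Ioc 0 (2 * Real.pi / ω), Real.sin (ω * n * t) * η t := by
  rw [integral_periodic_mul_deriv (by positivity) (hasDerivAt_cos_mul ω n) hη (by fun_prop) hη'
    (by rw [cos_period hω]; simp) (by simpa using hηp 0), ← integral_neg, ← integral_const_mul]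
  congr 1
  funext t
  ring

/-- `∫ sin(ωnt) η' = -ωn ∫ cos(ωnt) η` over a period. -/
theorem integral_sin_mul_deriv (hω : 0 < ω) (n : ℕ) {η η' : ℝ → ℝ}
    (hη : ∀ t, HasDerivAt η (η' t) t) (hη' : Continuous η')
    (hηp : ∀ t, η (t + 2 * Real.pi / ω) = η t) :
    ∫ t in Ioc 0 (2 * Real.pi / ω), Real.sin (ω * n * t) * η' t =
      -(ω * n * ∫ t in Ioc 0 (2 * Real.pi / ω), Real.cos (ω * n * t) * η t) := by
  rw [integral_periodic_mul_deriv (by positivity) (hasDerivAt_sin_mul ω n) hη (by fun_prop) hη'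
    (by rw [show (n : ℝ) = ((n : ℤ) : ℝ) by simp, sin_period hω]; simp) (by simpa using hηp 0),
    ← integral_const_mul]
  congr 2
  funext t
  ring

end Trig

/-! ### Test functions on the cylinder -/

namespace IsTestFunction

variable {T : ℝ} {ψ : ℝ × ℝ → ℝ}

theorem contDiff_left (h : IsTestFunction T ψ) (t : ℝ) : ContDiff ℝ 1 fun x => ψ (x, t) :=
  (h.smooth.of_le (by exact_mod_cast le_top)).comp (contDiff_prodMk_left t)

theorem contDiff_right (h : IsTestFunction T ψ) (x : ℝ) : ContDiff ℝ 1 fun t => ψ (x, t) :=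
  (h.smooth.of_le (by exact_mod_cast le_top)).comp (contDiff_prodMk_right x)

theorem continuous_partialX (h : IsTestFunction T ψ) : Continuous (partialX ψ) := by
  have hd : Differentiable ℝ ψ := h.smooth.differentiable (by simp)
  have h1 : partialX ψ = fun p => fderiv ℝ ψ p (1, 0) := by
    funext p
    have h2 : HasDerivAt (fun x : ℝ => (x, p.2)) ((1 : ℝ), (0 : ℝ)) p.1 :=
      (hasDerivAt_id p.1).prodMk (hasDerivAt_const p.1 p.2)
    exact ((hd p).hasFDerivAt.comp_hasDerivAt p.1 h2).deriv
  rw [h1]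
  exact (h.smooth.continuous_fderiv (by simp)).clm_apply continuous_const

theorem continuous_partialT (h : IsTestFunction T ψ) : Continuous (partialT ψ) := by
  have hd : Differentiable ℝ ψ := h.smooth.differentiable (by simp)
  have h1 : partialT ψ = fun p => fderiv ℝ ψ p (0, 1) := by
    funext p
    have h2 : HasDerivAt (fun t : ℝ => (p.1, t)) ((0 : ℝ), (1 : ℝ)) p.2 :=
      (hasDerivAt_const p.2 p.1).prodMk (hasDerivAt_id p.2)
    exact ((hd p).hasFDerivAt.comp_hasDerivAt p.2 h2).deriv
  rw [h1]
  exact (h.smooth.continuous_fderiv (by simp)).clm_apply continuous_const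

theorem hasDerivAt_partialT (h : IsTestFunction T ψ) (x t : ℝ) :
    HasDerivAt (fun t => ψ (x, t)) (partialT ψ (x, t)) t :=
  ((h.contDiff_right x).differentiable one_ne_zero t).hasDerivAt

theorem partialT_periodic (h : IsTestFunction T ψ) (x t : ℝ) :
    partialT ψ (x, t + T) = partialT ψ (x, t) := by
  have h1 : HasDerivAt (fun t => ψ (x, t + T)) (partialT ψ (x, t + T)) t :=
    (h.hasDerivAt_partialT x (t + T)).comp_add_const t T
  simp only [h.periodic] at h1
  exact h1.unique (h.hasDerivAt_partialT x t)

theorem exists_radius (h : IsTestFunction T ψ) :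
    ∃ R : ℝ, ∀ p : ℝ × ℝ, R < |p.1| → ψ p = 0 ∧ partialX ψ p = 0 ∧ partialT ψ p = 0 := by
  obtain ⟨R, hR⟩ := h.compactSupport
  refine ⟨R, fun p hp => ⟨hR p.1 p.2 hp, ?_, ?_⟩⟩
  · exact deriv_eq_zero_of_lt_abs (η := fun x => ψ (x, p.2)) (fun x hx => hR x p.2 hx) hp
  · have : (fun t => ψ (p.1, t)) = fun _ => 0 := by
      funext t; exact hR _ _ hp
    rw [partialT, this, deriv_const]

end IsTestFunction

/-! ### Orthogonal series on the cylinder -/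

theorem cylMeasure_eq_prod (T : ℝ) :
    cylMeasure T = (volume : Measure ℝ).prod (volume.restrict (Ioc 0 T)) := by
  rw [cylMeasure, Measure.volume_eq_prod, ← Measure.prod_restrict, Measure.restrict_univ]

theorem memLp_exp_cyl (T : ℝ) {ρ : ℝ} (hρ : 0 < ρ) :
    MemLp (fun p : ℝ × ℝ => Real.exp (-ρ * |p.1|)) 2 (cylMeasure T) := by
  rw [cylMeasure_eq_prod]
  exact (memLp_exp_neg_mul_abs hρ).comp_fst _

theorem memLp_cyl_of_exp_bound {T N ρ : ℝ} (hρ : 0 < ρ) {F : ℝ × ℝ → ℝ}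
    (hF : AEStronglyMeasurable F (cylMeasure T))
    (hb : ∀ᵐ p ∂cylMeasure T, |F p| ≤ N * Real.exp (-ρ * |p.1|)) : MemLp F 2 (cylMeasure T) := by
  refine ((memLp_exp_cyl T hρ).const_mul N).of_le hF ?_
  filter_upwards [hb] with p hp
  exact hp.trans (le_abs_self _)

theorem ae_cyl_fst {T : ℝ} {P : ℝ → Prop} (h : ∀ᵐ x, P x) : ∀ᵐ p ∂cylMeasure T, P p.1 := by
  rw [cylMeasure_eq_prod]
  exact Measure.quasiMeasurePreserving_fst.ae h

theorem aestronglyMeasurable_cyl_fst {T : ℝ} {A : ℝ → ℝ} (h : AEStronglyMeasurable A volume) :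
    AEStronglyMeasurable (fun p : ℝ × ℝ => A p.1) (cylMeasure T) := by
  rw [cylMeasure_eq_prod]
  exact h.comp_quasiMeasurePreserving Measure.quasiMeasurePreserving_fst

theorem memLp_cyl_mul {T N ρ : ℝ} (hρ : 0 < ρ) {A S : ℝ → ℝ} (hA : AEStronglyMeasurable A volume)
    (hb : ∀ᵐ x, |A x| ≤ N * Real.exp (-ρ * |x|)) (hS : Continuous S) (hS1 : ∀ t, |S t| ≤ 1) :
    MemLp (fun p : ℝ × ℝ => A p.1 * S p.2) 2 (cylMeasure T) := by
  refine memLp_cyl_of_exp_bound (N := N) hρ ((aestronglyMeasurable_cyl_fst hA).mul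
    (hS.comp continuous_snd).aestronglyMeasurable) ?_
  filter_upwards [ae_cyl_fst hb] with p hp
  rw [abs_mul]
  exact (mul_le_of_le_one_right (abs_nonneg _) (hS1 p.2)).trans hp

theorem exists_bound_cyl {T R : ℝ} {F : ℝ × ℝ → ℝ} (hF : Continuous F)
    (hR : ∀ p : ℝ × ℝ, R < |p.1| → F p = 0) :
    ∃ B, 0 ≤ B ∧ ∀ᵐ p ∂cylMeasure T, |F p| ≤ B * Real.exp (-1 * |p.1|) := by
  obtain ⟨B, hB⟩ := ((isCompact_Icc (a := -R) (b := R)).prod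
    (isCompact_Icc (a := 0) (b := T))).exists_bound_of_continuousOn hF.continuousOn
  refine ⟨max B 0 * Real.exp R, by positivity, ?_⟩
  rw [cylMeasure, ae_restrict_iff' (MeasurableSet.univ.prod measurableSet_Ioc)]
  refine Eventually.of_forall fun p hp => ?_
  rcases le_or_gt |p.1| R with h | h
  · have h1 := hB p ⟨abs_le.1 h, ⟨hp.2.1.le, hp.2.2⟩⟩
    rw [mul_assoc, ← Real.exp_add]
    refine h1.trans ((le_max_left B 0).trans ?_)
    exact le_mul_of_one_le_right (le_max_right _ _) (Real.one_le_exp (by linarith))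
  · rw [hR p h, abs_zero]; positivity

theorem memLp_cyl_of_continuous {T R : ℝ} {F : ℝ × ℝ → ℝ} (hF : Continuous F)
    (hR : ∀ p : ℝ × ℝ, R < |p.1| → F p = 0) : MemLp F 2 (cylMeasure T) := by
  obtain ⟨B, -, hB⟩ := exists_bound_cyl (T := T) hF hR
  exact memLp_cyl_of_exp_bound one_pos hF.aestronglyMeasurable hB

theorem integrable_cyl_mul {T : ℝ} {F q : ℝ × ℝ → ℝ} (hF : MemLp F 2 (cylMeasure T))
    (hq : MemLp q 2 (cylMeasure T)) : Integrable (fun p => F p * q p) (cylMeasure T) :=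
  hF.integrable_mul hq

theorem summable_of_orthogonal {E : Type*} [NormedAddCommGroup E] [InnerProductSpace ℝ E]
    [CompleteSpace E] {ι : Type*} {f : ι → E} (ho : ∀ i j, i ≠ j → inner ℝ (f i) (f j) = 0)
    (hs : Summable fun i => ‖f i‖ ^ 2) : Summable f := by
  have hV : OrthogonalFamily ℝ (fun i => Submodule.span ℝ {f i})
      fun i => (Submodule.span ℝ {f i}).subtypeₗᵢ := by
    intro i j hij v w
    obtain ⟨a, ha⟩ := Submodule.mem_span_singleton.1 v.2
    obtain ⟨b, hb⟩ := Submodule.mem_span_singleton.1 w.2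
    change inner ℝ (v : E) (w : E) = 0
    rw [← ha, ← hb, inner_smul_left, inner_smul_right, ho i j hij, mul_zero, mul_zero]
  exact (hV.summable_iff_norm_sq_summable
    fun i => ⟨f i, Submodule.mem_span_singleton_self (f i)⟩).2 hs

/-- A series `∑ A_n(x) S_n(t)` whose time factors are orthogonal over a period and whose
space factors are `O(c_n e^{-ρ|x|})` with `c ∈ ℓ²` converges in `L²` of the cylinder. -/
theorem exists_cyl_series {T ρ : ℝ} (hρ : 0 < ρ) {A S : ℕ → ℝ → ℝ} {c : ℕ → ℝ}
    (hA : ∀ n, Measurable (A n)) (hAb : ∀ n x, |A n x| ≤ c n * Real.exp (-ρ * |x|))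
    (hc : Summable fun n => c n ^ 2) (hS : ∀ n, Continuous (S n)) (hS1 : ∀ n t, |S n t| ≤ 1)
    (hSo : ∀ n m, n ≠ m → ∫ t in Ioc 0 T, S n t * S m t = 0) :
    ∃ F : ℝ × ℝ → ℝ, MemLp F 2 (cylMeasure T) ∧ ∀ q : ℝ × ℝ → ℝ, MemLp q 2 (cylMeasure T) →
      HasSum (fun n => ∫ p, A n p.1 * S n p.2 * q p ∂cylMeasure T)
        (∫ p, F p * q p ∂cylMeasure T) := by
  have hmem : ∀ n, MemLp (fun p : ℝ × ℝ => A n p.1 * S n p.2) 2 (cylMeasure T) := fun n =>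
    memLp_cyl_mul hρ (hA n).aestronglyMeasurable (Eventually.of_forall (hAb n)) (hS n) (hS1 n)
  set f : ℕ → Lp ℝ 2 (cylMeasure T) := fun n => (hmem n).toLp with hf
  have hinner : ∀ (n : ℕ) {q : ℝ × ℝ → ℝ} (hq : MemLp q 2 (cylMeasure T)),
      inner ℝ hq.toLp (f n) = ∫ p, A n p.1 * S n p.2 * q p ∂cylMeasure T := by
    intro n q hq
    rw [L2.inner_def]
    refine integral_congr_ae ?_
    filter_upwards [(hmem n).coeFn_toLp, hq.coeFn_toLp] with p h1 h2
    rw [hf, h1, h2]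
    simp
  have ho : ∀ n m, n ≠ m → inner ℝ (f n) (f m) = 0 := by
    intro n m hnm
    rw [hinner m (hmem n), cylMeasure_eq_prod]
    have h1 := integral_prod_mul (μ := (volume : Measure ℝ)) (ν := volume.restrict (Ioc 0 T))
      (fun x => A m x * A n x) (fun t => S m t * S n t)
    rw [hSo m n hnm.symm, mul_zero] at h1
    refine Eq.trans (integral_congr_ae (Eventually.of_forall fun p => ?_)) h1
    simp only
    ring
  have hsum : Summable fun n => ‖f n‖ ^ 2 := by
    refine Summable.of_nonneg_of_le (fun n => sq_nonneg _) (fun n => ?_)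
      (hc.mul_right (‖(memLp_exp_cyl T hρ).toLp‖ ^ 2))
    rw [← mul_pow]
    refine pow_le_pow_left₀ (norm_nonneg _) ?_ 2
    refine Lp.norm_le_mul_norm_of_ae_le_mul ?_
    filter_upwards [(hmem n).coeFn_toLp, (memLp_exp_cyl T hρ).coeFn_toLp] with p h1 h2
    rw [hf, h1, h2, Real.norm_eq_abs, Real.norm_eq_abs, Real.abs_exp, abs_mul]
    exact (mul_le_of_le_one_right (abs_nonneg _) (hS1 n p.2)).trans (hAb n p.1)
  obtain ⟨F, hF⟩ := summable_of_orthogonal ho hsum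
  refine ⟨F, Lp.memLp F, fun q hq => ?_⟩
  have h := (innerSL ℝ hq.toLp).hasSum hF
  simp only [innerSL_apply_apply, hinner] at h
  suffices hFq : inner ℝ hq.toLp F = ∫ p, F p * q p ∂cylMeasure T from hFq ▸ h
  rw [L2.inner_def]
  refine integral_congr_ae ?_
  filter_upwards [hq.coeFn_toLp] with p h2
  rw [h2]
  simp

/-- Termwise integration of a normally convergent series against a square integrable function. -/
theorem hasSum_integral_cyl {T ρ : ℝ} (hρ : 0 < ρ) {F : ℕ → ℝ × ℝ → ℝ} {w : ℝ × ℝ → ℝ} {c : ℕ → ℝ}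
    (hF : ∀ n, Continuous (F n)) (hb : ∀ n p, |F n p| ≤ c n * Real.exp (-ρ * |p.1|))
    (hc : Summable c) (hw : ∀ p, HasSum (fun n => F n p) (w p)) {q : ℝ × ℝ → ℝ}
    (hq : MemLp q 2 (cylMeasure T)) :
    HasSum (fun n => ∫ p, F n p * q p ∂cylMeasure T) (∫ p, w p * q p ∂cylMeasure T) := by
  refine hasSum_integral_of_dominated_convergence
    (fun n p => c n * (Real.exp (-ρ * |p.1|) * |q p|))
    (fun n => (hF n).aestronglyMeasurable.mul hq.1) (fun n => Eventually.of_forall fun p => ?_)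
    (Eventually.of_forall fun p => hc.mul_right _) ?_
    (Eventually.of_forall fun p => (hw p).mul_right _)
  · rw [Real.norm_eq_abs, abs_mul, ← mul_assoc]
    exact mul_le_mul_of_nonneg_right (hb n p) (abs_nonneg _)
  · simp only [tsum_mul_right]
    exact (integrable_cyl_mul (memLp_exp_cyl T hρ) hq.norm).const_mul _

/-! ### Single modes on the cylinder -/

section Mode

variable {g φ φ₁ φ₂ : ℝ → ℝ} {κ ρ N N₁ T : ℝ} {ψ : ℝ × ℝ → ℝ} {S : ℝ → ℝ}

theorem IsTestFunction.memLp (h : IsTestFunction T ψ) : MemLp ψ 2 (cylMeasure T) := by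
  obtain ⟨R, hR⟩ := h.exists_radius
  exact memLp_cyl_of_continuous h.smooth.continuous fun p hp => (hR p hp).1

theorem IsTestFunction.memLp_partialX (h : IsTestFunction T ψ) :
    MemLp (partialX ψ) 2 (cylMeasure T) := by
  obtain ⟨R, hR⟩ := h.exists_radius
  exact memLp_cyl_of_continuous h.continuous_partialX fun p hp => (hR p hp).2.1

theorem IsTestFunction.memLp_partialT (h : IsTestFunction T ψ) :
    MemLp (partialT ψ) 2 (cylMeasure T) := by
  obtain ⟨R, hR⟩ := h.exists_radius
  exact memLp_cyl_of_continuous h.continuous_partialT fun p hp => (hR p hp).2.2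

/-- The indicator function of the right half cylinder. -/
noncomputable def rightHalf (q : ℝ × ℝ → ℝ) : ℝ × ℝ → ℝ := (Ioi 0 ×ˢ univ).indicator q

theorem memLp_rightHalf {q : ℝ × ℝ → ℝ} (hq : MemLp q 2 (cylMeasure T)) :
    MemLp (rightHalf q) 2 (cylMeasure T) :=
  hq.indicator (measurableSet_Ioi.prod MeasurableSet.univ)

theorem IsMode.memLp_mul (h : IsMode g κ ρ N N₁ φ φ₁ φ₂) (hρ : 0 < ρ) (hS : Continuous S)
    (hS1 : ∀ t, |S t| ≤ 1) :
    MemLp (fun p : ℝ × ℝ => φ |p.1| * S p.2) 2 (cylMeasure T) :=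
  memLp_cyl_mul (A := fun x => φ |x|) hρ h.prim.continuous_comp_abs.aestronglyMeasurable
    (Eventually.of_forall fun x => h.bound _ (abs_nonneg x)) hS hS1

theorem IsMode.memLp_sign_mul (h : IsMode g κ ρ N N₁ φ φ₁ φ₂) (hρ : 0 < ρ) (hS : Continuous S)
    (hS1 : ∀ t, |S t| ≤ 1) :
    MemLp (fun p : ℝ × ℝ => Real.sign p.1 * φ₁ |p.1| * S p.2) 2 (cylMeasure T) :=
  memLp_cyl_mul (A := fun x => Real.sign x * φ₁ |x|) hρ h.measurable_sign_mul.aestronglyMeasurable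
    (Eventually.of_forall h.abs_sign_mul_le) hS hS1

theorem IsMode.memLp_evenPotential_mul (h : IsMode g κ ρ N N₁ φ φ₁ φ₂) (hρ : 0 < ρ)
    (hg : MemLp g ∞ volume) (hS : Continuous S) (hS1 : ∀ t, |S t| ≤ 1) :
    MemLp (fun p : ℝ × ℝ => evenPotential g κ φ p.1 * S p.2) 2 (cylMeasure T) := by
  obtain ⟨G, -, hG⟩ := ae_abs_le_of_memLp_top hg
  exact memLp_cyl_mul hρ (h.aestronglyMeasurable_evenPotential hg.1)
    (h.abs_evenPotential_le hG) hS hS1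

/-- Fubini's theorem, integrating over `x` first. -/
theorem integral_cyl_add {F₁ F₂ : ℝ × ℝ → ℝ} (h₁ : Integrable F₁ (cylMeasure T))
    (h₂ : Integrable F₂ (cylMeasure T)) :
    ∫ p, F₁ p ∂cylMeasure T + ∫ p, F₂ p ∂cylMeasure T =
      ∫ t in Ioc 0 T, ∫ x, (F₁ (x, t) + F₂ (x, t)) := by
  rw [← integral_add h₁ h₂]
  have h := h₁.add h₂
  rw [cylMeasure_eq_prod] at h ⊢
  exact integral_prod_symm _ h

theorem IsMode.integral_partialX (h : IsMode g κ ρ N N₁ φ φ₁ φ₂) (hρ : 0 < ρ)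
    (hS : Continuous S) (hS1 : ∀ t, |S t| ≤ 1) (hψ : IsTestFunction T ψ) :
    ∫ p, φ |p.1| * S p.2 * partialX ψ p ∂cylMeasure T +
      ∫ p, Real.sign p.1 * φ₁ |p.1| * S p.2 * ψ p ∂cylMeasure T = 0 := by
  rw [integral_cyl_add (integrable_cyl_mul (h.memLp_mul hρ hS hS1) hψ.memLp_partialX)
    (integrable_cyl_mul (h.memLp_sign_mul hρ hS hS1) hψ.memLp)]
  obtain ⟨R, hR⟩ := hψ.compactSupport
  refine integral_eq_zero_of_ae (Eventually.of_forall fun t => ?_)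
  have h1 := h.integral_mul_deriv_add_sign hρ (hψ.contDiff_left t) fun x hx => hR x t hx
  rw [Pi.zero_apply, ← mul_zero (S t), ← h1, ← integral_const_mul]
  refine integral_congr_ae (Eventually.of_forall fun x => ?_)
  simp only [partialX]
  ring

theorem IsMode.integral_rightHalf (h : IsMode g κ ρ N N₁ φ φ₁ φ₂) (hρ : 0 < ρ)
    (hS : Continuous S) (hS1 : ∀ t, |S t| ≤ 1) (hψ : IsTestFunction T ψ) :
    ∫ p, φ |p.1| * S p.2 * rightHalf (partialX ψ) p ∂cylMeasure T +
      ∫ p, Real.sign p.1 * φ₁ |p.1| * S p.2 * rightHalf ψ p ∂cylMeasure T =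
      -(φ 0 * ∫ t in Ioc 0 T, S t * ψ (0, t)) := by
  rw [integral_cyl_add
    (integrable_cyl_mul (h.memLp_mul hρ hS hS1) (memLp_rightHalf hψ.memLp_partialX))
    (integrable_cyl_mul (h.memLp_sign_mul hρ hS hS1) (memLp_rightHalf hψ.memLp))]
  obtain ⟨R, hR⟩ := hψ.compactSupport
  rw [← integral_const_mul, ← integral_neg]
  congr 1
  funext t
  have h1 := h.prim.integral_mul_deriv_add (hψ.contDiff_left t) fun x hx => hR x t hx
  rw [show -(φ 0 * (S t * ψ (0, t))) = S t * -(φ 0 * ψ (0, t)) by ring, ← h1,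
    ← integral_const_mul, ← integral_indicator measurableSet_Ioi]
  congr 1
  funext x
  by_cases hx : 0 < x
  · have hx' : (x, t) ∈ Ioi (0 : ℝ) ×ˢ (univ : Set ℝ) := ⟨hx, trivial⟩
    rw [indicator_of_mem (mem_Ioi.2 hx)]
    simp only [rightHalf, indicator_of_mem hx', abs_of_pos hx, Real.sign_of_pos hx, partialX]
    ring
  · have hx' : (x, t) ∉ Ioi (0 : ℝ) ×ˢ (univ : Set ℝ) := fun h => hx h.1
    rw [indicator_of_notMem (by simpa using hx)]
    simp only [rightHalf, indicator_of_notMem hx']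
    ring

theorem IsMode.integral_sign_partialX (h : IsMode g κ ρ N N₁ φ φ₁ φ₂) (hρ : 0 < ρ)
    (hg : MemLp g ∞ volume) (hev : ∀ᵐ x, g (-x) = g x)
    (hS : Continuous S) (hS1 : ∀ t, |S t| ≤ 1) (hψ : IsTestFunction T ψ) :
    ∫ p, Real.sign p.1 * φ₁ |p.1| * S p.2 * partialX ψ p ∂cylMeasure T +
      ∫ p, evenPotential g κ φ p.1 * S p.2 * ψ p ∂cylMeasure T =
      -(2 * φ₁ 0 * ∫ t in Ioc 0 T, S t * ψ (0, t)) := by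
  rw [integral_cyl_add (integrable_cyl_mul (h.memLp_sign_mul hρ hS hS1) hψ.memLp_partialX)
    (integrable_cyl_mul (h.memLp_evenPotential_mul hρ hg hS hS1) hψ.memLp)]
  obtain ⟨R, hR⟩ := hψ.compactSupport
  rw [← integral_const_mul, ← integral_neg]
  congr 1
  funext t
  have h1 := h.integral_sign_mul_deriv_add hρ hg hev (hψ.contDiff_left t) fun x hx => hR x t hx
  rw [show -(2 * φ₁ 0 * (S t * ψ (0, t))) = S t * -(2 * φ₁ 0 * ψ (0, t)) by ring, ← h1,
    ← integral_const_mul]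
  congr 1
  funext x
  simp only [partialX]
  ring

theorem integral_cyl_cos_partialT {ω : ℝ} (hω : 0 < ω) (n : ℕ) {A : ℝ → ℝ}
    (hA : MemLp (fun p : ℝ × ℝ => A p.1 * Real.cos (ω * n * p.2)) 2 (cylMeasure (2 * Real.pi / ω)))
    (hA' : MemLp (fun p : ℝ × ℝ => A p.1 * Real.sin (ω * n * p.2)) 2 (cylMeasure (2 * Real.pi / ω)))
    (hψ : IsTestFunction (2 * Real.pi / ω) ψ) :
    ∫ p, A p.1 * Real.cos (ω * n * p.2) * partialT ψ p ∂cylMeasure (2 * Real.pi / ω) =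
      ω * n * ∫ p, A p.1 * Real.sin (ω * n * p.2) * ψ p ∂cylMeasure (2 * Real.pi / ω) := by
  have i1 := integrable_cyl_mul hA hψ.memLp_partialT
  have i2 := integrable_cyl_mul hA' hψ.memLp
  rw [cylMeasure_eq_prod] at i1 i2 ⊢
  rw [integral_prod _ i1, integral_prod _ i2, ← integral_const_mul]
  congr 1
  funext x
  have h := integral_cos_mul_deriv hω n (hψ.hasDerivAt_partialT x)
    (hψ.continuous_partialT.comp (Continuous.prodMk_right x)) (hψ.periodic x)
  simp only [mul_assoc (A x), integral_const_mul]
  rw [h]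
  ring

theorem integral_cyl_sin_partialT {ω : ℝ} (hω : 0 < ω) (n : ℕ) {A : ℝ → ℝ}
    (hA : MemLp (fun p : ℝ × ℝ => A p.1 * Real.sin (ω * n * p.2)) 2 (cylMeasure (2 * Real.pi / ω)))
    (hA' : MemLp (fun p : ℝ × ℝ => A p.1 * Real.cos (ω * n * p.2)) 2 (cylMeasure (2 * Real.pi / ω)))
    (hψ : IsTestFunction (2 * Real.pi / ω) ψ) :
    ∫ p, A p.1 * Real.sin (ω * n * p.2) * partialT ψ p ∂cylMeasure (2 * Real.pi / ω) =
      -(ω * n * ∫ p, A p.1 * Real.cos (ω * n * p.2) * ψ p ∂cylMeasure (2 * Real.pi / ω)) := by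
  have i1 := integrable_cyl_mul hA hψ.memLp_partialT
  have i2 := integrable_cyl_mul hA' hψ.memLp
  rw [cylMeasure_eq_prod] at i1 i2 ⊢
  rw [integral_prod _ i1, integral_prod _ i2, ← integral_const_mul, ← integral_neg]
  congr 1
  funext x
  have h := integral_sin_mul_deriv hω n (hψ.hasDerivAt_partialT x)
    (hψ.continuous_partialT.comp (Continuous.prodMk_right x)) (hψ.periodic x)
  simp only [mul_assoc (A x), integral_const_mul]
  rw [h]
  ring

/-- The weak form of the linear equation for a single mode: only the jump of the `x`-derivative
at `x = 0` is left. -/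
theorem IsMode.integral_weakForm {ω : ℝ} (hω : 0 < ω) (n : ℕ)
    (h : IsMode g (ω * n) ρ N N₁ φ φ₁ φ₂) (hρ : 0 < ρ)
    (hg : MemLp g ∞ volume) (hev : ∀ᵐ x, g (-x) = g x)
    (hψ : IsTestFunction (2 * Real.pi / ω) ψ) :
    ∫ p, -(ω * n) * φ |p.1| * Real.sin (ω * n * p.2) * (-g p.1 * partialT ψ p)
        ∂cylMeasure (2 * Real.pi / ω) +
      ∫ p, Real.sign p.1 * φ₁ |p.1| * Real.cos (ω * n * p.2) * partialX ψ p
        ∂cylMeasure (2 * Real.pi / ω) =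
      -(2 * φ₁ 0 * ∫ t in Ioc 0 (2 * Real.pi / ω), Real.cos (ω * n * t) * ψ (0, t)) := by
  have hcos : Continuous fun t => Real.cos (ω * n * t) := by fun_prop
  have hsin : Continuous fun t => Real.sin (ω * n * t) := by fun_prop
  have h1 := h.integral_sign_partialX hρ hg hev hcos (fun t => Real.abs_cos_le_one _) hψ
  have h2 := integral_cyl_sin_partialT hω n
    (h.memLp_evenPotential_mul hρ hg hsin fun t => Real.abs_sin_le_one _)
    (h.memLp_evenPotential_mul hρ hg hcos fun t => Real.abs_cos_le_one _) hψ
  rw [← h1, add_comm]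
  congr 1
  rcases Nat.eq_zero_or_pos n with rfl | hn
  · simp [evenPotential]
  · have hn' : (0 : ℝ) < n := by exact_mod_cast hn
    have h3 : ∫ p, evenPotential g (ω * n) φ p.1 * Real.cos (ω * n * p.2) * ψ p
        ∂cylMeasure (2 * Real.pi / ω) = -(ω * n)⁻¹ * ∫ p, evenPotential g (ω * n) φ p.1 *
          Real.sin (ω * n * p.2) * partialT ψ p ∂cylMeasure (2 * Real.pi / ω) := by
      rw [h2]
      field_simp
    rw [h3, ← integral_const_mul]
    refine integral_congr_ae (Eventually.of_forall fun p => ?_)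
    simp only [evenPotential]
    field_simp

end Mode

/-! ### The weak solution generated by a sequence -/

/-- A family of decaying modes at the frequencies `ωn`. For odd `n` they are normalised by
`Ψ_n(0) = 1`. -/
structure IsModeFamily (g : ℝ → ℝ) (ω ρ M C : ℝ) (Ψ Ψ₁ Ψ₂ : ℕ → ℝ → ℝ) : Prop where
  mode : ∀ n : ℕ, IsMode g (ω * n) ρ M (C * n) (Ψ n) (Ψ₁ n) (Ψ₂ n)
  one : ∀ n : ℕ, Odd n → Ψ n 0 = 1

/-- The real amplitude `2 T^{-1/2} α_n / n` of the `n`-th cosine mode. It vanishes for even `n`, in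
particular for `n = 0`, where `α_0 = 0`. -/
noncomputable def waveAmp (ω : ℝ) (α : DomJ) (n : ℕ) : ℝ :=
  2 / √(2 * Real.pi / ω) * (α.seq n / n)

/-- The function `w(x,t) = ∑_n 2 T^{-1/2} (α_n / n) Ψ_n(|x|) cos(ωnt)`. This is the real form of the
series over all odd integers, in which the terms with indices `±n` are complex conjugate. -/
noncomputable def wave (ω : ℝ) (Ψ : ℕ → ℝ → ℝ) (α : DomJ) (p : ℝ × ℝ) : ℝ :=
  ∑' n : ℕ, waveAmp ω α n * Ψ n |p.1| * Real.cos (ω * n * p.2)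

/-- The time derivative `-ω T^{-1/2} u(t/T)` of `w(0, ·)`. -/
noncomputable def traceDeriv (ω : ℝ) (α : DomJ) (t : ℝ) : ℝ :=
  -(ω / √(2 * Real.pi / ω)) * α.profile (DomJ.timeMk ω t)

theorem summable_abs_seq_div (α : DomJ) : Summable fun k : ℤ => |α.seq k / k| := by
  have h2 : Summable fun k : ℤ => 1 / (k : ℝ) ^ 2 := Real.summable_one_div_int_pow.2 one_lt_two
  refine Summable.of_nonneg_of_le (fun k => abs_nonneg _) (fun k => ?_)
    (α.isDomJ.sq_summable.add h2)
  rw [div_eq_mul_inv, abs_mul, ← sq_abs (α.seq k), one_div, ← inv_pow, ← sq_abs ((k : ℝ)⁻¹)]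
  nlinarith [sq_nonneg (|α.seq k| - |(k : ℝ)⁻¹|), sq_nonneg |α.seq k|, sq_nonneg |(k : ℝ)⁻¹|]

theorem summable_abs_waveAmp (ω : ℝ) (α : DomJ) : Summable fun n => |waveAmp ω α n| := by
  have h := ((summable_abs_seq_div α).comp_injective Nat.cast_injective).mul_left
    |2 / √(2 * Real.pi / ω)|
  refine h.congr fun n => ?_
  simp [waveAmp, abs_mul]

theorem waveAmp_mul (ω : ℝ) (α : DomJ) (n : ℕ) :
    waveAmp ω α n * n = 2 / √(2 * Real.pi / ω) * α.seq n := by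
  rcases Nat.eq_zero_or_pos n with rfl | hn
  · simp [α.isDomJ.even_zero 0 (by simp)]
  · have : (n : ℝ) ≠ 0 := by exact_mod_cast hn.ne'
    rw [waveAmp]; field_simp

theorem waveAmp_even (ω : ℝ) (α : DomJ) {n : ℕ} (hn : ¬ Odd n) : waveAmp ω α n = 0 := by
  have : Even (n : ℤ) := by exact_mod_cast Nat.not_odd_iff_even.1 hn
  rw [waveAmp, α.isDomJ.even_zero n this]; simp

theorem summable_sq_waveAmp_mul (ω : ℝ) (α : DomJ) (c : ℝ) :
    Summable fun n : ℕ => (|waveAmp ω α n| * (c * n)) ^ 2 := by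
  have h := (α.isDomJ.sq_summable.comp_injective Nat.cast_injective).mul_left
    ((c * (2 / √(2 * Real.pi / ω))) ^ 2)
  refine h.congr fun n => ?_
  have h1 : (|waveAmp ω α n| * (c * n)) ^ 2 = (c * (waveAmp ω α n * n)) ^ 2 := by
    rw [mul_pow, sq_abs]; ring
  rw [h1, waveAmp_mul]
  simp only [Function.comp_apply]
  ring

namespace IsModeFamily

variable {g : ℝ → ℝ} {ω ρ M C : ℝ} {Ψ Ψ₁ Ψ₂ : ℕ → ℝ → ℝ}

theorem waveAmp_mul_apply_zero (h : IsModeFamily g ω ρ M C Ψ Ψ₁ Ψ₂) (α : DomJ) (n : ℕ) :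
    waveAmp ω α n * Ψ n 0 = waveAmp ω α n := by
  by_cases hn : Odd n
  · rw [h.one n hn, mul_one]
  · rw [waveAmp_even ω α hn, zero_mul]

theorem abs_term_le (h : IsModeFamily g ω ρ M C Ψ Ψ₁ Ψ₂) (α : DomJ) (n : ℕ) (p : ℝ × ℝ) :
    |waveAmp ω α n * Ψ n |p.1| * Real.cos (ω * n * p.2)| ≤
      |waveAmp ω α n| * M * Real.exp (-ρ * |p.1|) := by
  rw [abs_mul, abs_mul, mul_assoc |waveAmp ω α n| M]
  refine (mul_le_of_le_one_right (by positivity) (Real.abs_cos_le_one _)).trans ?_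
  exact mul_le_mul_of_nonneg_left ((h.mode n).bound _ (abs_nonneg _)) (abs_nonneg _)

theorem M_nonneg (h : IsModeFamily g ω ρ M C Ψ Ψ₁ Ψ₂) : 0 ≤ M := by
  have := (abs_nonneg _).trans ((h.mode 0).bound 0 le_rfl)
  simpa using this

theorem abs_term_le_const (h : IsModeFamily g ω ρ M C Ψ Ψ₁ Ψ₂) (hρ : 0 < ρ) (α : DomJ)
    (n : ℕ) (p : ℝ × ℝ) :
    |waveAmp ω α n * Ψ n |p.1| * Real.cos (ω * n * p.2)| ≤ |waveAmp ω α n| * M := by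
  refine (h.abs_term_le α n p).trans ?_
  have := h.M_nonneg
  refine mul_le_of_le_one_right (by positivity) (Real.exp_le_one_iff.2 ?_)
  have := abs_nonneg p.1
  nlinarith

theorem continuous_term (h : IsModeFamily g ω ρ M C Ψ Ψ₁ Ψ₂) (α : DomJ) (n : ℕ) :
    Continuous fun p : ℝ × ℝ => waveAmp ω α n * Ψ n |p.1| * Real.cos (ω * n * p.2) := by
  have h1 : Continuous fun p : ℝ × ℝ => Ψ n |p.1| :=
    (h.mode n).prim.continuous_comp_abs.comp continuous_fst
  exact (continuous_const.mul h1).mul (by fun_prop)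

theorem hasSum_wave (h : IsModeFamily g ω ρ M C Ψ Ψ₁ Ψ₂) (hρ : 0 < ρ) (α : DomJ) (p : ℝ × ℝ) :
    HasSum (fun n => waveAmp ω α n * Ψ n |p.1| * Real.cos (ω * n * p.2)) (wave ω Ψ α p) :=
  (Summable.of_norm_bounded ((summable_abs_waveAmp ω α).mul_right M)
    fun n => h.abs_term_le_const hρ α n p).hasSum

theorem continuous_wave (h : IsModeFamily g ω ρ M C Ψ Ψ₁ Ψ₂) (hρ : 0 < ρ) (α : DomJ) :
    Continuous (wave ω Ψ α) :=
  continuous_tsum (h.continuous_term α) ((summable_abs_waveAmp ω α).mul_right M)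
    fun n p => h.abs_term_le_const hρ α n p

theorem memLp_wave (h : IsModeFamily g ω ρ M C Ψ Ψ₁ Ψ₂) (hρ : 0 < ρ) (α : DomJ) (T : ℝ) :
    MemLp (wave ω Ψ α) 2 (cylMeasure T) := by
  refine memLp_cyl_of_exp_bound (N := ∑' n, |waveAmp ω α n| * M) hρ
    (h.continuous_wave hρ α).aestronglyMeasurable (Eventually.of_forall fun p => ?_)
  have h1 := tsum_of_norm_bounded
    (f := fun n : ℕ => waveAmp ω α n * Ψ n |p.1| * Real.cos (ω * n * p.2))
    (((summable_abs_waveAmp ω α).mul_right M).mul_right (Real.exp (-ρ * |p.1|))).hasSum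
    fun n => h.abs_term_le α n p
  rw [tsum_mul_right] at h1
  exact h1

theorem wave_periodic (hω : 0 < ω) (α : DomJ) (x t : ℝ) :
    wave ω Ψ α (x, t + 2 * Real.pi / ω) = wave ω Ψ α (x, t) := by
  refine tsum_congr fun n => ?_
  rw [show ω * n * (t + 2 * Real.pi / ω) = ω * n * t + n * (2 * Real.pi) by field_simp,
    Real.cos_add_nat_mul_two_pi]

theorem hasSum_integral_wave (h : IsModeFamily g ω ρ M C Ψ Ψ₁ Ψ₂) (hρ : 0 < ρ) (α : DomJ) {T : ℝ}
    {q : ℝ × ℝ → ℝ} (hq : MemLp q 2 (cylMeasure T)) :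
    HasSum (fun n : ℕ =>
        waveAmp ω α n * ∫ p, Ψ n |p.1| * Real.cos (ω * n * p.2) * q p ∂cylMeasure T)
      (∫ p, wave ω Ψ α p * q p ∂cylMeasure T) := by
  refine (hasSum_integral_cyl hρ (h.continuous_term α) (h.abs_term_le α)
    ((summable_abs_waveAmp ω α).mul_right M) (h.hasSum_wave hρ α) hq).congr_fun fun n => ?_
  rw [← integral_const_mul]
  congr 1
  funext p
  ring

/-- Existence of the weak time derivative as an `L²` sum. -/
theorem exists_wave_t (h : IsModeFamily g ω ρ M C Ψ Ψ₁ Ψ₂) (hω : 0 < ω) (hρ : 0 < ρ) (α : DomJ) :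
    ∃ wt : ℝ × ℝ → ℝ, MemLp wt 2 (cylMeasure (2 * Real.pi / ω)) ∧
      ∀ q : ℝ × ℝ → ℝ, MemLp q 2 (cylMeasure (2 * Real.pi / ω)) →
      HasSum (fun n : ℕ => waveAmp ω α n * ∫ p, -(ω * n) * Ψ n |p.1| * Real.sin (ω * n * p.2) * q p
        ∂cylMeasure (2 * Real.pi / ω)) (∫ p, wt p * q p ∂cylMeasure (2 * Real.pi / ω)) := by
  obtain ⟨wt, hm, hs⟩ := exists_cyl_series (T := 2 * Real.pi / ω) hρ
    (A := fun n x => waveAmp ω α n * (-(ω * n) * Ψ n |x|)) (S := fun n t => Real.sin (ω * n * t))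
    (c := fun n => |waveAmp ω α n| * (ω * M * n))
    (fun n => ((h.mode n).prim.continuous_comp_abs.measurable.const_mul _).const_mul _)
    (fun n x => by
      rw [abs_mul, mul_assoc]
      refine mul_le_mul_of_nonneg_left ?_ (abs_nonneg _)
      rw [abs_mul, abs_neg, abs_of_nonneg (by positivity),
        show ω * M * n * Real.exp (-ρ * |x|) = ω * n * (M * Real.exp (-ρ * |x|)) by ring]
      exact mul_le_mul_of_nonneg_left ((h.mode n).bound _ (abs_nonneg _)) (by positivity))
    (summable_sq_waveAmp_mul ω α _) (fun n => by fun_prop) (fun n t => Real.abs_sin_le_one _)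
    (fun n m hnm => integral_sin_mul_sin hω hnm)
  refine ⟨wt, hm, fun q hq => (hs q hq).congr_fun fun n => ?_⟩
  rw [← integral_const_mul]
  congr 1
  funext p
  ring

/-- Existence of the weak space derivative as an `L²` sum. -/
theorem exists_wave_x (h : IsModeFamily g ω ρ M C Ψ Ψ₁ Ψ₂) (hω : 0 < ω) (hρ : 0 < ρ) (α : DomJ) :
    ∃ wx : ℝ × ℝ → ℝ, MemLp wx 2 (cylMeasure (2 * Real.pi / ω)) ∧
      ∀ q : ℝ × ℝ → ℝ, MemLp q 2 (cylMeasure (2 * Real.pi / ω)) →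
      HasSum (fun n : ℕ => waveAmp ω α n *
        ∫ p, Real.sign p.1 * Ψ₁ n |p.1| * Real.cos (ω * n * p.2) * q p
        ∂cylMeasure (2 * Real.pi / ω)) (∫ p, wx p * q p ∂cylMeasure (2 * Real.pi / ω)) := by
  obtain ⟨wx, hm, hs⟩ := exists_cyl_series (T := 2 * Real.pi / ω) hρ
    (A := fun n x => waveAmp ω α n * (Real.sign x * Ψ₁ n |x|))
    (S := fun n t => Real.cos (ω * n * t))
    (c := fun n => |waveAmp ω α n| * (C * n))
    (fun n => (h.mode n).measurable_sign_mul.const_mul _)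
    (fun n x => by
      rw [abs_mul, mul_assoc]
      exact mul_le_mul_of_nonneg_left ((h.mode n).abs_sign_mul_le x) (abs_nonneg _))
    (summable_sq_waveAmp_mul ω α _) (fun n => by fun_prop) (fun n t => Real.abs_cos_le_one _)
    (fun n m hnm => integral_cos_mul_cos hω hnm)
  refine ⟨wx, hm, fun q hq => (hs q hq).congr_fun fun n => ?_⟩
  rw [← integral_const_mul]
  congr 1
  funext p
  ring

/-- Termwise integration of the trace at `x = 0`. -/
theorem hasSum_integral_trace (h : IsModeFamily g ω ρ M C Ψ Ψ₁ Ψ₂) (hρ : 0 < ρ) (α : DomJ)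
    {r : ℝ → ℝ} (hr : Continuous r) (T : ℝ) :
    HasSum (fun n : ℕ => waveAmp ω α n * ∫ t in Ioc 0 T, Real.cos (ω * n * t) * r t)
      (∫ t in Ioc 0 T, wave ω Ψ α (0, t) * r t) := by
  have hri : Integrable r (volume.restrict (Ioc 0 T)) :=
    (hr.integrableOn_Icc (a := 0) (b := T)).mono_set Ioc_subset_Icc_self
  have hs := hasSum_integral_of_dominated_convergence (μ := volume.restrict (Ioc 0 T))
    (F := fun n t => waveAmp ω α n * Ψ n |0| * Real.cos (ω * n * t) * r t)
    (f := fun t => wave ω Ψ α (0, t) * r t)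
    (fun n t => |waveAmp ω α n| * M * |r t|)
    (fun n => Continuous.aestronglyMeasurable (by fun_prop))
    (fun n => Eventually.of_forall fun t => by
      rw [Real.norm_eq_abs, abs_mul]
      exact mul_le_mul_of_nonneg_right (h.abs_term_le_const hρ α n (0, t)) (abs_nonneg _))
    (Eventually.of_forall fun t => ((summable_abs_waveAmp ω α).mul_right M).mul_right _)
    (by simp only [tsum_mul_right]; exact hri.abs.const_mul _)
    (Eventually.of_forall fun t => (h.hasSum_wave hρ α (0, t)).mul_right _)
  refine hs.congr_fun fun n => ?_
  rw [abs_zero, h.waveAmp_mul_apply_zero, ← integral_const_mul]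
  congr 1
  funext t
  ring

theorem hasSum_integral_traceDeriv (hω : 0 < ω) (α : DomJ) {r : ℝ → ℝ} (hr : Continuous r)
    (hper : ∀ t, r (t + 2 * Real.pi / ω) = r t) :
    HasSum (fun n : ℕ => -(waveAmp ω α n *
        (ω * n * ∫ t in Ioc 0 (2 * Real.pi / ω), Real.sin (ω * n * t) * r t)))
      (∫ t in Ioc 0 (2 * Real.pi / ω), traceDeriv ω α t * r t) := by
  have hu2 : MemLp α.profile 2 AddCircle.haarAddCircle :=
    (Lp.memLp α.profile).mono_exponent (by norm_num)
  have hs := (DomJ.hasSum_integral_timeMk_mul hω α.hasSineCoeffs_profile hu2 α.isDomJ.odd_symm hr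
    hper).mul_left (-(ω / √(2 * Real.pi / ω)))
  rw [← integral_const_mul] at hs
  simp only [traceDeriv, mul_assoc] at hs ⊢
  refine hs.congr_fun fun n => ?_
  have h1 := waveAmp_mul ω α n
  simp only [mul_comm (r _)]
  rw [← mul_assoc ω, ← mul_assoc (waveAmp ω α n), mul_comm ω, ← mul_assoc (waveAmp ω α n), h1]
  ring

theorem isWeakDerivTorus (h : IsModeFamily g ω ρ M C Ψ Ψ₁ Ψ₂) (hω : 0 < ω) (hρ : 0 < ρ) (α : DomJ) :
    IsWeakDerivTorus (2 * Real.pi / ω) (fun t => wave ω Ψ α (0, t)) (traceDeriv ω α) := by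
  intro η hη hper
  have hd : Differentiable ℝ η := hη.differentiable (by simp)
  have hc : Continuous (deriv η) := hη.continuous_deriv (by simp)
  have h1 := h.hasSum_integral_trace hρ α hc (2 * Real.pi / ω)
  have h2 := (hasSum_integral_traceDeriv hω α hη.continuous hper).neg
  refine h1.unique (h2.congr_fun fun n => ?_)
  rw [integral_cos_mul_deriv hω n (fun t => (hd t).hasDerivAt) hc hper, neg_neg]

/-- Since `w` is continuous, its trace at `x = 0` is its restriction. -/
theorem isTraceAtZero (h : IsModeFamily g ω ρ M C Ψ Ψ₁ Ψ₂) (hρ : 0 < ρ) (α : DomJ)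
    {wx : ℝ × ℝ → ℝ} {T : ℝ} (hm : MemLp wx 2 (cylMeasure T))
    (hwx : ∀ q : ℝ × ℝ → ℝ, MemLp q 2 (cylMeasure T) →
      HasSum (fun n : ℕ => waveAmp ω α n *
        ∫ p, Real.sign p.1 * Ψ₁ n |p.1| * Real.cos (ω * n * p.2) * q p
        ∂cylMeasure T) (∫ p, wx p * q p ∂cylMeasure T)) :
    IsTraceAtZero T (wave ω Ψ α) wx fun t => wave ω Ψ α (0, t) := by
  have hcont : Continuous fun t => wave ω Ψ α (0, t) :=
    (h.continuous_wave hρ α).comp (Continuous.prodMk_right 0)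
  refine ⟨?_, fun ψ hψ => ?_⟩
  · obtain ⟨B, hB⟩ := (isCompact_Icc (a := 0) (b := T)).exists_bound_of_continuousOn
      hcont.continuousOn
    refine MemLp.of_bound hcont.aestronglyMeasurable B ?_
    rw [ae_restrict_iff' measurableSet_Ioc]
    exact Eventually.of_forall fun t ht => hB t (Ioc_subset_Icc_self ht)
  · have hset : volume.restrict (Ioi (0 : ℝ) ×ˢ Ioc 0 T) =
        (cylMeasure T).restrict (Ioi 0 ×ˢ univ) := by
      rw [cylMeasure, Measure.restrict_restrict (measurableSet_Ioi.prod MeasurableSet.univ),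
        prod_inter_prod, inter_univ, univ_inter]
    have i1 := integrable_cyl_mul (h.memLp_wave hρ α T) (memLp_rightHalf hψ.memLp_partialX)
    have i2 := integrable_cyl_mul hm (memLp_rightHalf hψ.memLp)
    have hsplit : ∫ p in Ioi 0 ×ˢ Ioc 0 T, (wave ω Ψ α p * partialX ψ p + wx p * ψ p) =
        ∫ p, wave ω Ψ α p * rightHalf (partialX ψ) p ∂cylMeasure T +
          ∫ p, wx p * rightHalf ψ p ∂cylMeasure T := by
      rw [hset, ← integral_indicator (measurableSet_Ioi.prod MeasurableSet.univ),
        ← integral_add i1 i2]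
      congr 1
      funext p
      by_cases hp : p ∈ Ioi (0 : ℝ) ×ˢ (univ : Set ℝ)
      · simp only [rightHalf, indicator_of_mem hp]
      · simp only [rightHalf, indicator_of_notMem hp, mul_zero, add_zero]
    rw [hsplit]
    have h1 := (h.hasSum_integral_wave hρ α (memLp_rightHalf hψ.memLp_partialX)).add
      (hwx _ (memLp_rightHalf hψ.memLp))
    have h2 := (h.hasSum_integral_trace hρ α (hψ.contDiff_right 0).continuous T).neg
    refine h1.unique (h2.congr_fun fun n => ?_)
    have h3 := (h.mode n).integral_rightHalf hρ (S := fun t => Real.cos (ω * n * t)) (by fun_prop)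
      (fun t => Real.abs_cos_le_one _) hψ
    rw [← mul_add, h3]
    linear_combination (-∫ t in Ioc 0 T, Real.cos (ω * n * t) * ψ (0, t)) *
      h.waveAmp_mul_apply_zero α n

theorem isH1Cyl (h : IsModeFamily g ω ρ M C Ψ Ψ₁ Ψ₂) (hω : 0 < ω) (hρ : 0 < ρ) (α : DomJ)
    {wx wt : ℝ × ℝ → ℝ} (hmx : MemLp wx 2 (cylMeasure (2 * Real.pi / ω)))
    (hmt : MemLp wt 2 (cylMeasure (2 * Real.pi / ω)))
    (hwx : ∀ q : ℝ × ℝ → ℝ, MemLp q 2 (cylMeasure (2 * Real.pi / ω)) →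
      HasSum (fun n : ℕ => waveAmp ω α n *
        ∫ p, Real.sign p.1 * Ψ₁ n |p.1| * Real.cos (ω * n * p.2) * q p
        ∂cylMeasure (2 * Real.pi / ω)) (∫ p, wx p * q p ∂cylMeasure (2 * Real.pi / ω)))
    (hwt : ∀ q : ℝ × ℝ → ℝ, MemLp q 2 (cylMeasure (2 * Real.pi / ω)) →
      HasSum (fun n : ℕ => waveAmp ω α n * ∫ p, -(ω * n) * Ψ n |p.1| * Real.sin (ω * n * p.2) * q p
        ∂cylMeasure (2 * Real.pi / ω)) (∫ p, wt p * q p ∂cylMeasure (2 * Real.pi / ω))) :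
    IsH1Cyl (2 * Real.pi / ω) (wave ω Ψ α) wx wt where
  periodic := wave_periodic hω α
  memLp := h.memLp_wave hρ α _
  memLp_x := hmx
  memLp_t := hmt
  weak_x ψ hψ := by
    refine (h.hasSum_integral_wave hρ α hψ.memLp_partialX).unique
      ((hwx ψ hψ.memLp).neg.congr_fun fun n => ?_)
    have h3 := (h.mode n).integral_partialX hρ (S := fun t => Real.cos (ω * n * t)) (by fun_prop)
      (fun t => Real.abs_cos_le_one _) hψ
    rw [eq_neg_of_add_eq_zero_left h3, mul_neg]
  weak_t ψ hψ := by
    refine (h.hasSum_integral_wave hρ α hψ.memLp_partialT).unique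
      ((hwt ψ hψ.memLp).neg.congr_fun fun n => ?_)
    rw [integral_cyl_cos_partialT hω n (A := fun x => Ψ n |x|)
      ((h.mode n).memLp_mul hρ (S := fun t => Real.cos (ω * n * t)) (by fun_prop)
        fun t => Real.abs_cos_le_one _)
      ((h.mode n).memLp_mul hρ (S := fun t => Real.sin (ω * n * t)) (by fun_prop)
        fun t => Real.abs_sin_le_one _) hψ, ← mul_neg, ← integral_const_mul, ← integral_neg]
    congr 2
    funext p
    ring

/-- If the cube of the profile of `α` satisfies the Euler-Lagrange equation, then the nonlinear
boundary term cancels the jump of the `x`-derivative, so that `wave` is a weak solution. -/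
theorem isWeakSolution (h : IsModeFamily g ω ρ M C Ψ Ψ₁ Ψ₂) (hω : 0 < ω) (hρ : 0 < ρ)
    (hg : MemLp g ∞ volume) (hev : ∀ᵐ x, g (-x) = g x) {γ : ℝ} (hγ : γ ≠ 0) (α : DomJ) {q : ℤ → ℝ}
    (hq : ∀ n : ℕ, Odd n → q n = 2 * Real.pi / ω / (γ * ω ^ 4) * (Ψ₁ n 0 / (n : ℝ) ^ 2))
    (hqs : ∀ k, q (-k) = q k)
    (hcube : HasSineCoeffs (fun s => α.profile s ^ 3) fun k => -2 * q k * α.seq k)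
    (hcube2 : MemLp (fun s => α.profile s ^ 3) 2 AddCircle.haarAddCircle) :
    IsWeakSolution g γ (2 * Real.pi / ω) (wave ω Ψ α) := by
  obtain ⟨wt, hmt, hwt⟩ := h.exists_wave_t hω hρ α
  obtain ⟨wx, hmx, hwx⟩ := h.exists_wave_x hω hρ α
  refine ⟨wx, wt, fun t => wave ω Ψ α (0, t), traceDeriv ω α, h.isH1Cyl hω hρ α hmx hmt hwx hwt,
    h.isTraceAtZero hρ α hmx hwx, h.isWeakDerivTorus hω hρ α, ?_, fun ψ hψ => ?_⟩
  · have h4 : MemLp α.profile 3 AddCircle.haarAddCircle :=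
      (Lp.memLp α.profile).mono_exponent (by norm_num)
    exact (DomJ.memLp_timeMk hω h4).const_mul _
  have hgψ : MemLp (fun p : ℝ × ℝ => -g p.1 * partialT ψ p) 2 (cylMeasure (2 * Real.pi / ω)) := by
    obtain ⟨G, hG0, hG⟩ := ae_abs_le_of_memLp_top hg
    refine (hψ.memLp_partialT.const_mul G).of_le
      ((aestronglyMeasurable_cyl_fst hg.1).neg.mul hψ.memLp_partialT.1) ?_
    filter_upwards [ae_cyl_fst hG] with p hp
    rw [norm_mul, norm_mul, norm_neg, Real.norm_of_nonneg hG0.le]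
    exact mul_le_mul_of_nonneg_right hp (norm_nonneg _)
  have hbulk : ∫ p, (-g p.1 * wt p * partialT ψ p + wx p * partialX ψ p)
      ∂cylMeasure (2 * Real.pi / ω) = ∫ p, wt p * (-g p.1 * partialT ψ p)
      ∂cylMeasure (2 * Real.pi / ω) + ∫ p, wx p * partialX ψ p ∂cylMeasure (2 * Real.pi / ω) := by
    rw [← integral_add (integrable_cyl_mul hmt hgψ) (integrable_cyl_mul hmx hψ.memLp_partialX)]
    congr 1
    funext p
    ring
  set T := 2 * Real.pi / ω with hT
  have hT0 : 0 < T := by positivity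
  set s := √T with hs
  have hs0 : 0 < s := Real.sqrt_pos.2 hT0
  have hs2 : s ^ 2 = T := Real.sq_sqrt hT0.le
  have hodd : ∀ k, -2 * q (-k) * α.seq (-k) = -(-2 * q k * α.seq k) := fun k => by
    rw [hqs, α.isDomJ.odd_symm]; ring
  have h1 := (hwt _ hgψ).add (hwx _ hψ.memLp_partialX)
  have h2 := (DomJ.hasSum_integral_timeMk_mul hω hcube hcube2 hodd
    (r := fun t => partialT ψ (0, t)) (hψ.continuous_partialT.comp (Continuous.prodMk_right 0))
    (hψ.partialT_periodic 0)).mul_left (γ * (-(ω / s)) ^ 3)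
  have hcubeint : γ * (-(ω / s)) ^ 3 * ∫ t in Ioc 0 T, α.profile (DomJ.timeMk ω t) ^ 3 *
      partialT ψ (0, t) = γ * ∫ t in Ioc 0 T, traceDeriv ω α t ^ 3 * partialT ψ (0, t) := by
    rw [mul_assoc, ← integral_const_mul]
    congr 2
    funext t
    rw [traceDeriv]
    ring
  rw [hcubeint] at h2
  rw [hbulk, sub_eq_zero]
  refine h1.unique (h2.congr_fun fun n => ?_)
  rw [← mul_add, (h.mode n).integral_weakForm hω n hρ hg hev hψ]
  simp only [mul_comm (partialT ψ _)]
  rw [integral_sin_mul_deriv hω n (hψ.hasDerivAt_partialT 0)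
    (hψ.continuous_partialT.comp (Continuous.prodMk_right 0)) (hψ.periodic 0)]
  by_cases hn : Odd n
  · have hn0 : (n : ℝ) ≠ 0 := by exact_mod_cast hn.pos.ne'
    rw [hq n hn, waveAmp, ← hT, ← hs]
    -- both sides are `-4 T^{-1/2} (α_n / n) Ψ_n'(0) ∫ cos(ωnt) ψ(0,t) dt`
    generalize ∫ t in Ioc 0 T, Real.cos (ω * n * t) * ψ (0, t) = I
    clear_value s
    rw [show T = s ^ 2 from hs2.symm]
    field_simp
  · have he : Even (n : ℤ) := by exact_mod_cast Nat.not_odd_iff_even.1 hn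
    rw [waveAmp_even ω α hn, α.isDomJ.even_zero n he]
    ring

/-- A nonzero sequence generates a nontrivial function, since the sine coefficients of the time
derivative of its trace are proportional to the sequence. -/
theorem wave_not_ae_zero (h : IsModeFamily g ω ρ M C Ψ Ψ₁ Ψ₂) (hω : 0 < ω) (hρ : 0 < ρ)
    {α : DomJ} (hα : α ≠ 0) : ¬ wave ω Ψ α =ᵐ[volume] 0 := by
  intro hw
  have hw0 : wave ω Ψ α = 0 :=
    (Continuous.ae_eq_iff_eq volume (h.continuous_wave hρ α) continuous_zero).1 hw
  have hnat : ∀ n : ℕ, α.seq n = 0 := by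
    intro n
    have h1 := h.isWeakDerivTorus hω hρ α (fun t => Real.sin (ω * n * t))
      (by fun_prop) (fun t => by
        rw [show ω * n * (t + 2 * Real.pi / ω) = ω * n * t + n * (2 * Real.pi) by field_simp,
          Real.sin_add_nat_mul_two_pi])
    have hm : AEStronglyMeasurable (fun s => α.profile s * DomJ.circleSin n s)
        AddCircle.haarAddCircle :=
      (Lp.aestronglyMeasurable α.profile).mul (DomJ.continuous_circleSin n).aestronglyMeasurable
    have h2 := DomJ.integral_timeMk hω hm
    simp only [DomJ.circleSin_timeMk, Int.cast_natCast,
      α.hasSineCoeffs_profile.integral_mul_circleSin (DomJ.integrable_circleL4 _) n] at h2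
    simp only [hw0, Pi.zero_apply, zero_mul, integral_zero, traceDeriv, mul_assoc,
      integral_const_mul] at h1
    simp only [mul_assoc] at h2
    rw [h2] at h1
    have hs0 : 0 < √(2 * Real.pi / ω) := Real.sqrt_pos.2 (by positivity)
    have := Real.pi_pos
    field_simp at h1
    simpa using h1
  refine hα (DomJ.ext_seq (funext fun k => ?_))
  rw [DomJ.seq_zero, Pi.zero_apply]
  rcases Int.eq_nat_or_neg k with ⟨n, rfl | rfl⟩
  · exact hnat n
  · rw [α.isDomJ.odd_symm, hnat n, neg_zero]

/-- The complex Fourier series over all integers has the real sum `wave`. -/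
theorem hasSum_fourierMode (h : IsModeFamily g ω ρ M C Ψ Ψ₁ Ψ₂) (hω : 0 < ω) (hρ : 0 < ρ) (α : DomJ)
    {Φ : ℕ → ℝ → ℝ} (hΦ : ∀ n, Odd n → ∀ x, 0 ≤ x → Φ n x = Ψ n x) (x t : ℝ) :
    HasSum (fun k : ℤ => ((α.seq k / k * Φ k.natAbs |x| : ℝ) : ℂ) * fourierMode ω k t)
      ((wave ω Ψ α (x, t) : ℝ) : ℂ) := by
  set f : ℤ → ℂ := fun k => ((α.seq k / k * Φ k.natAbs |x| : ℝ) : ℂ) * fourierMode ω k t with hf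
  have hΨ : ∀ k : ℤ, α.seq k / k * Φ k.natAbs |x| = α.seq k / k * Ψ k.natAbs |x| := by
    intro k
    rcases Int.even_or_odd k with hk | hk
    · rw [α.isDomJ.even_zero k hk]; simp
    · rw [hΦ _ (Int.natAbs_odd.2 hk) _ (abs_nonneg x)]
  have hexp : ∀ k : ℤ, fourierMode ω k t = ((1 / √(2 * Real.pi / ω) : ℝ) : ℂ) *
      (((Real.cos (ω * k * t) : ℝ) : ℂ) + ((Real.sin (ω * k * t) : ℝ) : ℂ) * Complex.I) := by
    intro k
    rw [fourierMode, show Complex.I * ω * k * t = ((ω * k * t : ℝ) : ℂ) * Complex.I by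
      push_cast; ring, Complex.exp_mul_I, Complex.ofReal_cos, Complex.ofReal_sin]
    push_cast
    rfl
  have hsum : Summable f := by
    refine Summable.of_norm_bounded (((summable_abs_seq_div α).mul_right
      (M * (1 / √(2 * Real.pi / ω))))) fun k => ?_
    have hn : ‖fourierMode ω k t‖ = 1 / √(2 * Real.pi / ω) := by
      rw [fourierMode, show Complex.I * ω * k * t = ((ω * k * t : ℝ) : ℂ) * Complex.I by
        push_cast; ring, norm_mul, Complex.norm_exp_ofReal_mul_I, mul_one, norm_div, norm_one,
        Complex.norm_real, Real.norm_of_nonneg (Real.sqrt_nonneg _)]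
    rw [hf]
    simp only
    rw [norm_mul, hn, hΨ, Complex.norm_real, Real.norm_eq_abs, abs_mul, mul_assoc]
    refine mul_le_mul_of_nonneg_left (mul_le_mul_of_nonneg_right ?_ (by positivity)) (abs_nonneg _)
    refine ((h.mode _).bound _ (abs_nonneg x)).trans ?_
    refine mul_le_of_le_one_right h.M_nonneg (Real.exp_le_one_iff.2 ?_)
    have := abs_nonneg x
    nlinarith
  have h1 := hsum.hasSum.nat_add_neg
  have hf0 : f 0 = 0 := by simp [hf]
  rw [hf0, add_zero] at h1
  have h2 : HasSum (fun n : ℕ => f n + f (-n)) ((wave ω Ψ α (x, t) : ℝ) : ℂ) := by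
    refine (Complex.hasSum_ofReal.2 (h.hasSum_wave hρ α (x, t))).congr_fun fun n => ?_
    simp only [hf, hΨ, hexp, waveAmp, α.isDomJ.odd_symm, Int.natAbs_neg, Int.natAbs_natCast,
      Int.cast_neg, Int.cast_natCast, mul_neg, neg_mul, Real.cos_neg, Real.sin_neg, neg_div_neg_eq]
    push_cast
    ring
  rw [← h1.unique h2]
  exact hsum.hasSum

end IsModeFamily

/-! ### The functional `J` under the standing assumptions -/

/-- Under (C2) the given solutions form a mode family, filled up by zero at even `n`. The bound
`C n` for the derivatives is the Landau inequality on intervals of length `1 / n`. -/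
theorem exists_isModeFamily {g : ℝ → ℝ} (hg : MemLp g ∞ volume) (ω : ℝ) {Φ : ℕ → ℝ → ℝ}
    (hΦ : ∀ k : ℕ, Odd k → IsDecayingSolution g ω k (Φ k)) (hC2 : CondC2 Φ) :
    ∃ (ρ M C : ℝ) (Ψ Ψ₁ Ψ₂ : ℕ → ℝ → ℝ), 0 < ρ ∧ 0 < C ∧ IsModeFamily g ω ρ M C Ψ Ψ₁ Ψ₂ ∧
      ∀ n, Odd n → Φ n = Ψ n ∧ derivZero (Φ n) = Ψ₁ n 0 := by
  obtain ⟨ρ, hρ, M, hM, hb⟩ := hC2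
  obtain ⟨C, hC, hD⟩ := exists_deriv_bound hg ω hM hρ
  have key : ∀ n : ℕ, ∃ ψ ψ₁ ψ₂ : ℝ → ℝ, IsMode g (ω * n) ρ M (C * n) ψ ψ₁ ψ₂ ∧
      (Odd n → Φ n = ψ ∧ ψ 0 = 1) := by
    intro n
    by_cases hn : Odd n
    · obtain ⟨φ₁, φ₂, h1, h2, h3, h4, h5⟩ := hD n (Φ n) hn.pos (hΦ n hn) (hb n hn)
      refine ⟨Φ n, φ₁, φ₂, ⟨h1, h2, ?_, hb n hn, h5⟩, fun _ => ⟨rfl, h4⟩⟩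
      filter_upwards [h3] with x hx hx0
      rw [hx hx0]; ring
    · have hz : IsHalfLinePrimitive 0 0 :=
        ⟨fun _ _ _ _ => intervalIntegrable_const (c := 0), fun _ _ _ _ => by simp⟩
      refine ⟨0, 0, 0, ⟨hz, hz, Eventually.of_forall fun x _ => by simp,
        fun x _ => ?_, fun x _ => ?_⟩, fun h => absurd h hn⟩
      · rw [Pi.zero_apply, abs_zero]; positivity
      · rw [Pi.zero_apply, abs_zero]; positivity
  choose Ψ Ψ₁ Ψ₂ hmode hodd using key
  refine ⟨ρ, M, C, Ψ, Ψ₁, Ψ₂, hρ, hC, ⟨hmode, fun n hn => (hodd n hn).2⟩, fun n hn =>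
    ⟨(hodd n hn).1, ?_⟩⟩
  rw [(hodd n hn).1]
  exact (hmode n).prim.derivZero_eq (hmode n).prim₁

/-- At a critical point the cube of the profile, a priori only in `L^{4/3}`, is square integrable,
because the Euler-Lagrange equation bounds its sine coefficients by those of the profile. -/
theorem DomJ.memLp_two_profile_cube {q : ℤ → ℝ} {K : ℝ} (hq : ∀ k, |q k| ≤ K) {α : DomJ}
    (h : HasSineCoeffs (fun s => α.profile s ^ 3) fun k => -2 * q k * α.seq k) :
    MemLp (fun s => α.profile s ^ 3) 2 AddCircle.haarAddCircle := by
  refine memLp_two_of_hasSineCoeffs h (integrable_profile_cube α) ?_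
  refine Summable.of_nonneg_of_le (fun k => sq_nonneg _) (fun k => ?_)
    (α.isDomJ.sq_summable.mul_left (4 * K ^ 2))
  have h1 : q k ^ 2 ≤ K ^ 2 := sq_le_sq' (abs_le.1 (hq k)).1 (abs_le.1 (hq k)).2
  rw [show (-2 * q k * α.seq k) ^ 2 = 4 * q k ^ 2 * α.seq k ^ 2 by ring]
  gcongr

theorem mainTheorem2 (g : ℝ → ℝ) (γ ω : ℝ) (hω : 0 < ω) (hC0 : CondC0 g γ) (hC1 : CondC1 g ω) :
    (∀ k : ℕ, Odd k → ∃ φ : ℝ → ℝ, IsDecayingSolution g ω k φ) ∧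
    ∀ Φ : ℕ → ℝ → ℝ, (∀ k : ℕ, Odd k → IsDecayingSolution g ω k (Φ k)) → CondC2 Φ →
      -- `J` is well defined: all sums in its definition converge
      (∀ z : DomJ, (∀ k, Summable fun l => z.seq l * z.seq (k - l)) ∧
        (Summable fun l => conv z.seq z.seq l * conv z.seq z.seq (0 - l)) ∧
        Summable fun k : ℤ => derivZero (Φ k.natAbs) / (k : ℝ) ^ 2 * z.seq k ^ 2) ∧
      Differentiable ℝ (functionalJ Φ γ ω) ∧
      BddBelow (Set.range (functionalJ Φ γ ω)) ∧
      Filter.Tendsto (functionalJ Φ γ ω) (Bornology.cobounded DomJ) Filter.atTop ∧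
      -- under (i) or (ii) a negative minimum is attained
      (((γ < 0 ∧ ∃ k : ℕ, Odd k ∧ 0 < derivZero (Φ k)) ∨
          (0 < γ ∧ ∃ k : ℕ, Odd k ∧ derivZero (Φ k) < 0)) →
        ∃ α : DomJ, (∀ z : DomJ, functionalJ Φ γ ω α ≤ functionalJ Φ γ ω z) ∧
          functionalJ Φ γ ω α < 0) ∧
      -- critical points give weak solutions, nontrivial ones if the critical point is nonzero
      ∀ α : DomJ, fderiv ℝ (functionalJ Φ γ ω) α = 0 →
        ∃ w : ℝ × ℝ → ℝ,
          (∀ x t : ℝ, HasSum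
            (fun k : ℤ => ((α.seq k / k * Φ k.natAbs |x| : ℝ) : ℂ) * fourierMode ω k t)
            ((w (x, t) : ℝ) : ℂ)) ∧
          IsWeakSolution g γ (2 * Real.pi / ω) w ∧
          (α ≠ 0 → ¬ w =ᵐ[MeasureTheory.volume] 0) := by
  obtain ⟨hg, hev, -, hγ⟩ := hC0
  refine ⟨fun k hk => exists_isDecayingSolution hg hev fun h => hC1 k hk (Or.inr h),
    fun Φ hΦ hC2 => ?_⟩
  obtain ⟨ρ, M, C, Ψ, Ψ₁, Ψ₂, hρ, hC, hmode, hΨ⟩ := exists_isModeFamily hg ω hΦ hC2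
  have hderiv : ∀ k : ℕ, Odd k → |derivZero (Φ k)| ≤ C * k := by
    intro k hk
    rw [(hΨ k hk).2]
    simpa using (hmode.mode k).bound₁ 0 le_rfl
  have hwt := DomJ.abs_weight_le_const hderiv hC.le
  set c := (2 * Real.pi / ω) / (γ * ω ^ 4) with hc
  -- the weights of the quadratic part, bounded and tending to zero
  have hq : ∀ k, |c * DomJ.weight Φ k| ≤ |c| * C := fun k => by
    rw [abs_mul]
    exact mul_le_mul_of_nonneg_left (hwt k) (abs_nonneg c)
  have hq0 : Tendsto (fun k => c * DomJ.weight Φ k) cofinite (𝓝 0) := by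
    simpa using (DomJ.tendsto_weight hderiv hC.le).const_mul c
  have hqs : ∀ k, c * DomJ.weight Φ (-k) = c * DomJ.weight Φ k := fun k => by
    rw [DomJ.weight_neg]
  have hqn : ∀ n : ℕ, Odd n → c * DomJ.weight Φ n = c * (derivZero (Φ n) / (n : ℝ) ^ 2) := by
    intro n hn
    have hn' : Odd (n : ℤ) := by exact_mod_cast hn
    rw [DomJ.weight, if_pos hn', Int.natAbs_natCast, Int.cast_natCast]
  rw [DomJ.functionalJ_eq hq]
  refine ⟨fun z => ⟨z.isDomJ.summable_conv, ?_, ?_⟩, DomJ.differentiable_quarticFunctional hq,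
    DomJ.bddBelow_quarticFunctional hq, DomJ.tendsto_quarticFunctional hq, fun hneg => ?_,
    fun α hα => ?_⟩
  · exact z.isDomJ.summable_sq.congr fun l => (DomJ.conv_mul_conv z l).symm
  · exact (DomJ.summable_weighted_mul hwt z z).congr fun k => (DomJ.weight_mul Φ z k).symm
  · have hn : ∃ n : ℕ, Odd n ∧ c * (derivZero (Φ n) / (n : ℝ) ^ 2) < 0 := by
      have hT : 0 < 2 * Real.pi / ω := by positivity
      rcases hneg with ⟨hγ', n, hn, hd⟩ | ⟨hγ', n, hn, hd⟩
      · have hn0 : (0 : ℝ) < n := by exact_mod_cast hn.pos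
        exact ⟨n, hn, mul_neg_of_neg_of_pos
          (div_neg_of_pos_of_neg hT (mul_neg_of_neg_of_pos hγ' (by positivity))) (by positivity)⟩
      · have hn0 : (0 : ℝ) < n := by exact_mod_cast hn.pos
        exact ⟨n, hn, mul_neg_of_pos_of_neg (by positivity)
          (div_neg_of_neg_of_pos hd (by positivity))⟩
    obtain ⟨n, hn, hd⟩ := hn
    rw [← hqn n hn] at hd
    obtain ⟨α, hα⟩ := DomJ.exists_isMin_quarticFunctional hq hq0
    obtain ⟨z, hz⟩ := DomJ.exists_quarticFunctional_neg hq (n := n) (by exact_mod_cast hn) hd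
      (by rwa [hqs])
    exact ⟨α, hα, (hα z).trans_lt hz⟩
  · have hcube := DomJ.hasSineCoeffs_cube_of_critical hq hqs hα
    refine ⟨wave ω Ψ α, hmode.hasSum_fourierMode hω hρ α fun n hn x _ => by rw [(hΨ n hn).1],
      hmode.isWeakSolution hω hρ hg hev hγ α (fun n hn => ?_) hqs hcube
        (DomJ.memLp_two_profile_cube hq hcube), hmode.wave_not_ae_zero hω hρ⟩
    rw [hqn n hn, (hΨ n hn).2]
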